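/- Let $b>1$, $c>0$ and $k\in\left(0,(b+1)^{-1}c\right)$. Let $\phi\in C^\infty(\mathbb{R})$ be the profile of the smooth solitary wave of the $b$-Camassa--Holm equation with speed $c$ on the background $k$, that is, a non-constant smooth real solution of $$-(c-\phi)(\phi'''-\phi')+b\,\phi'(\phi''-\phi)=0,\qquad \phi'(0)=0,\qquad \phi(x)\to k\ \text{ as } |x|\to\infty,$$ and let $\mu:=\phi-\phi''$. Consider the Sturm--Liouville operator $$\mathcal{L}=-\frac{d}{dx}\,\frac{c-\phi}{\mu^2}\,\frac{d}{dx}+\frac{(b+1)(c-\phi)}{2\mu^2}+\frac{(2b+1)(c-\phi)\mu''}{b\mu^3}-\frac{(2b+1)(3b+1)(c-\phi)(\mu')^2}{2b^2\mu^4}-\frac{(c-k)\left[(b-1)c+(b+1)k\right]}{2(c-\phi)\mu^2}.$$ Then $\mathcal{L}$, defined classically on $C_c^\infty(\mathbb{R})$, extends to a self-adjoint operator in $L^2(\mathbb{R})$ with the dense domain $H^2(\mathbb{R})$, on which it acts by the same expression with weak derivatives. Its essential spectrum (the spectrum without the isolated eigenvalues of finite multiplicity) is $\left[k^{-2}(c-(b+1)k),\infty\right)$.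 There exists $\delta>0$ such that the part of the spectrum of $\mathcal{L}$ below $\delta$ consists of exactly two points, a simple negative eigenvalue and a simple eigenvalue $0$. Moreover $\mu'\in L^2(\mathbb{R})$ and the kernel of $\mathcal{L}$ is spanned by $\mu'$. -/

import Mathlib

open MeasureTheory TemperedDistribution LineDeriv Filter
open scoped SchwartzMap Topology ContDiff

noncomputable section

namespace BCH

/-! ### The smooth solitary wave -/

/-- `φ` is the profile of a smooth solitary wave `u(t, x) = φ (x - c t)` of the `b`-family of
Camassa--Holm equations on the constant background `k`, normalised by `φ' 0 = 0`: a smooth,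
non-constant solution of the travelling wave equation
`-(c - φ) (φ''' - φ') + b φ' (φ'' - φ) = 0` with `φ x → k` as `|x| → ∞`. -/
structure IsSolitaryWave (b c k : ℝ) (φ : ℝ → ℝ) : Prop where
  smooth : ContDiff ℝ ∞ φ
  equation : ∀ x, -(c - φ x) * (iteratedDeriv 3 φ x - deriv φ x)
    + b * deriv φ x * (iteratedDeriv 2 φ x - φ x) = 0
  deriv_zero : deriv φ 0 = 0
  tendsto_atTop : Tendsto φ atTop (𝓝 k)
  tendsto_atBot : Tendsto φ atBot (𝓝 k)
  nonconstant : ∃ x, φ x ≠ k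

/-- The momentum density `μ = φ - φ''` of the profile `φ`. -/
def momentum (φ : ℝ → ℝ) (x : ℝ) : ℝ := φ x - iteratedDeriv 2 φ x

/-! ### Sturm--Liouville operators in `L²(ℝ)` -/

/-- The complex Hilbert space `L²(ℝ)`. -/
abbrev L2 : Type := Lp ℂ 2 (volume : Measure ℝ)

/-- `v ∈ L²(ℝ)` is the derivative of `u ∈ L²(ℝ)` in the sense of (tempered) distributions. -/
def IsWeakDeriv (u v : L2) : Prop := ∂_{(1 : ℝ)} (u : 𝓢'(ℝ, ℂ)) = (v : 𝓢'(ℝ, ℂ))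

theorem coe_add (u v : L2) :
    ((u + v : L2) : 𝓢'(ℝ, ℂ)) = (u : 𝓢'(ℝ, ℂ)) + (v : 𝓢'(ℝ, ℂ)) := by
  simp only [← Lp.toTemperedDistributionCLM_apply, map_add]

theorem coe_smul (a : ℂ) (u : L2) : ((a • u : L2) : 𝓢'(ℝ, ℂ)) = a • (u : 𝓢'(ℝ, ℂ)) := by
  simp only [← Lp.toTemperedDistributionCLM_apply, map_smul]

theorem coe_zero : ((0 : L2) : 𝓢'(ℝ, ℂ)) = 0 := by
  simp only [← Lp.toTemperedDistributionCLM_apply, map_zero]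

theorem eq_zero_of_coe_eq_zero {u : L2} (h : (u : 𝓢'(ℝ, ℂ)) = 0) : u = 0 := by
  have h1 := Lp.ker_toTemperedDistributionCLM_eq_bot (F := ℂ) (E := ℝ) (μ := volume) (p := 2)
  rw [LinearMap.ker_eq_bot'] at h1
  exact h1 u h

theorem IsWeakDeriv.add {u v u' v' : L2} (h : IsWeakDeriv u u') (h' : IsWeakDeriv v v') :
    IsWeakDeriv (u + v) (u' + v') := by
  unfold IsWeakDeriv at *
  rw [coe_add, coe_add, lineDerivOp_add, h, h']

theorem IsWeakDeriv.smul (a : ℂ) {u u' : L2} (h : IsWeakDeriv u u') :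
    IsWeakDeriv (a • u) (a • u') := by
  unfold IsWeakDeriv at *
  rw [coe_smul, coe_smul, lineDerivOp_smul, h]

theorem isWeakDeriv_zero : IsWeakDeriv 0 0 := by
  have h : ∂_{(1 : ℝ)} ((0 : 𝓢'(ℝ, ℂ)) + 0) = ∂_{(1 : ℝ)} (0 : 𝓢'(ℝ, ℂ)) +
      ∂_{(1 : ℝ)} (0 : 𝓢'(ℝ, ℂ)) :=
    lineDerivOp_add _ _ _
  rw [add_zero, left_eq_add] at h
  rw [IsWeakDeriv, coe_zero, h]

theorem IsWeakDeriv.eq_zero {v : L2} (h : IsWeakDeriv 0 v) : v = 0 := by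
  apply eq_zero_of_coe_eq_zero
  rw [← h, isWeakDeriv_zero, coe_zero]

/-- The Sobolev space `H²(ℝ)` as a subspace of `L²(ℝ)`. -/
def sobolevH2 : Submodule ℂ L2 where
  carrier := {u | MemSobolev 2 2 (u : 𝓢'(ℝ, ℂ))}
  zero_mem' := by
    rw [Set.mem_ofPred_eq, coe_zero]
    exact memSobolev_fun_zero ℝ ℂ 2 2
  add_mem' hu hv := by
    rw [Set.mem_ofPred_eq, coe_add]
    exact hu.add hv
  smul_mem' a _ hu := by
    rw [Set.mem_ofPred_eq, coe_smul]
    exact hu.smul a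

/-- The graph of the Sturm--Liouville operator `u ↦ -(p u')' + q u`: all pairs `(u, f)` with
`u ∈ H²(ℝ)` and `f ∈ L²(ℝ)` such that `p u' ∈ L²(ℝ)` has a derivative in `L²(ℝ)` and
`f = -(p u')' + q u` almost everywhere. Here `v = u'`, `z = p u'` and `w = (p u')'`. -/
def sturmLiouvilleGraph (p q : ℝ → ℝ) : Submodule ℂ (L2 × L2) where
  carrier := {x | x.1 ∈ sobolevH2 ∧ ∃ v z w : L2, IsWeakDeriv x.1 v ∧
    (∀ᵐ t, z t = (p t : ℂ) * v t) ∧ IsWeakDeriv z w ∧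
    ∀ᵐ t, x.2 t = -w t + (q t : ℂ) * x.1 t}
  zero_mem' := by
    refine ⟨sobolevH2.zero_mem, 0, 0, 0, isWeakDeriv_zero, ?_, isWeakDeriv_zero, ?_⟩
    · filter_upwards with t
      simp
    · filter_upwards with t
      simp
  add_mem' := by
    rintro ⟨u₁, f₁⟩ ⟨u₂, f₂⟩ ⟨hu₁, v₁, z₁, w₁, hv₁, hz₁, hw₁, hf₁⟩
      ⟨hu₂, v₂, z₂, w₂, hv₂, hz₂, hw₂, hf₂⟩
    refine ⟨sobolevH2.add_mem hu₁ hu₂, v₁ + v₂, z₁ + z₂, w₁ + w₂, hv₁.add hv₂, ?_,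
      hw₁.add hw₂, ?_⟩
    · filter_upwards [hz₁, hz₂, Lp.coeFn_add z₁ z₂, Lp.coeFn_add v₁ v₂] with t h1 h2 h3 h4
      rw [h3, h4, Pi.add_apply, Pi.add_apply, h1, h2]
      ring
    · filter_upwards [hf₁, hf₂, Lp.coeFn_add f₁ f₂, Lp.coeFn_add w₁ w₂, Lp.coeFn_add u₁ u₂]
        with t h1 h2 h3 h4 h5
      simp only [Prod.mk_add_mk] at h1 h2 ⊢
      rw [h3, h4, h5, Pi.add_apply, Pi.add_apply, Pi.add_apply, h1, h2]
      ring
  smul_mem' := by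
    rintro a ⟨u, f⟩ ⟨hu, v, z, w, hv, hz, hw, hf⟩
    refine ⟨sobolevH2.smul_mem a hu, a • v, a • z, a • w, hv.smul a, ?_, hw.smul a, ?_⟩
    · filter_upwards [hz, Lp.coeFn_smul a z, Lp.coeFn_smul a v] with t h1 h2 h3
      rw [h2, h3, Pi.smul_apply, Pi.smul_apply, h1, smul_eq_mul, smul_eq_mul]
      ring
    · filter_upwards [hf, Lp.coeFn_smul a f, Lp.coeFn_smul a w, Lp.coeFn_smul a u]
        with t h1 h2 h3 h4
      simp only [Prod.smul_mk] at h1 ⊢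
      rw [h2, h3, h4, Pi.smul_apply, Pi.smul_apply, Pi.smul_apply, h1, smul_eq_mul, smul_eq_mul,
        smul_eq_mul]
      ring

theorem sturmLiouvilleGraph_functional (p q : ℝ → ℝ) (x : L2 × L2)
    (hx : x ∈ sturmLiouvilleGraph p q) (hx' : x.1 = 0) : x.2 = 0 := by
  obtain ⟨u, f⟩ := x
  obtain ⟨-, v, z, w, hv, hz, hw, hf⟩ := hx
  simp only at hx' hv hf ⊢
  subst hx'
  obtain rfl := hv.eq_zero
  have hz0 : z = 0 := by
    apply Lp.ext
    filter_upwards [hz, Lp.coeFn_zero ℂ 2 (volume : Measure ℝ)] with t h1 h2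
    rw [h1, h2]
    simp
  subst hz0
  obtain rfl := hw.eq_zero
  apply Lp.ext
  filter_upwards [hf, Lp.coeFn_zero ℂ 2 (volume : Measure ℝ)] with t h1 h2
  rw [h1, h2]
  simp

/-- The Sturm--Liouville operator `u ↦ -(p u')' + q u` in `L²(ℝ)`, defined for all `u ∈ H²(ℝ)`
for which `-(p u')' + q u` lies in `L²(ℝ)`. -/
def sturmLiouville (p q : ℝ → ℝ) : L2 →ₗ.[ℂ] L2 := (sturmLiouvilleGraph p q).toLinearPMap

theorem sturmLiouville_graph (p q : ℝ → ℝ) :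
    (sturmLiouville p q).graph = sturmLiouvilleGraph p q :=
  Submodule.toLinearPMap_graph_eq _ (sturmLiouvilleGraph_functional p q)

/-! ### The Hessian operator at the solitary wave -/

/-- The coefficient `p = (c - φ) / μ²` of the Hessian operator. -/
def hessianP (c : ℝ) (φ : ℝ → ℝ) (x : ℝ) : ℝ := (c - φ x) / momentum φ x ^ 2

/-- The potential `q` of the Hessian operator. -/
def hessianQ (b c k : ℝ) (φ : ℝ → ℝ) (x : ℝ) : ℝ :=
  (b + 1) * (c - φ x) / (2 * momentum φ x ^ 2)
    + (2 * b + 1) * (c - φ x) * iteratedDeriv 2 (momentum φ) x / (b * momentum φ x ^ 3)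
    - (2 * b + 1) * (3 * b + 1) * (c - φ x) * deriv (momentum φ) x ^ 2
        / (2 * b ^ 2 * momentum φ x ^ 4)
    - (c - k) * ((b - 1) * c + (b + 1) * k) / (2 * (c - φ x) * momentum φ x ^ 2)

/-- The Hessian operator `𝓛 = -d/dx p d/dx + q` in `L²(ℝ)`. -/
def hessian (b c k : ℝ) (φ : ℝ → ℝ) : L2 →ₗ.[ℂ] L2 :=
  sturmLiouville (hessianP c φ) (hessianQ b c k φ)

/-! ### Spectral theory of unbounded operators -/

variable {E : Type*} [NormedAddCommGroup E] [InnerProductSpace ℂ E]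

/-- The resolvent set: all `z` for which `T - z` maps the domain of `T` bijectively onto the whole
space with a bounded inverse `R`. -/
def resolventSet (T : E →ₗ.[ℂ] E) : Set ℂ :=
  {z | ∃ R : E →L[ℂ] E,
    (∀ f : E, ∃ h : R f ∈ T.domain, T ⟨R f, h⟩ - z • R f = f) ∧
    ∀ u : T.domain, R (T u - z • (u : E)) = u}

/-- The spectrum of an unbounded operator. -/
def spectrum (T : E →ₗ.[ℂ] E) : Set ℂ := (resolventSet T)ᶜ

/-- The eigenspace `{u ∈ dom T : T u = z u}`, as a subspace of the whole space. -/
def eigenspace (T : E →ₗ.[ℂ] E) (z : ℂ) : Submodule ℂ E :=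
  (LinearMap.ker (T.toFun - z • T.domain.subtype)).map T.domain.subtype

/-- `z` is a simple eigenvalue of `T`: the eigenspace is one-dimensional and there are no further
generalized eigenvectors. -/
def IsSimpleEigenvalue (T : E →ₗ.[ℂ] E) (z : ℂ) : Prop :=
  Module.finrank ℂ (eigenspace T z) = 1 ∧
    ∀ u : T.domain, T u - z • (u : E) ∈ eigenspace T z → (u : E) ∈ eigenspace T z

/-- The discrete spectrum of a self-adjoint operator: the isolated points of the spectrum that are
eigenvalues of finite multiplicity. -/
def discreteSpectrum (T : E →ₗ.[ℂ] E) : Set ℂ :=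
  {z | (∃ ε > 0, spectrum T ∩ Metric.ball z ε = {z}) ∧ eigenspace T z ≠ ⊥ ∧
    FiniteDimensional ℂ (eigenspace T z)}

/-- The essential spectrum of a self-adjoint operator: the complement in the spectrum of the
discrete spectrum. -/
def essentialSpectrum (T : E →ₗ.[ℂ] E) : Set ℂ := spectrum T \ discreteSpectrum T

end BCH

end

/-! The Hessian is a Sturm--Liouville operator `-(p u')' + q u` with an explicit null solution, and
Sturm's oscillation argument locates `0` as its second eigenvalue.

The profile: the wave equation reads `(c - φ) μ' = b φ' μ`, so `(c - φ) ^ b * μ` is constant, equal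
to `k (c - k) ^ b` (`flux_eq_of_lt`). Hence `φ` never reaches `c` (`lt_speed`), `μ` is a function of
`φ`, and `φ'' = φ - μ` has a first integral. Concavity of `s ↦ s - k ((c - k) / (c - s)) ^ b`
together with `(b + 1) k < c` gives `φ'' < 0` at every critical point
(`sub_momentum_neg_of_deriv_eq_zero`), so `φ'` vanishes only at `0`.

The null solution: `w = μ' = b φ' μ / (c - φ)` solves the equation (`hasDerivAt_hessianP_mul`), is
square integrable and changes sign exactly once, at `0`. For `U` vanishing at `0`, Jacobi's identity
rewrites the form as the integral of `p |U' - (w' / w) U|²` (`form_eq`). The form is therefore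
nonnegative in codimension one, which leaves room for at most one negative eigenvalue, and a simple
one. If the form were nonnegative everywhere, then `|w|`, a limit of domain elements whose forms
tend to `0`, would lie in the kernel; but the kernel is spanned by `w` (`eigenspace_zero`), since a
Wronskian with zero derivative lying in `L²` vanishes, and `w` changes sign (`exists_form_neg`).

The rest of the spectrum: `q` tends to `L = (c - (b + 1) k) / k ^ 2 > 0` at both ends. For `a < L` a
Poincaré inequality on a fine mesh bounds the form below by `a` modulo finite rank (`hasFormBound`),
so the spectrum below `a` consists of finitely many eigenvalues of finite multiplicity
(`mem_resolventSet_of_hasFormBound`, `finite_eigenvalues_of_hasFormBound`). Wave packets escaping to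
infinity put all of `[L, ∞)` into the spectrum (`mem_spectrum_of_tendsto`). Self-adjointness follows
from symmetry and the surjectivity of `T + r` for large real `r` (`exists_sub_smul_eq`). -/

namespace BCH

/-! ### Self-adjoint operators whose form is bounded below modulo finite rank -/

section Abstract

variable {E : Type*} [NormedAddCommGroup E] [InnerProductSpace ℂ E]

open scoped ComplexConjugate InnerProductSpace

theorem inner_self_eq_ofReal (x : E) : ⟪x, x⟫_ℂ = ((‖x‖ ^ 2 : ℝ) : ℂ) := by
  rw [inner_self_eq_norm_sq_to_K]
  push_cast
  rfl

/-- `T` is symmetric with respect to the inner product. -/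
def IsSymm (T : E →ₗ.[ℂ] E) : Prop :=
  ∀ x y : T.domain, ⟪T x, (y : E)⟫_ℂ = ⟪(x : E), T y⟫_ℂ

theorem IsSymm.im_inner {T : E →ₗ.[ℂ] E} (hT : IsSymm T) (u : T.domain) :
    (⟪(u : E), T u⟫_ℂ).im = 0 := by
  have h := inner_conj_symm (𝕜 := ℂ) (u : E) (T u)
  rw [hT u u] at h
  exact Complex.conj_eq_iff_im.1 h

theorem IsSymm.inner_eq_re {T : E →ₗ.[ℂ] E} (hT : IsSymm T) (u : T.domain) :
    ⟪(u : E), T u⟫_ℂ = ((⟪(u : E), T u⟫_ℂ).re : ℂ) := by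
  apply Complex.ext
  · simp
  · simp [hT.im_inner u]

theorem isSymm_of_isSelfAdjoint [CompleteSpace E] {T : E →ₗ.[ℂ] E} (hT : IsSelfAdjoint T) :
    IsSymm T := by
  have h := LinearPMap.adjoint_isFormalAdjoint hT.dense_domain
  rw [LinearPMap.isSelfAdjoint_def.1 hT] at h
  exact h

/-- For `v` in the adjoint domain, surjectivity provides `u` in the domain with the same image under
`T + r` as `v` has under the adjoint plus `r`. Then `v - u` is orthogonal to the range of `T + r`,
which is the whole space, so `v = u`. -/
theorem isSelfAdjoint_of_symm_of_surjective [CompleteSpace E] {T : E →ₗ.[ℂ] E}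
    (hd : Dense (T.domain : Set E)) (hT : IsSymm T) (r : ℝ)
    (hs : ∀ f : E, ∃ u : T.domain, T u + (r : ℂ) • (u : E) = f) : IsSelfAdjoint T := by
  rw [LinearPMap.isSelfAdjoint_def]
  have hle : T ≤ T.adjoint := LinearPMap.IsFormalAdjoint.le_adjoint hd hT
  symm
  apply LinearPMap.eq_of_le_of_domain_eq hle
  apply le_antisymm hle.1
  intro v hv
  obtain ⟨u, hu⟩ := hs (T.adjoint ⟨v, hv⟩ + (r : ℂ) • v)
  have key : ∀ x : T.domain, ⟪T x + (r : ℂ) • (x : E), v - u⟫_ℂ = 0 := by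
    intro x
    have h1 : ⟪T x, v⟫_ℂ = ⟪(x : E), T.adjoint ⟨v, hv⟩⟫_ℂ := by
      have := LinearPMap.adjoint_isFormalAdjoint hd ⟨v, hv⟩ x
      rw [← inner_conj_symm, ← this, inner_conj_symm]
    have h2 := congrArg (fun y => ⟪(x : E), y⟫_ℂ) hu
    simp only [inner_add_right, inner_smul_right] at h2
    rw [inner_add_left, inner_sub_right, inner_sub_right, inner_smul_left, inner_smul_left,
      h1, hT x u, Complex.conj_ofReal]
    linear_combination -h2
  obtain ⟨x, hx⟩ := hs (v - u)
  have := key x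
  rw [hx, inner_self_eq_zero, sub_eq_zero] at this
  rw [this]
  exact u.2

/-- Pythagoras: by symmetry the cross term of `(T - Re z) u` and `i (Im z) u` is purely imaginary.
-/
theorem IsSymm.norm_sub_smul_sq {T : E →ₗ.[ℂ] E} (hT : IsSymm T) (z : ℂ) (u : T.domain) :
    ‖T u - z • (u : E)‖ ^ 2 = ‖T u - (z.re : ℂ) • (u : E)‖ ^ 2 + z.im ^ 2 * ‖(u : E)‖ ^ 2 := by
  have h : T u - z • (u : E) = (T u - (z.re : ℂ) • (u : E)) - (z.im * Complex.I) • (u : E) := by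
    rw [sub_sub, ← add_smul, Complex.re_add_im]
  have h0 : RCLike.re ⟪T u - (z.re : ℂ) • (u : E), ((z.im : ℂ) * Complex.I) • (u : E)⟫_ℂ = 0 := by
    rw [inner_smul_right, inner_sub_left, inner_smul_left, hT u u, hT.inner_eq_re u,
      inner_self_eq_ofReal]
    simp only [Complex.conj_ofReal]
    have : (z.im : ℂ) * Complex.I * (((⟪(u : E), T u⟫_ℂ).re : ℂ) - (z.re : ℂ) * ((‖(u : E)‖ ^ 2 : ℝ) : ℂ))
      = ((z.im * ((⟪(u : E), T u⟫_ℂ).re - z.re * ‖(u : E)‖ ^ 2) : ℝ) : ℂ) * Complex.I := by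
      push_cast; ring
    change Complex.re _ = 0
    rw [this, Complex.re_ofReal_mul, Complex.I_re, mul_zero]
  rw [h, @norm_sub_sq ℂ, h0, norm_smul, norm_mul, Complex.norm_I, Complex.norm_real, mul_one,
    mul_pow, Real.norm_eq_abs, sq_abs]
  ring

theorem mem_eigenspace_iff {T : E →ₗ.[ℂ] E} {z : ℂ} {x : E} :
    x ∈ eigenspace T z ↔ ∃ u : T.domain, T u = z • (u : E) ∧ (u : E) = x := by
  simp only [eigenspace, Submodule.mem_map, LinearMap.mem_ker, LinearMap.sub_apply,
    LinearMap.smul_apply, Submodule.subtype_apply, sub_eq_zero]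
  rfl

/-- The lower bound gives injectivity and, since the graph is closed, a closed range. A vector
orthogonal to the range lies in the adjoint domain and is an eigenvector for `conj z`, so the range
is everything. -/
theorem mem_resolventSet_of_bounded_below [CompleteSpace E] {T : E →ₗ.[ℂ] E}
    (hT : IsSelfAdjoint T) {z : ℂ} {c : ℝ} (hc : 0 < c)
    (hb : ∀ u : T.domain, c * ‖(u : E)‖ ≤ ‖T u - z • (u : E)‖)
    (hi : ∀ u : T.domain, T u = conj z • (u : E) → u = 0) : z ∈ resolventSet T := by
  set S : T.domain →ₗ[ℂ] E := T.toFun - z • T.domain.subtype with hS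
  have hSa : ∀ u, S u = T u - z • (u : E) := fun u => rfl
  have hinj : Function.Injective S := by
    rw [← LinearMap.ker_eq_bot, LinearMap.ker_eq_bot']
    intro u hu
    have := hb u
    rw [← hSa, hu, norm_zero] at this
    have h2 : ‖(u : E)‖ = 0 := by nlinarith [norm_nonneg (u : E)]
    exact Subtype.ext (norm_eq_zero.1 h2)
  have hclosed : IsClosed (LinearMap.range S : Set E) := by
    apply isClosed_of_closure_subset
    intro f hf
    rw [mem_closure_iff_seq_limit] at hf
    obtain ⟨y, hy, hlim⟩ := hf
    choose u hu using hy
    have hcau : CauchySeq (fun n => (u n : E)) := by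
      have h1 := hlim.cauchySeq
      rw [Metric.cauchySeq_iff'] at h1 ⊢
      intro ε hε
      obtain ⟨N, hN⟩ := h1 (c * ε) (by positivity)
      refine ⟨N, fun n hn => ?_⟩
      have h2 := hN n hn
      have h3 := hb (u n - u N)
      rw [← hSa, map_sub, hu, hu] at h3
      rw [dist_eq_norm] at h2 ⊢
      rw [AddSubgroupClass.coe_sub] at h3
      nlinarith
    obtain ⟨x, hx⟩ := cauchySeq_tendsto_of_complete hcau
    have hTu : Tendsto (fun n => T (u n)) atTop (𝓝 (f + z • x)) := by
      have : (fun n => T (u n)) = fun n => y n + z • (u n : E) := by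
        funext n
        rw [← hu n, hSa]; abel
      rw [this]
      exact hlim.add (hx.const_smul z)
    have hmem : (x, f + z • x) ∈ T.graph := by
      refine hT.isClosed.mem_of_tendsto (hx.prodMk_nhds hTu) (Eventually.of_forall fun n => ?_)
      exact T.mem_graph (u n)
    obtain ⟨w, hw1, hw2⟩ := (LinearPMap.mem_graph_iff T).1 hmem
    simp only at hw1 hw2
    refine ⟨w, ?_⟩
    rw [hSa, hw2, hw1]; abel
  have htop : LinearMap.range S = ⊤ := by
    have := hclosed.completeSpace_coe
    rw [← Submodule.orthogonal_eq_bot_iff, Submodule.eq_bot_iff]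
    intro v hv
    -- Orthogonality to the range says exactly that `v` is in the adjoint domain with image `conj z
    -- • v`.
    have hv' : ∀ u : T.domain, ⟪T u - z • (u : E), v⟫_ℂ = 0 := fun u =>
      (Submodule.mem_orthogonal _ _).1 hv _ ⟨u, rfl⟩
    have h1 : ∀ x : T.domain, ⟪conj z • v, (x : E)⟫_ℂ = ⟪v, T x⟫_ℂ := by
      intro x
      have := hv' x
      rw [← inner_conj_symm, map_eq_zero, inner_sub_right, inner_smul_right, sub_eq_zero] at this
      rw [this, inner_smul_left, Complex.conj_conj]
    have h2 : v ∈ T.adjoint.domain := LinearPMap.mem_adjoint_domain_of_exists v ⟨_, h1⟩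
    have h3 : T.adjoint ⟨v, h2⟩ = conj z • v := LinearPMap.adjoint_apply_eq hT.dense_domain _ h1
    have h4 : (v, conj z • v) ∈ T.adjoint.graph := by
      rw [LinearPMap.mem_graph_iff]
      exact ⟨⟨v, h2⟩, rfl, h3⟩
    rw [LinearPMap.isSelfAdjoint_def.1 hT, LinearPMap.mem_graph_iff] at h4
    obtain ⟨w, hw1, hw2⟩ := h4
    simp only at hw1 hw2
    rw [← hw1] at hw2
    rw [← hw1, hi w hw2]
    rfl
  let e := LinearEquiv.ofBijective S ⟨hinj, LinearMap.range_eq_top.1 htop⟩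
  have he : ∀ f, T (e.symm f) - z • (e.symm f : E) = f := fun f => e.apply_symm_apply f
  let R : E →L[ℂ] E := LinearMap.mkContinuous (T.domain.subtype ∘ₗ e.symm.toLinearMap) c⁻¹ (by
    intro f
    have := hb (e.symm f)
    rw [he] at this
    rw [inv_mul_eq_div, le_div_iff₀ hc, mul_comm]
    exact this)
  refine ⟨R, fun f => ⟨(e.symm f).2, he f⟩, fun u => ?_⟩
  exact congrArg Subtype.val (e.symm_apply_apply u)

theorem mem_resolventSet_of_im_ne_zero [CompleteSpace E] {T : E →ₗ.[ℂ] E}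
    (hT : IsSelfAdjoint T) {z : ℂ} (hz : z.im ≠ 0) : z ∈ resolventSet T := by
  have hs := isSymm_of_isSelfAdjoint hT
  have hb : ∀ (z : ℂ) (u : T.domain), |z.im| * ‖(u : E)‖ ≤ ‖T u - z • (u : E)‖ := by
    intro z u
    apply le_of_sq_le_sq _ (norm_nonneg _)
    rw [hs.norm_sub_smul_sq z u, mul_pow, sq_abs]
    nlinarith [sq_nonneg ‖T u - (z.re : ℂ) • (u : E)‖]
  refine mem_resolventSet_of_bounded_below hT (abs_pos.2 hz) (hb z) fun u hu => ?_
  have h := hb (conj z) u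
  rw [hu, sub_self, norm_zero, Complex.conj_im, abs_neg] at h
  have : ‖(u : E)‖ = 0 := by nlinarith [norm_nonneg (u : E), abs_pos.2 hz]
  exact Subtype.ext (norm_eq_zero.1 this)

theorem spectrum_eq_ofReal_re [CompleteSpace E] {T : E →ₗ.[ℂ] E}
    (hT : IsSelfAdjoint T) {z : ℂ} (hz : z ∈ spectrum T) : z = (z.re : ℂ) := by
  by_contra h
  refine hz (mem_resolventSet_of_im_ne_zero hT fun h0 => h ?_)
  apply Complex.ext <;> simp [h0]

theorem mem_spectrum_of_eigenspace_ne_bot {T : E →ₗ.[ℂ] E} {z : ℂ} (h : eigenspace T z ≠ ⊥) :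
    z ∈ spectrum T := by
  rintro ⟨R, -, hR⟩
  apply h
  rw [Submodule.eq_bot_iff]
  intro x hx
  obtain ⟨u, hu, rfl⟩ := mem_eigenspace_iff.1 hx
  have := hR u
  rw [hu, sub_self, map_zero] at this
  exact this.symm

/-- The quadratic form of `T` is bounded below by `a`, up to a form of finite rank. -/
def HasFormBound (T : E →ₗ.[ℂ] E) (a : ℝ) : Prop :=
  ∃ (n : ℕ) (l : E →L[ℂ] (Fin n → ℂ)) (C : ℝ), ∀ u : T.domain,
    a * ‖(u : E)‖ ^ 2 ≤ (⟪(u : E), T u⟫_ℂ).re + C * ‖l u‖ ^ 2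

/-- Otherwise there are unit vectors `u m` with `(T - r) u m → 0`. Their finite-rank parts converge
along a subsequence, and then the form bound applied to differences makes the subsequence Cauchy. As
the graph is closed, the limit is a unit eigenvector. -/
theorem mem_resolventSet_of_hasFormBound [CompleteSpace E] {T : E →ₗ.[ℂ] E}
    (hT : IsSelfAdjoint T) {a r : ℝ} (ha : HasFormBound T a) (hr : r < a)
    (hi : eigenspace T (r : ℂ) = ⊥) : (r : ℂ) ∈ resolventSet T := by
  have hi' : ∀ u : T.domain, T u = (r : ℂ) • (u : E) → u = 0 := by
    intro u hu
    have : (u : E) ∈ eigenspace T (r : ℂ) := mem_eigenspace_iff.2 ⟨u, hu, rfl⟩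
    rw [hi, Submodule.mem_bot] at this
    exact Subtype.ext this
  suffices ∃ c > 0, ∀ u : T.domain, c * ‖(u : E)‖ ≤ ‖T u - (r : ℂ) • (u : E)‖ by
    obtain ⟨c, hc, hb⟩ := this
    exact mem_resolventSet_of_bounded_below hT hc hb (by simpa using hi')
  by_contra! hcon
  obtain ⟨n, l, C, hl⟩ := ha
  have hex : ∀ m : ℕ, ∃ u : T.domain, ‖(u : E)‖ = 1 ∧ ‖T u - (r : ℂ) • (u : E)‖ < 1 / ((m : ℝ) + 1) := by
    intro m
    obtain ⟨u, hu⟩ := hcon (1 / ((m : ℝ) + 1)) (by positivity)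
    have hu0 : (0 : ℝ) < ‖(u : E)‖ := by
      rw [norm_pos_iff]
      intro h0
      rw [h0, norm_zero, mul_zero] at hu
      exact absurd hu (not_lt.2 (norm_nonneg _))
    refine ⟨((‖(u : E)‖⁻¹ : ℝ) : ℂ) • u, ?_, ?_⟩
    · rw [SetLike.val_smul, norm_smul, Complex.norm_real, norm_inv, norm_norm,
        inv_mul_cancel₀ hu0.ne']
    · rw [SetLike.val_smul, LinearPMap.map_smul, smul_comm, ← smul_sub, norm_smul, Complex.norm_real, norm_inv,
        norm_norm, inv_mul_lt_iff₀ hu0, mul_comm]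
      exact hu
  choose u hu1 hu2 using hex
  have hbdd : ∀ m, l (u m) ∈ Metric.closedBall (0 : Fin n → ℂ) ‖l‖ := by
    intro m
    rw [mem_closedBall_zero_iff]
    simpa [hu1 m] using l.le_opNorm (u m : E)
  obtain ⟨y, -, φ, hφ, hlim⟩ := (isCompact_closedBall (0 : Fin n → ℂ) ‖l‖).tendsto_subseq hbdd
  have hsmall : Tendsto (fun m => T (u (φ m)) - (r : ℂ) • (u (φ m) : E)) atTop (𝓝 0) := by
    rw [tendsto_zero_iff_norm_tendsto_zero]
    refine squeeze_zero (fun _ => norm_nonneg _) (fun m => (hu2 (φ m)).le) ?_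
    exact (tendsto_one_div_add_atTop_nhds_zero_nat).comp hφ.tendsto_atTop
  -- The form bound with `r` subtracted: `a - r > 0` controls the norm by the residual and the
  -- finite-rank part.
  have hkey : ∀ w : T.domain, (a - r) * ‖(w : E)‖ ^ 2 ≤
      ‖T w - (r : ℂ) • (w : E)‖ * ‖(w : E)‖ + C * ‖l w‖ ^ 2 := by
    intro w
    have h1 := hl w
    have h2 : (⟪(w : E), T w⟫_ℂ).re = (⟪(w : E), T w - (r : ℂ) • (w : E)⟫_ℂ).re + r * ‖(w : E)‖ ^ 2 := by
      rw [inner_sub_right, inner_smul_right, inner_self_eq_ofReal, Complex.sub_re,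
        Complex.re_ofReal_mul, Complex.ofReal_re]
      ring
    have h3 : (⟪(w : E), T w - (r : ℂ) • (w : E)⟫_ℂ).re ≤ ‖T w - (r : ℂ) • (w : E)‖ * ‖(w : E)‖ := by
      rw [mul_comm]
      exact (Complex.re_le_norm _).trans (norm_inner_le_norm _ _)
    linarith
  have hcau : CauchySeq (fun m => (u (φ m) : E)) := by
    have h1 := hsmall.cauchySeq
    have h2 := hlim.cauchySeq
    rw [Metric.cauchySeq_iff'] at h1 h2 ⊢
    intro ε hε
    have har : 0 < a - r := by linarith
    -- `C` may have either sign; `C'` dominates it and is positive, so it can be divided by.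
    set C' := |C| + 1
    obtain ⟨N₁, hN₁⟩ := Metric.cauchySeq_iff.1 hsmall.cauchySeq ((a - r) * ε ^ 2 / 8) (by positivity)
    obtain ⟨N₂, hN₂⟩ := Metric.cauchySeq_iff.1 hlim.cauchySeq (Real.sqrt ((a - r) * ε ^ 2 / (4 * C'))) (by
      apply Real.sqrt_pos.2; positivity)
    refine ⟨max N₁ N₂, fun m hm => ?_⟩
    set N := max N₁ N₂
    have e1 := hN₁ m ((le_max_left _ _).trans hm) N (le_max_left _ _)
    have e2 := hN₂ m ((le_max_right _ _).trans hm) N (le_max_right _ _)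
    rw [dist_eq_norm] at e1 e2 ⊢
    have k := hkey (u (φ m) - u (φ N))
    rw [AddSubgroupClass.coe_sub, LinearPMap.map_sub, map_sub] at k
    have e1' : T (u (φ m)) - T (u (φ N)) - (r : ℂ) • ((u (φ m) : E) - u (φ N)) =
      T (u (φ m)) - (r : ℂ) • (u (φ m) : E) - (T (u (φ N)) - (r : ℂ) • (u (φ N) : E)) := by
      rw [smul_sub]; abel
    rw [e1'] at k
    have n2 : ‖(u (φ m) : E) - u (φ N)‖ ≤ 2 := by
      refine (norm_sub_le _ _).trans ?_
      rw [hu1, hu1]; norm_num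
    have e2' : ‖l (u (φ m)) - l (u (φ N))‖ ^ 2 < (a - r) * ε ^ 2 / (4 * C') := by
      have := pow_lt_pow_left₀ e2 (norm_nonneg _) two_ne_zero
      rwa [Real.sq_sqrt (by positivity)] at this
    have e3 : C * ‖l (u (φ m)) - l (u (φ N))‖ ^ 2 ≤ (a - r) * ε ^ 2 / 4 := by
      calc C * ‖l (u (φ m)) - l (u (φ N))‖ ^ 2 ≤ C' * ((a - r) * ε ^ 2 / (4 * C')) := by
            have : C ≤ C' := (le_abs_self C).trans (by simp [C'])
            have hC' : 0 < C' := by positivity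
            calc _ ≤ C' * ‖l (u (φ m)) - l (u (φ N))‖ ^ 2 := by gcongr
              _ ≤ _ := by gcongr
        _ = _ := by
            have hC' : C' ≠ 0 := by positivity
            field_simp
    have e4 : ‖T (u (φ m)) - (r : ℂ) • (u (φ m) : E) - (T (u (φ N)) - (r : ℂ) • (u (φ N) : E))‖
        * ‖(u (φ m) : E) - u (φ N)‖ ≤ ((a - r) * ε ^ 2 / 8) * 2 :=
      mul_le_mul e1.le n2 (norm_nonneg _) (by positivity)
    by_contra! hge
    have : ε ^ 2 ≤ ‖(u (φ m) : E) - u (φ N)‖ ^ 2 := pow_le_pow_left₀ hε.le hge 2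
    nlinarith [mul_pos har (pow_pos hε 2), mul_le_mul_of_nonneg_left this har.le]
  obtain ⟨x, hx⟩ := cauchySeq_tendsto_of_complete hcau
  have hTu : Tendsto (fun m => T (u (φ m))) atTop (𝓝 ((r : ℂ) • x)) := by
    have := hsmall.add (hx.const_smul (r : ℂ))
    simpa using this
  have hmem : (x, (r : ℂ) • x) ∈ T.graph := by
    refine hT.isClosed.mem_of_tendsto (hx.prodMk_nhds hTu) (Eventually.of_forall fun m => ?_)
    exact T.mem_graph _
  obtain ⟨w, hw1, hw2⟩ := (LinearPMap.mem_graph_iff T).1 hmem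
  simp only at hw1 hw2
  rw [← hw1] at hw2
  have hn : ‖x‖ = 1 := by
    refine tendsto_nhds_unique hx.norm ?_
    simp [hu1]
  rw [← hw1, hi' w hw2] at hn
  simp at hn

/-- The finite-rank map is injective on the eigenspace: on its kernel the form is at least `a`, but
on eigenvectors it equals `r < a`. -/
theorem finiteDimensional_eigenspace_of_hasFormBound {T : E →ₗ.[ℂ] E} {a r : ℝ}
    (ha : HasFormBound T a) (hr : r < a) : FiniteDimensional ℂ (eigenspace T (r : ℂ)) := by
  obtain ⟨n, l, C, hl⟩ := ha
  apply FiniteDimensional.of_injective (l.toLinearMap ∘ₗ (eigenspace T (r : ℂ)).subtype)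
  rw [← LinearMap.ker_eq_bot, LinearMap.ker_eq_bot']
  rintro ⟨x, hx⟩ h
  obtain ⟨u, hu, rfl⟩ := mem_eigenspace_iff.1 hx
  have h' : l u = 0 := h
  have := hl u
  rw [h', hu, inner_smul_right, inner_self_eq_ofReal, norm_zero, Complex.re_ofReal_mul,
    Complex.ofReal_re] at this
  have h4 : ‖(u : E)‖ ^ 2 = 0 := by nlinarith [sq_nonneg ‖(u : E)‖]
  exact Subtype.ext (norm_eq_zero.1 (pow_eq_zero_iff two_ne_zero |>.1 h4))

/-- With more eigenvectors than dimensions, a nontrivial combination is annihilated by `l`. Its form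
is an average of the `r i`, weighted by the squared coefficients, hence strictly below `a` times its
squared norm. -/
theorem card_le_finrank_of_orthonormal {T : E →ₗ.[ℂ] E} {V : Type*} [AddCommGroup V] [Module ℂ V]
    [FiniteDimensional ℂ V] (l : T.domain →ₗ[ℂ] V) {a : ℝ}
    (hl : ∀ u : T.domain, l u = 0 → a * ‖(u : E)‖ ^ 2 ≤ (⟪(u : E), T u⟫_ℂ).re)
    {ι : Type*} [Fintype ι] (u : ι → T.domain) (r : ι → ℝ)
    (ho : Orthonormal ℂ (fun i => (u i : E))) (hu : ∀ i, T (u i) = (r i : ℂ) • (u i : E))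
    (hr : ∀ i, r i < a) : Fintype.card ι ≤ Module.finrank ℂ V := by
  by_contra! hcard
  have hnot : ¬ LinearIndependent ℂ (fun i => l (u i)) := fun h => by
    have := h.fintype_card_le_finrank
    omega
  rw [Fintype.not_linearIndependent_iff] at hnot
  obtain ⟨g, hg, i₀, hi₀⟩ := hnot
  set x : T.domain := ∑ i, g i • u i with hx
  have hlx : l x = 0 := by rw [hx, map_sum]; simpa using hg
  have hxE : (x : E) = ∑ i, g i • (u i : E) := by rw [hx]; simp
  have hTx : T x = ∑ i, (g i * r i) • (u i : E) := by
    have : T x = T.toFun x := rfl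
    rw [this, hx, map_sum]
    refine Finset.sum_congr rfl fun i _ => ?_
    rw [map_smul]
    change g i • T (u i) = _
    rw [hu, smul_smul]
  have h1 : ⟪(x : E), T x⟫_ℂ = ((∑ i, r i * ‖g i‖ ^ 2 : ℝ) : ℂ) := by
    rw [hxE, hTx, ho.inner_sum]
    push_cast
    refine Finset.sum_congr rfl fun i _ => ?_
    rw [← mul_assoc, Complex.conj_mul']
    ring
  have h2 : ‖(x : E)‖ ^ 2 = ∑ i, ‖g i‖ ^ 2 := by
    have : ⟪(x : E), (x : E)⟫_ℂ = ((∑ i, ‖g i‖ ^ 2 : ℝ) : ℂ) := by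
      rw [hxE, ho.inner_sum]
      push_cast
      refine Finset.sum_congr rfl fun i _ => ?_
      rw [Complex.conj_mul']
    rw [inner_self_eq_ofReal] at this
    exact Complex.ofReal_injective this
  have h3 := hl x hlx
  rw [h1, h2, Complex.ofReal_re, Finset.mul_sum] at h3
  refine absurd h3 (not_le.2 ?_)
  apply Finset.sum_lt_sum
  · intro i _
    have := hr i
    gcongr
  · refine ⟨i₀, Finset.mem_univ _, ?_⟩
    have := hr i₀
    have : 0 < ‖g i₀‖ := norm_pos_iff.2 hi₀
    gcongr

theorem IsSymm.inner_eq_zero {T : E →ₗ.[ℂ] E} (hT : IsSymm T) {r s : ℝ} (hrs : r ≠ s)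
    {u v : T.domain} (hu : T u = (r : ℂ) • (u : E)) (hv : T v = (s : ℂ) • (v : E)) :
    ⟪(u : E), (v : E)⟫_ℂ = 0 := by
  have h := hT u v
  rw [hu, hv, inner_smul_left, inner_smul_right, Complex.conj_ofReal, ← sub_eq_zero, ← sub_mul] at h
  rcases mul_eq_zero.1 h with h | h
  · rw [sub_eq_zero] at h
    exact absurd (Complex.ofReal_injective h) hrs
  · exact h

theorem exists_unit_eigenvector {T : E →ₗ.[ℂ] E} {z : ℂ} (h : eigenspace T z ≠ ⊥) :
    ∃ u : T.domain, ‖(u : E)‖ = 1 ∧ T u = z • (u : E) := by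
  obtain ⟨x, hx, hx0⟩ := Submodule.exists_mem_ne_zero_of_ne_bot h
  obtain ⟨u, hu, rfl⟩ := mem_eigenspace_iff.1 hx
  have hu0 : ‖(u : E)‖ ≠ 0 := norm_ne_zero_iff.2 hx0
  refine ⟨((‖(u : E)‖⁻¹ : ℝ) : ℂ) • u, ?_, ?_⟩
  · rw [SetLike.val_smul, norm_smul, Complex.norm_real, norm_inv, norm_norm, inv_mul_cancel₀ hu0]
  · rw [SetLike.val_smul, LinearPMap.map_smul, hu, smul_comm]

/-- Eigenvectors for distinct eigenvalues are orthogonal, so the counting bound limits the number of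
eigenvalues. -/
theorem finite_eigenvalues_of_form_bound {T : E →ₗ.[ℂ] E} (hT : IsSymm T)
    {V : Type*} [AddCommGroup V] [Module ℂ V]
    [FiniteDimensional ℂ V] (l : T.domain →ₗ[ℂ] V) {a : ℝ}
    (hl : ∀ u : T.domain, l u = 0 → a * ‖(u : E)‖ ^ 2 ≤ (⟪(u : E), T u⟫_ℂ).re) :
    {r : ℝ | r < a ∧ eigenspace T (r : ℂ) ≠ ⊥}.Finite := by
  by_contra hinf
  obtain ⟨s, hs, hcard⟩ := Set.Infinite.exists_subset_card_eq hinf (Module.finrank ℂ V + 1)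
  have hs' : ∀ r : s, (r : ℝ) < a ∧ eigenspace T ((r : ℝ) : ℂ) ≠ ⊥ := fun r => hs r.2
  choose u hu1 hu2 using fun r : s => exists_unit_eigenvector (hs' r).2
  have ho : Orthonormal ℂ (fun r : s => (u r : E)) := by
    refine ⟨hu1, fun i j hij => ?_⟩
    exact hT.inner_eq_zero (fun h => hij (Subtype.ext h)) (hu2 i) (hu2 j)
  have := card_le_finrank_of_orthonormal l hl u (fun r => (r : ℝ)) ho hu2 (fun r => (hs' r).1)
  rw [Fintype.card_coe, hcard] at this
  omega

theorem finite_eigenvalues_of_hasFormBound {T : E →ₗ.[ℂ] E} (hT : IsSymm T) {a : ℝ}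
    (ha : HasFormBound T a) : {r : ℝ | r < a ∧ eigenspace T (r : ℂ) ≠ ⊥}.Finite := by
  obtain ⟨n, l, C, hl⟩ := ha
  refine finite_eigenvalues_of_form_bound hT (l.toLinearMap ∘ₗ T.domain.subtype) fun u hu => ?_
  have h := hl u
  have hu' : l u = 0 := hu
  rwa [hu', norm_zero, zero_pow two_ne_zero, mul_zero, add_zero] at h

theorem eigenspace_ne_bot_of_mem_spectrum [CompleteSpace E] {T : E →ₗ.[ℂ] E}
    (hT : IsSelfAdjoint T) {a r : ℝ} (ha : HasFormBound T a) (hr : r < a)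
    (hs : (r : ℂ) ∈ spectrum T) : eigenspace T (r : ℂ) ≠ ⊥ :=
  fun h => hs (mem_resolventSet_of_hasFormBound hT ha hr h)

/-- Below `L` a spectral point is an eigenvalue of finite multiplicity, and it is isolated because
only finitely many eigenvalues lie below any `a < L`. From `L` on, no spectral point is isolated. -/
theorem essentialSpectrum_eq_Ici [CompleteSpace E] {T : E →ₗ.[ℂ] E} (hT : IsSelfAdjoint T) {L : ℝ}
    (hlow : ∀ a < L, HasFormBound T a) (hup : ∀ r ≥ L, (r : ℂ) ∈ spectrum T) :
    essentialSpectrum T = (fun r : ℝ => (r : ℂ)) '' Set.Ici L := by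
  ext z
  constructor
  · rintro ⟨hz, hd⟩
    have hzr := spectrum_eq_ofReal_re hT hz
    refine ⟨z.re, ?_, hzr.symm⟩
    by_contra hlt
    rw [Set.mem_Ici, not_le] at hlt
    apply hd
    obtain ⟨a, ha1, ha2⟩ := exists_between hlt
    have hfb := hlow a ha2
    rw [hzr] at hz
    have hfin := finite_eigenvalues_of_hasFormBound (isSymm_of_isSelfAdjoint hT) hfb
    refine ⟨?_, ?_, ?_⟩
    · set S := {r : ℝ | r < a ∧ eigenspace T (r : ℂ) ≠ ⊥}
      have hcl : IsClosed (S \ {z.re}) := (hfin.subset Set.sdiff_subset).isClosed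
      have hnh : (S \ {z.re})ᶜ ∩ Set.Iio a ∈ 𝓝 z.re :=
        inter_mem (hcl.isOpen_compl.mem_nhds (by simp)) (Iio_mem_nhds ha1)
      obtain ⟨ε, hε, hball⟩ := Metric.mem_nhds_iff.1 hnh
      refine ⟨ε, hε, ?_⟩
      ext y
      constructor
      · rintro ⟨hy1, hy2⟩
        have hyr := spectrum_eq_ofReal_re hT hy1
        rw [Metric.mem_ball, hyr, hzr, Complex.dist_of_im_eq (by simp), Complex.ofReal_re,
          Complex.ofReal_re] at hy2
        have := hball (Metric.mem_ball.2 hy2)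
        have hya : y.re < a := this.2
        rw [hyr] at hy1
        have hmem : y.re ∈ S := ⟨hya, eigenspace_ne_bot_of_mem_spectrum hT hfb hya hy1⟩
        have : y.re = z.re := by
          by_contra hne
          exact this.1 ⟨hmem, hne⟩
        rw [Set.mem_singleton_iff, hyr, hzr, this]
      · rintro rfl
        rw [← hzr] at hz
        exact ⟨hz, Metric.mem_ball_self hε⟩
    · rw [hzr]; exact eigenspace_ne_bot_of_mem_spectrum hT hfb ha1 hz
    · rw [hzr]; exact finiteDimensional_eigenspace_of_hasFormBound hfb ha1
  · rintro ⟨r, hr, rfl⟩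
    refine ⟨hup r hr, ?_⟩
    rintro ⟨⟨ε, hε, hball⟩, -⟩
    -- A second spectral point inside the ball that was supposed to isolate `r`.
    have h1 : ((r + ε / 2 : ℝ) : ℂ) ∈ spectrum T ∩ Metric.ball (r : ℂ) ε := by
      refine ⟨hup _ (le_trans hr (by linarith)), ?_⟩
      rw [Metric.mem_ball, Complex.dist_of_im_eq (by simp)]
      simp only [Complex.ofReal_re, Real.dist_eq]
      rw [add_sub_cancel_left, abs_of_pos (by linarith)]
      linarith
    rw [hball, Set.mem_singleton_iff] at h1
    have := Complex.ofReal_injective h1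
    linarith

/-- The form of a nonnegative symmetric operator, as a semi-inner product on the domain. -/
@[reducible] noncomputable def formCore (T : E →ₗ.[ℂ] E) (hT : IsSymm T)
    (hpos : ∀ u : T.domain, 0 ≤ (⟪(u : E), T u⟫_ℂ).re) :
    PreInnerProductSpace.Core ℂ T.domain where
  inner u v := ⟪(u : E), T v⟫_ℂ
  conj_inner_symm u v := by
    rw [inner_conj_symm, hT u v]
  re_inner_nonneg u := hpos u
  add_left u v w := by
    rw [Submodule.coe_add, inner_add_left]
  smul_left u v c := by
    rw [Submodule.coe_smul, inner_smul_left]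

/-- Cauchy--Schwarz for the semi-inner product defined by the form. -/
theorem norm_inner_sq_le_form {T : E →ₗ.[ℂ] E} (hT : IsSymm T)
    (hpos : ∀ u : T.domain, 0 ≤ (⟪(u : E), T u⟫_ℂ).re) (u v : T.domain) :
    ‖⟪(u : E), T v⟫_ℂ‖ ^ 2 ≤ (⟪(u : E), T u⟫_ℂ).re * (⟪(v : E), T v⟫_ℂ).re := by
  let _ := formCore T hT hpos
  have h := InnerProductSpace.Core.inner_mul_inner_self_le (𝕜 := ℂ) (F := T.domain) u v
  have e : ‖⟪(v : E), T u⟫_ℂ‖ = ‖⟪(u : E), T v⟫_ℂ‖ := by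
    rw [← hT v u, norm_inner_symm]
  have h' : ‖⟪(u : E), T v⟫_ℂ‖ * ‖⟪(v : E), T u⟫_ℂ‖ ≤
    (⟪(u : E), T u⟫_ℂ).re * (⟪(v : E), T v⟫_ℂ).re := h
  rw [e] at h'
  rw [sq]
  exact h'

/-- Cauchy--Schwarz for the form gives `⟪x, T v⟫ = 0` for every `v` in the domain. So `x` lies in
the kernel of the adjoint, which is `T`. Convergence of `T (u n)` is not needed. -/
theorem mem_ker_of_tendsto_form [CompleteSpace E] {T : E →ₗ.[ℂ] E} (hT : IsSelfAdjoint T)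
    (hpos : ∀ u : T.domain, 0 ≤ (⟪(u : E), T u⟫_ℂ).re) {u : ℕ → T.domain} {x : E}
    (hx : Tendsto (fun n => (u n : E)) atTop (𝓝 x))
    (hu : Tendsto (fun n => (⟪(u n : E), T (u n)⟫_ℂ).re) atTop (𝓝 0)) :
    x ∈ eigenspace T 0 := by
  have hs := isSymm_of_isSelfAdjoint hT
  have key : ∀ v : T.domain, ⟪x, T v⟫_ℂ = 0 := by
    intro v
    have h1 : Tendsto (fun n => ‖⟪(u n : E), T v⟫_ℂ‖ ^ 2) atTop (𝓝 (‖⟪x, T v⟫_ℂ‖ ^ 2)) :=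
      ((hx.inner tendsto_const_nhds).norm).pow 2
    have h2 : Tendsto (fun n => ‖⟪(u n : E), T v⟫_ℂ‖ ^ 2) atTop (𝓝 0) := by
      refine squeeze_zero (fun _ => by positivity) (fun n => norm_inner_sq_le_form hs hpos (u n) v) ?_
      simpa using hu.mul_const _
    have := tendsto_nhds_unique h1 h2
    simpa using this
  have h1 : ∀ v : T.domain, ⟪(0 : E), (v : E)⟫_ℂ = ⟪x, T v⟫_ℂ := fun v => by
    rw [key v, inner_zero_left]
  have h2 : x ∈ T.adjoint.domain := LinearPMap.mem_adjoint_domain_of_exists x ⟨0, h1⟩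
  have h3 : T.adjoint ⟨x, h2⟩ = 0 := LinearPMap.adjoint_apply_eq hT.dense_domain _ h1
  have h4 : (x, (0 : E)) ∈ T.adjoint.graph := by
    rw [LinearPMap.mem_graph_iff]
    exact ⟨⟨x, h2⟩, rfl, h3⟩
  rw [LinearPMap.isSelfAdjoint_def.1 hT, LinearPMap.mem_graph_iff] at h4
  obtain ⟨w, hw1, hw2⟩ := h4
  exact mem_eigenspace_iff.2 ⟨w, by simpa using hw2, hw1⟩

/-- The infimum of the form of a semibounded self-adjoint operator lies in the spectrum. -/
theorem exists_neg_mem_spectrum [CompleteSpace E] {T : E →ₗ.[ℂ] E} (hT : IsSelfAdjoint T) {m : ℝ}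
    (hm : ∀ u : T.domain, m * ‖(u : E)‖ ^ 2 ≤ (⟪(u : E), T u⟫_ℂ).re)
    (hneg : ∃ u : T.domain, (⟪(u : E), T u⟫_ℂ).re < 0) :
    ∃ r : ℝ, r < 0 ∧ (r : ℂ) ∈ spectrum T := by
  have hs := isSymm_of_isSelfAdjoint hT
  -- All lower bounds of the form. If their supremum `r` had a bounded resolvent `R`, a larger
  -- number would still be a lower bound.
  set S : Set ℝ := {x | ∀ u : T.domain, x * ‖(u : E)‖ ^ 2 ≤ (⟪(u : E), T u⟫_ℂ).re} with hS
  obtain ⟨u₀, hu₀⟩ := hneg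
  have hn0 : 0 < ‖(u₀ : E)‖ ^ 2 := by
    rcases (sq_nonneg ‖(u₀ : E)‖).eq_or_lt with h | h
    · have : (u₀ : E) = 0 := by
        rw [← norm_eq_zero]; exact pow_eq_zero_iff two_ne_zero |>.1 h.symm
      rw [this, inner_zero_left] at hu₀
      simp at hu₀
    · exact h
  have hbd : ∀ x ∈ S, x ≤ (⟪(u₀ : E), T u₀⟫_ℂ).re / ‖(u₀ : E)‖ ^ 2 := fun x hx => by
    rw [le_div_iff₀ hn0]; exact hx u₀
  have hbdd : BddAbove S := ⟨_, hbd⟩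
  set r := sSup S with hr
  have hrS : r ∈ S := by
    intro u
    rcases (norm_nonneg (u : E)).eq_or_lt with h | h
    · have h0 : (u : E) = 0 := norm_eq_zero.1 h.symm
      simp [h0]
    · rw [← le_div_iff₀ (by positivity)]
      refine csSup_le ⟨m, hm⟩ fun x hx => ?_
      rw [le_div_iff₀ (by positivity)]
      exact hx u
  refine ⟨r, lt_of_le_of_lt (hbd r hrS) (div_neg_of_neg_of_pos hu₀ hn0), ?_⟩
  rintro ⟨R, hR1, hR2⟩
  set K := ‖R‖ + 1
  have hK : 0 < K := by positivity
  have hre : ∀ u : T.domain, (⟪(u : E), T u - (r : ℂ) • (u : E)⟫_ℂ).re =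
      (⟪(u : E), T u⟫_ℂ).re - r * ‖(u : E)‖ ^ 2 := by
    intro u
    rw [inner_sub_right, inner_smul_right, inner_self_eq_ofReal, Complex.sub_re,
      Complex.re_ofReal_mul, Complex.ofReal_re]
  set T' : E →ₗ.[ℂ] E := ⟨T.domain, T.toFun - (r : ℂ) • T.domain.subtype⟩ with hT'
  have hT'a : ∀ u : T.domain, T' u = T u - (r : ℂ) • (u : E) := fun u => rfl
  have hs' : IsSymm T' := by
    intro x y
    change ⟪T x - (r : ℂ) • (x : E), (y : E)⟫_ℂ = ⟪(x : E), T y - (r : ℂ) • (y : E)⟫_ℂ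
    rw [inner_sub_left, inner_sub_right, hs x y, inner_smul_left, inner_smul_right,
      Complex.conj_ofReal]
  have hpos : ∀ u : T'.domain, 0 ≤ (⟪(u : E), T' u⟫_ℂ).re := by
    intro u
    rw [hT'a u, hre u]
    linarith [hrS u]
  -- Cauchy--Schwarz for the form of `T - r`, applied to `u` and `R u`, gives `‖u‖⁴ ≤ (form of u) *
  -- ⟪R u, u⟫`, and the last factor is at most `K ‖u‖²`.
  have hS' : r + 1 / K ∈ S := by
    intro u
    obtain ⟨hd, hv⟩ := hR1 (u : E)
    have h1 := norm_inner_sq_le_form hs' hpos u ⟨R u, hd⟩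
    rw [hT'a, hT'a, hre, hv, inner_self_eq_ofReal, Complex.norm_real, norm_pow,
      norm_norm] at h1
    have h3 : (⟪R (u : E), (u : E)⟫_ℂ).re ≤ K * ‖(u : E)‖ ^ 2 := by
      calc _ ≤ ‖R (u : E)‖ * ‖(u : E)‖ := (Complex.re_le_norm _).trans (norm_inner_le_norm _ _)
        _ ≤ (‖R‖ * ‖(u : E)‖) * ‖(u : E)‖ := by gcongr; exact R.le_opNorm _
        _ ≤ _ := by
          have : ‖R‖ ≤ K := by simp [K]
          nlinarith [sq_nonneg ‖(u : E)‖]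
    have h4 := hrS u
    rcases (sq_nonneg ‖(u : E)‖).eq_or_lt with h | h
    · rw [← h, mul_zero] at h4 ⊢
      exact h4
    · have h5 : (‖(u : E)‖ ^ 2) * ‖(u : E)‖ ^ 2 ≤
          ((⟪(u : E), T u⟫_ℂ).re - r * ‖(u : E)‖ ^ 2) * K * ‖(u : E)‖ ^ 2 := by
        rw [← sq]
        refine h1.trans ?_
        rw [mul_assoc]
        exact mul_le_mul_of_nonneg_left h3 (by linarith)
      have h6 := le_of_mul_le_mul_right h5 h
      rw [← div_le_iff₀ hK] at h6
      rw [add_mul, one_div, inv_mul_eq_div]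
      linarith
  have := le_csSup hbdd hS'
  have : 0 < 1 / K := by positivity
  linarith

/-- Symmetry excludes Jordan chains: if `(T - r) u` is an eigenvector for `r`, then its squared norm
is `⟪u, (T - r)² u⟫ = 0`. -/
theorem isSimpleEigenvalue_of_finrank {T : E →ₗ.[ℂ] E} (hT : IsSymm T) (r : ℝ)
    (h : Module.finrank ℂ (eigenspace T (r : ℂ)) = 1) : IsSimpleEigenvalue T (r : ℂ) := by
  refine ⟨h, fun u hu => ?_⟩
  obtain ⟨v, hv, hvu⟩ := mem_eigenspace_iff.1 hu
  have h1 : ⟪T u - (r : ℂ) • (u : E), T u - (r : ℂ) • (u : E)⟫_ℂ = 0 := by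
    nth_rw 2 [← hvu]
    rw [inner_sub_left, hT u v, hv, inner_smul_left, inner_smul_right, Complex.conj_ofReal, sub_self]
  rw [inner_self_eq_zero, sub_eq_zero] at h1
  exact mem_eigenspace_iff.2 ⟨u, h1, rfl⟩

end Abstract

end BCH

namespace BCH

open scoped ComplexConjugate InnerProductSpace BoundedContinuousFunction FourierTransform

/-! ### Multiplication operators on `L²` -/

section Multiplication

theorem memLp_bcf_mul (g : ℝ →ᵇ ℝ) (u : L2) :
    MemLp (fun t => (g t : ℂ) * u t) 2 (volume : Measure ℝ) := by
  refine MemLp.of_le_mul (c := ‖g‖) (Lp.memLp u) ?_ ?_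
  · exact (Complex.continuous_ofReal.comp g.continuous).aestronglyMeasurable.mul
      (Lp.memLp u).aestronglyMeasurable
  · filter_upwards with t
    rw [norm_mul, Complex.norm_real]
    gcongr
    exact g.norm_coe_le_norm t

/-- Multiplication by a bounded continuous function on `L²`. -/
noncomputable def mulL (g : ℝ →ᵇ ℝ) : L2 →L[ℂ] L2 :=
  LinearMap.mkContinuous
    { toFun := fun u => (memLp_bcf_mul g u).toLp _
      map_add' := fun u v => by
        apply Lp.ext
        filter_upwards [(memLp_bcf_mul g (u + v)).coeFn_toLp,
          (memLp_bcf_mul g u).coeFn_toLp, (memLp_bcf_mul g v).coeFn_toLp,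
          Lp.coeFn_add u v, Lp.coeFn_add ((memLp_bcf_mul g u).toLp _) ((memLp_bcf_mul g v).toLp _)]
          with t h1 h2 h3 h4 h5
        rw [h5, Pi.add_apply, h1, h2, h3, h4, Pi.add_apply, mul_add]
      map_smul' := fun a u => by
        apply Lp.ext
        filter_upwards [(memLp_bcf_mul g (a • u)).coeFn_toLp,
          (memLp_bcf_mul g u).coeFn_toLp,
          Lp.coeFn_smul a u, Lp.coeFn_smul a ((memLp_bcf_mul g u).toLp _)]
          with t h1 h2 h4 h5
        rw [RingHom.id_apply, h5, Pi.smul_apply, h1, h2, h4, Pi.smul_apply, smul_eq_mul,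
          smul_eq_mul]
        ring } ‖g‖ (fun u => by
      change ‖(memLp_bcf_mul g u).toLp _‖ ≤ _
      refine Lp.norm_le_mul_norm_of_ae_le_mul ?_
      filter_upwards [(memLp_bcf_mul g u).coeFn_toLp] with t h1
      rw [h1, norm_mul, Complex.norm_real]
      gcongr
      exact g.norm_coe_le_norm t)

theorem coeFn_mulL (g : ℝ →ᵇ ℝ) (u : L2) : ∀ᵐ t, mulL g u t = (g t : ℂ) * u t :=
  (memLp_bcf_mul g u).coeFn_toLp

theorem L2_inner_def (u v : L2) : ⟪u, v⟫_ℂ = ∫ t, conj (u t) * v t := by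
  rw [L2.inner_def]
  refine integral_congr_ae (Eventually.of_forall fun t => ?_)
  change v t * conj (u t) = _
  ring

theorem inner_mulL (g : ℝ →ᵇ ℝ) (u v : L2) : ⟪mulL g u, v⟫_ℂ = ⟪u, mulL g v⟫_ℂ := by
  rw [L2_inner_def, L2_inner_def]
  refine integral_congr_ae ?_
  filter_upwards [coeFn_mulL g u, coeFn_mulL g v] with t h1 h2
  rw [h1, h2, map_mul, Complex.conj_ofReal]
  ring

theorem mulL_mulL (g h : ℝ →ᵇ ℝ) (u : L2) : mulL g (mulL h u) = mulL (g * h) u := by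
  apply Lp.ext
  filter_upwards [coeFn_mulL g (mulL h u), coeFn_mulL h u, coeFn_mulL (g * h) u] with t h1 h2 h3
  rw [h1, h2, h3, BoundedContinuousFunction.mul_apply, Complex.ofReal_mul, mul_assoc]

theorem norm_sq_eq_integral (u : L2) : ‖u‖ ^ 2 = ∫ t, ‖u t‖ ^ 2 := by
  have h := L2_inner_def u u
  rw [inner_self_eq_ofReal] at h
  apply Complex.ofReal_injective
  rw [h, ← integral_complex_ofReal]
  refine integral_congr_ae (Eventually.of_forall fun t => ?_)
  change conj (u t) * u t = _
  rw [Complex.conj_mul']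
  norm_cast

theorem integrable_norm_sq (u : L2) : Integrable (fun t => ‖u t‖ ^ 2) :=
  (memLp_two_iff_integrable_sq_norm (Lp.memLp u).aestronglyMeasurable).1 (Lp.memLp u)

end Multiplication

/-! ### Weak derivatives and Sobolev regularity via the Fourier transform -/

section WeakDeriv

theorem coe_inj {u v : L2} (h : (u : 𝓢'(ℝ, ℂ)) = (v : 𝓢'(ℝ, ℂ))) : u = v := by
  rw [← sub_eq_zero]
  apply eq_zero_of_coe_eq_zero
  rw [← Lp.toTemperedDistributionCLM_apply, map_sub, Lp.toTemperedDistributionCLM_apply,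
    Lp.toTemperedDistributionCLM_apply, h, sub_self]

theorem isWeakDeriv_iff_integral {u v : L2} :
    IsWeakDeriv u v ↔ ∀ g : 𝓢(ℝ, ℂ), ∫ x, deriv g x * u x = - ∫ x, g x * v x := by
  unfold IsWeakDeriv
  constructor
  · intro h g
    have := congrArg (fun d : 𝓢'(ℝ, ℂ) => d g) h
    simp only [lineDerivOp_apply_apply, map_neg, Lp.toTemperedDistribution_apply,
      smul_eq_mul] at this
    rw [← this, neg_neg]
    rfl
  · intro h
    ext g
    simp only [lineDerivOp_apply_apply, map_neg, Lp.toTemperedDistribution_apply,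
      smul_eq_mul]
    rw [neg_eq_iff_eq_neg, ← h g]
    rfl

theorem smulLeftCLM_coe_eq_iff {m : ℝ → ℂ} (hm : m.HasTemperateGrowth) {u w : L2} :
    smulLeftCLM ℂ m (u : 𝓢'(ℝ, ℂ)) = (w : 𝓢'(ℝ, ℂ)) ↔ ∀ᵐ x, w x = m x * u x := by
  constructor
  · intro h
    apply ae_eq_of_integral_contDiff_smul_eq ((Lp.memLp w).locallyIntegrable (by norm_num))
    · have hl : LocallyIntegrableOn (u : ℝ → ℂ) Set.univ :=
        locallyIntegrableOn_univ.2 ((Lp.memLp u).locallyIntegrable (by norm_num))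
      rw [← locallyIntegrableOn_univ]
      exact hl.continuousOn_mul hm.1.continuous.continuousOn isOpen_univ.isLocallyClosed
    · intro g hg hgs
      have hg₁ : HasCompactSupport (Complex.ofRealCLM ∘ g) := hgs.comp_left rfl
      have hg₂ : ContDiff ℝ ∞ (Complex.ofRealCLM ∘ g) := by fun_prop
      have := congrArg (fun d : 𝓢'(ℝ, ℂ) => d (hg₁.toSchwartzMap hg₂)) h
      simp only [smulLeftCLM_apply_apply, Lp.toTemperedDistribution_apply,
        SchwartzMap.smulLeftCLM_apply_apply hm, smul_eq_mul] at this
      simp only [Complex.real_smul]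
      refine this.symm.trans ?_
      refine integral_congr_ae (Eventually.of_forall fun x => ?_)
      change m x * (g x : ℂ) * u x = (g x : ℂ) * (m x * u x)
      ring
  · intro h
    ext g
    simp only [smulLeftCLM_apply_apply, Lp.toTemperedDistribution_apply,
        SchwartzMap.smulLeftCLM_apply_apply hm, smul_eq_mul]
    refine integral_congr_ae ?_
    filter_upwards [h] with x hx
    rw [hx]; ring

/-- The Fourier transform is injective on tempered distributions and turns the derivative into
multiplication by `2πiξ`; for `L²` functions the resulting identity can be read almost everywhere.
-/
theorem isWeakDeriv_iff_fourier {u v : L2} :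
    IsWeakDeriv u v ↔ ∀ᵐ ξ : ℝ, (𝓕 v : L2) ξ = (2 * Real.pi * Complex.I * ξ) * (𝓕 u : L2) ξ := by
  have h1 : IsWeakDeriv u v ↔ 𝓕 (∂_{(1 : ℝ)} (u : 𝓢'(ℝ, ℂ))) = 𝓕 (v : 𝓢'(ℝ, ℂ)) := by
    unfold IsWeakDeriv
    refine ⟨fun h => by rw [h], fun h => ?_⟩
    have := congrArg (fun d : 𝓢'(ℝ, ℂ) => 𝓕⁻ d) h
    simpa using this
  have hm : (fun ξ : ℝ => ((inner ℝ ξ (1 : ℝ) : ℝ) : ℂ)).HasTemperateGrowth := by fun_prop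
  rw [h1, TemperedDistribution.fourier_lineDerivOp_eq, Lp.fourier_toTemperedDistribution_eq,
    Lp.fourier_toTemperedDistribution_eq, ← map_smul, ← coe_smul, smulLeftCLM_coe_eq_iff hm]
  have hs := Lp.coeFn_smul (2 * Real.pi * Complex.I : ℂ) (𝓕 u : L2)
  constructor
  · intro h
    filter_upwards [h, hs] with ξ h1 h2
    rw [h1, h2, Pi.smul_apply, smul_eq_mul]
    simp only [RCLike.inner_apply, conj_trivial, one_mul]
    ring
  · intro h
    filter_upwards [h, hs] with ξ h1 h2
    rw [h1, h2, Pi.smul_apply, smul_eq_mul]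
    simp only [RCLike.inner_apply, conj_trivial, one_mul]
    ring

/-- Integration by parts through Plancherel: the symbol `2πiξ` is purely imaginary, so no density
argument or boundary term appears. -/
theorem IsWeakDeriv.inner_eq {u v z w : L2} (h : IsWeakDeriv u v) (h' : IsWeakDeriv z w) :
    ⟪v, z⟫_ℂ = -⟪u, w⟫_ℂ := by
  rw [← Lp.inner_fourier_eq v z, ← Lp.inner_fourier_eq u w, L2_inner_def, L2_inner_def,
    ← integral_neg]
  refine integral_congr_ae ?_
  filter_upwards [isWeakDeriv_iff_fourier.1 h, isWeakDeriv_iff_fourier.1 h'] with ξ h1 h2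
  rw [h1, h2]
  simp only [map_mul, Complex.conj_ofReal, Complex.conj_I, map_ofNat]
  ring

theorem memLp_deriv_schwartz (g : 𝓢(ℝ, ℂ)) : MemLp (deriv g) 2 (volume : Measure ℝ) := by
  have h := (SchwartzMap.derivCLM ℂ ℂ g).memLp 2 (volume : Measure ℝ)
  have e : ⇑(SchwartzMap.derivCLM ℂ ℂ g) = deriv g := funext fun x => SchwartzMap.derivCLM_apply ℂ g x
  rwa [e] at h

theorem isWeakDeriv_of_hasDerivAt {u u' : ℝ → ℂ} (hd : ∀ x, HasDerivAt u (u' x) x)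
    (hu : MemLp u 2 volume) (hu' : MemLp u' 2 volume) : IsWeakDeriv (hu.toLp u) (hu'.toLp u') := by
  rw [isWeakDeriv_iff_integral]
  intro g
  have hg : MemLp g 2 (volume : Measure ℝ) := g.memLp 2
  have hg' : MemLp (deriv g) 2 (volume : Measure ℝ) := memLp_deriv_schwartz g
  have h := integral_mul_deriv_eq_deriv_mul_of_integrable (u := g) (v := u) (u' := deriv g)
    (v' := u') (fun x _ => g.differentiableAt.hasDerivAt) (fun x _ => hd x)
    (hg.integrable_mul hu') (hg'.integrable_mul hu) (hg.integrable_mul hu)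
  rw [← neg_eq_iff_eq_neg] at h
  calc ∫ x, deriv g x * (hu.toLp u) x = ∫ x, deriv g x * u x := by
        refine integral_congr_ae ?_
        filter_upwards [hu.coeFn_toLp] with x hx
        rw [hx]
    _ = -∫ x, g x * u' x := h.symm
    _ = _ := by
        congr 1
        refine integral_congr_ae ?_
        filter_upwards [hu'.coeFn_toLp] with x hx
        rw [hx]

/-- The inner product is conjugate-linear on the left, so a Schwartz function `g` is tested through
its conjugate. -/
theorem isWeakDeriv_of_test {z w : L2} (h : ∀ (a b : ℝ → ℂ) (ha : MemLp a 2 volume)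
    (hb : MemLp b 2 volume), (∀ x, HasDerivAt a (b x) x) →
    ⟪hb.toLp b, z⟫_ℂ = -⟪ha.toLp a, w⟫_ℂ) : IsWeakDeriv z w := by
  rw [isWeakDeriv_iff_integral]
  intro g
  have hg : MemLp g 2 (volume : Measure ℝ) := g.memLp 2
  have hg' : MemLp (deriv g) 2 (volume : Measure ℝ) := memLp_deriv_schwartz g
  have hd : ∀ x, HasDerivAt (fun y => conj (g y)) (conj (deriv g x)) x := fun x =>
    (g.differentiableAt.hasDerivAt).star
  have := h _ _ (hg.star) (hg'.star) hd
  rw [L2_inner_def, L2_inner_def] at this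
  calc ∫ x, deriv g x * z x = ∫ x, conj ((hg'.star.toLp _) x) * z x := by
        refine integral_congr_ae ?_
        filter_upwards [hg'.star.coeFn_toLp] with x hx
        rw [hx]
        change _ = conj (conj (deriv g x)) * _
        rw [Complex.conj_conj]
    _ = _ := this
    _ = _ := by
        congr 1
        refine integral_congr_ae ?_
        filter_upwards [hg.star.coeFn_toLp] with x hx
        rw [hx]
        change conj (conj (g x)) * _ = _
        rw [Complex.conj_conj]

theorem memLp_bcf_mul_fun (g : ℝ →ᵇ ℝ) {a : ℝ → ℂ} (ha : MemLp a 2 volume) :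
    MemLp (fun t => (g t : ℂ) * a t) 2 (volume : Measure ℝ) := by
  refine (memLp_congr_ae ?_).1 (memLp_bcf_mul g (ha.toLp a))
  filter_upwards [ha.coeFn_toLp] with t ht
  rw [ht]

theorem mulL_toLp (g : ℝ →ᵇ ℝ) {a : ℝ → ℂ} (ha : MemLp a 2 volume) :
    mulL g (ha.toLp a) = (memLp_bcf_mul_fun g ha).toLp _ := by
  apply Lp.ext
  filter_upwards [coeFn_mulL g (ha.toLp a), ha.coeFn_toLp,
    (memLp_bcf_mul_fun g ha).coeFn_toLp] with t h1 h2 h3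
  rw [h1, h2, h3]

/-- Product rule by duality: multiplication is symmetric, so `g` can be moved onto the classically
differentiable test function, where the pointwise product rule holds. -/
theorem IsWeakDeriv.mulL {g g' : ℝ →ᵇ ℝ} (hg : ∀ x, HasDerivAt g (g' x) x) {u v : L2}
    (h : IsWeakDeriv u v) : IsWeakDeriv (mulL g u) (mulL g' u + mulL g v) := by
  apply isWeakDeriv_of_test
  intro a b ha hb hab
  have hd : ∀ x, HasDerivAt (fun y => (g y : ℂ) * a y) ((g' x : ℂ) * a x + (g x : ℂ) * b x) x :=
    fun x => (hg x).ofReal_comp.mul (hab x)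
  have h1 := (isWeakDeriv_of_hasDerivAt hd (memLp_bcf_mul_fun g ha)
    ((memLp_bcf_mul_fun g' ha).add (memLp_bcf_mul_fun g hb))).inner_eq h
  have h2 : ((memLp_bcf_mul_fun g' ha).add (memLp_bcf_mul_fun g hb)).toLp _ =
    BCH.mulL g' (ha.toLp a) + BCH.mulL g (hb.toLp b) := by
    rw [MemLp.toLp_add, mulL_toLp, mulL_toLp]
  have h3 : (memLp_bcf_mul_fun g ha).toLp _ = BCH.mulL g (ha.toLp a) := (mulL_toLp g ha).symm
  have h1' : ⟪((memLp_bcf_mul_fun g' ha).add (memLp_bcf_mul_fun g hb)).toLp _, u⟫_ℂ =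
    -⟪(memLp_bcf_mul_fun g ha).toLp _, v⟫_ℂ := h1
  rw [h2, h3, inner_add_left, inner_mulL, inner_mulL, inner_mulL] at h1'
  rw [inner_add_right]
  linear_combination h1'

theorem IsWeakDeriv.unique {u v w : L2} (h : IsWeakDeriv u v) (h' : IsWeakDeriv u w) : v = w :=
  coe_inj (h.symm.trans h')

theorem IsWeakDeriv.sub {u v u' v' : L2} (h : IsWeakDeriv u u') (h' : IsWeakDeriv v v') :
    IsWeakDeriv (u - v) (u' - v') := by
  have := h.add (h'.smul (-1))
  simpa [sub_eq_add_neg] using this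

theorem isClosed_weakDeriv : IsClosed {x : L2 × L2 | IsWeakDeriv x.1 x.2} := by
  have hc : Continuous fun u : L2 => (u : 𝓢'(ℝ, ℂ)) :=
    (Lp.toTemperedDistributionCLM ℂ volume 2).continuous
  have hd : Continuous fun d : 𝓢'(ℝ, ℂ) => ∂_{(1 : ℝ)} d :=
    (lineDerivOpCLM ℂ 𝓢'(ℝ, ℂ) (1 : ℝ)).continuous
  exact isClosed_eq (hd.comp (hc.comp continuous_fst)) (hc.comp continuous_snd)

theorem mem_sobolevH2_iff {u : L2} :
    u ∈ sobolevH2 ↔ ∃ v w : L2, IsWeakDeriv u v ∧ IsWeakDeriv v w := by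
  change MemSobolev 2 2 (u : 𝓢'(ℝ, ℂ)) ↔ _
  constructor
  · intro h
    have h1 := h.lineDerivOp (m := (1 : ℝ))
    have h2 := h1.lineDerivOp (m := (1 : ℝ))
    obtain ⟨v, hv⟩ := memSobolev_zero_iff.1 (h1.mono (show (0 : ℝ) ≤ 2 - 1 by norm_num))
    obtain ⟨w, hw⟩ := memSobolev_zero_iff.1 (h2.mono (show (0 : ℝ) ≤ 2 - 1 - 1 by norm_num))
    refine ⟨v, w, hv, ?_⟩
    rw [IsWeakDeriv, ← hv, hw]
  · rintro ⟨v, w, hv, hw⟩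
    rw [memSobolev_iff_exists_smulLeftCLM_fourier, Lp.fourier_toTemperedDistribution_eq]
    -- Since `𝓕 w = -4π²ξ² 𝓕 u`, this is `(1 + ξ²) 𝓕 u`, the Sobolev weight of order two.
    refine ⟨𝓕 u - ((4 * Real.pi ^ 2)⁻¹ : ℂ) • 𝓕 w, ?_⟩
    rw [smulLeftCLM_coe_eq_iff (by fun_prop)]
    filter_upwards [isWeakDeriv_iff_fourier.1 hv, isWeakDeriv_iff_fourier.1 hw,
      Lp.coeFn_sub (𝓕 u : L2) (((4 * Real.pi ^ 2)⁻¹ : ℂ) • 𝓕 w : L2),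
      Lp.coeFn_smul ((4 * Real.pi ^ 2)⁻¹ : ℂ) (𝓕 w : L2)] with ξ h1 h2 h3 h4
    rw [h3, Pi.sub_apply, h4, Pi.smul_apply, h2, h1]
    have hpi : (Real.pi : ℂ) ≠ 0 := by exact_mod_cast Real.pi_ne_zero
    simp only [div_self (two_ne_zero (α := ℝ)), Real.rpow_one, smul_eq_mul]
    push_cast
    have hn : ((‖ξ‖ : ℝ) : ℂ) ^ 2 = (ξ : ℂ) ^ 2 := by
      rw [Real.norm_eq_abs, ← Complex.ofReal_pow, sq_abs, Complex.ofReal_pow]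
    rw [hn]
    have hI : Complex.I ^ 2 = -1 := Complex.I_sq
    field_simp
    linear_combination (-4 * (𝓕 u : L2) ξ * (ξ : ℂ) ^ 2) * hI

/-- By the inequality of arithmetic and geometric means, `|𝓕 u|` is at most `(1 + ξ²)⁻¹ + (1 + ξ²)
|𝓕 u|²`. The second term is integrable because both `u` and its derivative are in `L²`. -/
theorem IsWeakDeriv.integrable_fourier {u v : L2} (h : IsWeakDeriv u v) :
    Integrable (𝓕 u : L2) := by
  have h1 := integrable_norm_sq (𝓕 u : L2)
  have h2 := integrable_norm_sq (𝓕 v : L2)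
  have h3 := integrable_inv_one_add_sq
  refine Integrable.mono' ((h3.add h1).add h2) (Lp.memLp _).aestronglyMeasurable ?_
  filter_upwards [isWeakDeriv_iff_fourier.1 h] with ξ hξ
  simp only [Pi.add_apply]
  rw [hξ, norm_mul, mul_pow]
  set a := ‖(𝓕 u : L2) ξ‖
  have e : ‖(2 * Real.pi * Complex.I * ξ : ℂ)‖ ^ 2 = 4 * Real.pi ^ 2 * ξ ^ 2 := by
    simp only [norm_mul, Complex.norm_real, Complex.norm_I, Complex.norm_ofNat, mul_pow,
      Real.norm_eq_abs, sq_abs]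
    ring
  rw [e]
  have hpi : 1 ≤ 4 * Real.pi ^ 2 := by nlinarith [Real.pi_gt_three]
  have h5 : 0 < 1 + ξ ^ 2 := by positivity
  have h6 : a ≤ (1 + ξ ^ 2)⁻¹ + (1 + ξ ^ 2) * a ^ 2 := by
    have h7 : 2 * a ≤ (1 + ξ ^ 2)⁻¹ + (1 + ξ ^ 2) * a ^ 2 := by
      have h8 : (1 + ξ ^ 2)⁻¹ + (1 + ξ ^ 2) * a ^ 2 - 2 * a = (1 + ξ ^ 2)⁻¹ * (1 - (1 + ξ ^ 2) * a) ^ 2 := by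
        field_simp
        ring
      have : 0 ≤ (1 + ξ ^ 2)⁻¹ * (1 - (1 + ξ ^ 2) * a) ^ 2 := by positivity
      linarith
    have : 0 ≤ a := norm_nonneg _
    linarith
  nlinarith [mul_nonneg (sq_nonneg ξ) (sq_nonneg a)]

/-- The Fourier inversion formula for `L²` functions with integrable Fourier transform. -/
theorem ae_eq_fourier_neg {u : L2} (h : Integrable (𝓕 u : L2)) :
    ∀ᵐ x, u x = 𝓕 (fun ξ : ℝ => (𝓕 u : L2) (-ξ)) x := by
  have h' : Integrable (fun ξ : ℝ => (𝓕 u : L2) (-ξ)) := h.comp_neg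
  apply ae_eq_of_integral_contDiff_smul_eq ((Lp.memLp u).locallyIntegrable (by norm_num))
  · apply Continuous.locallyIntegrable
    exact VectorFourier.fourierIntegral_continuous Real.continuous_fourierChar
      (innerSL ℝ).continuous₂ h'
  · intro g hg hgs
    have hg₁ : HasCompactSupport (Complex.ofRealCLM ∘ g) := hgs.comp_left rfl
    have hg₂ : ContDiff ℝ ∞ (Complex.ofRealCLM ∘ g) := by fun_prop
    set G := hg₁.toSchwartzMap hg₂
    have hG : ∀ x, G x = (g x : ℂ) := fun x => rfl
    have e1 : 𝓕⁻ ((𝓕 u : L2) : 𝓢'(ℝ, ℂ)) = (u : 𝓢'(ℝ, ℂ)) := by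
      rw [Lp.fourierInv_toTemperedDistribution_eq, FourierTransform.fourierInv_fourier_eq]
    have e2 := congrArg (fun d : 𝓢'(ℝ, ℂ) => d G) e1
    simp only [TemperedDistribution.fourierInv_apply, Lp.toTemperedDistribution_apply, smul_eq_mul]
      at e2
    -- The Fourier transform moves from the test function onto the integrable function `𝓕 u (-ξ)`,
    -- by Fubini.
    have e3 := VectorFourier.integral_fourierIntegral_smul_eq_flip (L := innerₗ ℝ)
      Real.continuous_fourierChar continuous_inner G.integrable h' (μ := volume) (ν := volume)
    simp only [Complex.real_smul]
    calc ∫ x, (g x : ℂ) * u x = ∫ x, G x * u x := rfl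
      _ = ∫ x, 𝓕⁻ G x * (𝓕 u : L2) x := e2.symm
      _ = ∫ x, 𝓕⁻ G (-x) * (𝓕 u : L2) (-x) :=
        (integral_neg_eq_self (fun x => 𝓕⁻ G x * (𝓕 u : L2) x) volume).symm
      _ = ∫ x, 𝓕 (G : ℝ → ℂ) x * (𝓕 u : L2) (-x) := by
        refine integral_congr_ae (Eventually.of_forall fun x => ?_)
        simp only
        congr 1
        rw [SchwartzMap.fourierInv_coe, Real.fourierInv_eq_fourier_neg, neg_neg]
      _ = _ := by
        simpa using! e3

/-- A function with two weak derivatives in `L²` has a `C¹` representative. -/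
theorem IsWeakDeriv.exists_hasDerivAt {u v w : L2} (h : IsWeakDeriv u v) (h' : IsWeakDeriv v w) :
    ∃ U V : ℝ → ℂ, (∀ x, HasDerivAt U (V x) x) ∧ Continuous V ∧ (∀ᵐ x, u x = U x) ∧
      ∀ᵐ x, v x = V x := by
  have hu := h.integrable_fourier
  have hv := h'.integrable_fourier
  have hF := isWeakDeriv_iff_fourier.1 h
  have hFn : ∀ᵐ ξ : ℝ, (𝓕 v : L2) (-ξ) = (-2 * Real.pi * Complex.I * ξ) • (𝓕 u : L2) (-ξ) := by
    have := (Measure.measurePreserving_neg (volume : Measure ℝ)).quasiMeasurePreserving.ae hF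
    filter_upwards [this] with ξ hξ
    rw [hξ, smul_eq_mul]
    push_cast
    ring
  have hv' : Integrable (fun ξ : ℝ => (𝓕 v : L2) (-ξ)) := hv.comp_neg
  have hx : Integrable (fun ξ : ℝ => ξ • (𝓕 u : L2) (-ξ)) := by
    have := hv'.const_mul (-2 * Real.pi * Complex.I)⁻¹
    refine this.congr ?_
    filter_upwards [hFn] with ξ hξ
    rw [hξ, Complex.real_smul, smul_eq_mul, ← mul_assoc, ← mul_assoc, inv_mul_cancel₀, one_mul]
    simp [Real.pi_ne_zero]
  refine ⟨_, 𝓕 (fun ξ : ℝ => (𝓕 v : L2) (-ξ)), fun x => ?_, ?_, ae_eq_fourier_neg hu,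
    ae_eq_fourier_neg hv⟩
  · have := Real.hasDerivAt_fourier hu.comp_neg hx x
    refine this.congr_deriv ?_
    rw [Real.fourier_eq, Real.fourier_eq]
    refine integral_congr_ae ?_
    filter_upwards [hFn] with ξ hξ
    simp only [hξ]
  · exact VectorFourier.fourierIntegral_continuous Real.continuous_fourierChar
      (innerSL ℝ).continuous₂ hv'

end WeakDeriv

end BCH

/-! ### Self-adjointness of Sturm--Liouville operators with bounded coefficients -/

namespace BCH

open scoped ComplexConjugate InnerProductSpace BoundedContinuousFunction

/-- Coefficients of a uniformly elliptic Sturm--Liouville operator with bounded coefficients. -/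
structure Coeff where
  /-- The leading coefficient. -/
  p : ℝ →ᵇ ℝ
  /-- The derivative of the leading coefficient. -/
  p' : ℝ →ᵇ ℝ
  /-- The potential. -/
  q : ℝ →ᵇ ℝ
  hasDerivAt_p : ∀ x, HasDerivAt p (p' x) x
  /-- A lower bound of the leading coefficient. -/
  low : ℝ
  low_pos : 0 < low
  low_le : ∀ x, low ≤ p x

/-- The reciprocal of a bounded continuous function that is bounded below. -/
noncomputable def bcfInv (g : ℝ →ᵇ ℝ) {m : ℝ} (hm : 0 < m) (h : ∀ x, m ≤ g x) : ℝ →ᵇ ℝ :=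
  BoundedContinuousFunction.ofNormedAddCommGroup (fun x => (g x)⁻¹)
    (g.continuous.inv₀ fun x => (hm.trans_le (h x)).ne') m⁻¹ fun x => by
      rw [norm_inv, Real.norm_of_nonneg (hm.le.trans (h x))]
      exact inv_anti₀ hm (h x)

@[simp]
theorem bcfInv_apply (g : ℝ →ᵇ ℝ) {m : ℝ} (hm : 0 < m) (h : ∀ x, m ≤ g x) (x : ℝ) :
    bcfInv g hm h x = (g x)⁻¹ := rfl

theorem mulL_bcfInv_mulL (g : ℝ →ᵇ ℝ) {m : ℝ} (hm : 0 < m) (h : ∀ x, m ≤ g x) (u : L2) :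
    mulL (bcfInv g hm h) (mulL g u) = u := by
  apply Lp.ext
  filter_upwards [coeFn_mulL (bcfInv g hm h) (mulL g u), coeFn_mulL g u] with t h1 h2
  have : (g t : ℂ) ≠ 0 := by exact_mod_cast (hm.trans_le (h t)).ne'
  rw [h1, h2, bcfInv_apply, Complex.ofReal_inv, inv_mul_cancel_left₀ this]

theorem mulL_mulL_bcfInv (g : ℝ →ᵇ ℝ) {m : ℝ} (hm : 0 < m) (h : ∀ x, m ≤ g x) (u : L2) :
    mulL g (mulL (bcfInv g hm h) u) = u := by
  rw [mulL_mulL, mul_comm, ← mulL_mulL, mulL_bcfInv_mulL]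

/-- The square root of a bounded continuous function. -/
noncomputable def bcfSqrt (g : ℝ →ᵇ ℝ) : ℝ →ᵇ ℝ :=
  BoundedContinuousFunction.ofNormedAddCommGroup (fun x => √(g x))
    (Real.continuous_sqrt.comp g.continuous) (√‖g‖) fun x => by
      rw [Real.norm_of_nonneg (Real.sqrt_nonneg _)]
      exact Real.sqrt_le_sqrt ((le_abs_self _).trans (g.norm_coe_le_norm x))

@[simp]
theorem bcfSqrt_apply (g : ℝ →ᵇ ℝ) (x : ℝ) : bcfSqrt g x = √(g x) := rfl

theorem mulL_bcfSqrt (g : ℝ →ᵇ ℝ) (h : ∀ x, 0 ≤ g x) (u : L2) :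
    mulL (bcfSqrt g) (mulL (bcfSqrt g) u) = mulL g u := by
  rw [mulL_mulL]
  congr 2
  ext x
  exact Real.mul_self_sqrt (h x)

theorem re_inner_mulL (g : ℝ →ᵇ ℝ) (u : L2) :
    (⟪u, mulL g u⟫_ℂ).re = ∫ t, g t * ‖u t‖ ^ 2 := by
  rw [L2_inner_def]
  have : ∫ t, conj (u t) * mulL g u t = ∫ t, ((g t * ‖u t‖ ^ 2 : ℝ) : ℂ) := by
    refine integral_congr_ae ?_
    filter_upwards [coeFn_mulL g u] with t ht
    rw [ht, mul_left_comm, Complex.conj_mul']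
    push_cast
    ring
  rw [this, integral_complex_ofReal, Complex.ofReal_re]

theorem integrable_mul_norm_sq (g : ℝ →ᵇ ℝ) (u : L2) :
    Integrable (fun t => g t * ‖u t‖ ^ 2) := by
  refine (integrable_norm_sq u).bdd_mul (c := ‖g‖) g.continuous.aestronglyMeasurable ?_
  exact Eventually.of_forall g.norm_coe_le_norm

namespace Coeff

variable (A : Coeff)

/-- The Sturm--Liouville operator with the given coefficients. -/
noncomputable abbrev op : L2 →ₗ.[ℂ] L2 := sturmLiouville A.p A.q

/-- Multiply by `1 / p`, which is bounded with bounded derivative by ellipticity. -/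
theorem isWeakDeriv_of_mulL {v w : L2} (h : IsWeakDeriv (mulL A.p v) w) : ∃ v', IsWeakDeriv v v' := by
  set g := bcfInv A.p A.low_pos A.low_le
  have hd : ∀ x, HasDerivAt g ((-(A.p' * g * g)) x) x := by
    intro x
    have h0 : A.p x ≠ 0 := (A.low_pos.trans_le (A.low_le x)).ne'
    refine ((A.hasDerivAt_p x).inv h0).congr_deriv ?_
    simp only [BoundedContinuousFunction.neg_apply, BoundedContinuousFunction.mul_apply, g,
      bcfInv_apply]
    field_simp
  have := h.mulL hd
  rw [mulL_bcfInv_mulL] at this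
  exact ⟨_, this⟩

/-- The condition `u ∈ H²` is automatic here: differentiability of `p u'` gives that of `u'`. -/
theorem mem_graph_iff {u f : L2} : (u, f) ∈ sturmLiouvilleGraph A.p A.q ↔
    ∃ v w : L2, IsWeakDeriv u v ∧ IsWeakDeriv (mulL A.p v) w ∧ f = -w + mulL A.q u := by
  constructor
  · rintro ⟨-, v, z, w, hv, hz, hw, hf⟩
    refine ⟨v, w, hv, ?_, ?_⟩
    · have : z = mulL A.p v := by
        apply Lp.ext
        filter_upwards [hz, coeFn_mulL A.p v] with t h1 h2
        rw [h1, h2]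
      rwa [← this]
    · apply Lp.ext
      filter_upwards [hf, coeFn_mulL A.q u, Lp.coeFn_add (-w) (mulL A.q u), Lp.coeFn_neg w]
        with t h1 h2 h3 h4
      rw [h1, h3, Pi.add_apply, h2, h4, Pi.neg_apply]
  · rintro ⟨v, w, hv, hw, rfl⟩
    obtain ⟨v', hv'⟩ := A.isWeakDeriv_of_mulL hw
    refine ⟨mem_sobolevH2_iff.2 ⟨v, v', hv, hv'⟩, v, mulL A.p v, w, hv, coeFn_mulL A.p v, hw, ?_⟩
    filter_upwards [coeFn_mulL A.q u, Lp.coeFn_add (-w) (mulL A.q u), Lp.coeFn_neg w]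
        with t h2 h3 h4
    rw [h3, Pi.add_apply, h2, h4, Pi.neg_apply]

theorem exists_apply_eq {u f : L2} (h : (u, f) ∈ sturmLiouvilleGraph A.p A.q) :
    ∃ x : A.op.domain, (x : L2) = u ∧ A.op x = f := by
  rw [← sturmLiouville_graph, LinearPMap.mem_graph_iff] at h
  exact h

theorem mem_graph_apply (u : A.op.domain) : ((u : L2), A.op u) ∈ sturmLiouvilleGraph A.p A.q := by
  rw [← sturmLiouville_graph]
  exact LinearPMap.mem_graph _ u

theorem domain_eq : A.op.domain = sobolevH2 := by
  ext u
  constructor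
  · intro hu
    exact (A.mem_graph_apply ⟨u, hu⟩).1
  · intro hu
    obtain ⟨v, v', hv, hv'⟩ := mem_sobolevH2_iff.1 hu
    have : (u, -(mulL A.p' v + mulL A.p v') + mulL A.q u) ∈ sturmLiouvilleGraph A.p A.q :=
      A.mem_graph_iff.2 ⟨v, _, hv, hv'.mulL A.hasDerivAt_p, rfl⟩
    obtain ⟨x, hx, -⟩ := A.exists_apply_eq this
    rw [← hx]
    exact x.2

theorem inner_apply_left (u : A.op.domain) {y v v₂ : L2} (hu : IsWeakDeriv (u : L2) v)
    (hy : IsWeakDeriv y v₂) :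
    ⟪y, A.op u⟫_ℂ = ⟪v₂, mulL A.p v⟫_ℂ + ⟪y, mulL A.q u⟫_ℂ := by
  obtain ⟨v₁, w, hv, hw, hf⟩ := A.mem_graph_iff.1 (A.mem_graph_apply u)
  obtain rfl := hv.unique hu
  rw [hf, inner_add_right, inner_neg_right, ← hy.inner_eq hw]

theorem isSymm : IsSymm A.op := by
  intro x y
  obtain ⟨v, w, hv, hw, hf⟩ := A.mem_graph_iff.1 (A.mem_graph_apply x)
  obtain ⟨v₂, w₂, hv₂, hw₂, hf₂⟩ := A.mem_graph_iff.1 (A.mem_graph_apply y)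
  rw [A.inner_apply_left y hv₂ hv, ← inner_conj_symm, A.inner_apply_left x hv hv₂, map_add,
    inner_conj_symm, inner_conj_symm, inner_mulL, inner_mulL]

theorem re_form (u : A.op.domain) {v : L2} (hu : IsWeakDeriv (u : L2) v) :
    (⟪(u : L2), A.op u⟫_ℂ).re = (∫ t, A.p t * ‖v t‖ ^ 2) + ∫ t, A.q t * ‖(u : L2) t‖ ^ 2 := by
  rw [A.inner_apply_left u hu hu, Complex.add_re, re_inner_mulL, re_inner_mulL]

theorem form_lower_bound (u : A.op.domain) :
    -‖A.q‖ * ‖(u : L2)‖ ^ 2 ≤ (⟪(u : L2), A.op u⟫_ℂ).re := by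
  obtain ⟨v, w, hv, hw, hf⟩ := A.mem_graph_iff.1 (A.mem_graph_apply u)
  rw [A.re_form u hv, norm_sq_eq_integral, ← integral_const_mul]
  have h1 : 0 ≤ ∫ t, A.p t * ‖v t‖ ^ 2 := integral_nonneg fun t =>
    mul_nonneg (A.low_pos.le.trans (A.low_le t)) (by positivity)
  have h2 : ∫ t, -‖A.q‖ * ‖(u : L2) t‖ ^ 2 ≤ ∫ t, A.q t * ‖(u : L2) t‖ ^ 2 := by
    refine integral_mono ((integrable_norm_sq _).const_mul _) (integrable_mul_norm_sq _ _) fun t => ?_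
    have := (abs_le.1 (A.q.norm_coe_le_norm t)).1
    dsimp only
    gcongr
  linarith

theorem dense_sobolevH2 : Dense (sobolevH2 : Set L2) := by
  have h := SchwartzMap.denseRange_toLpCLM (p := 2) (F := ℂ) (E := ℝ) (μ := volume)
    ENNReal.ofNat_ne_top
  refine Dense.mono ?_ h
  rintro _ ⟨f, rfl⟩
  change MemSobolev 2 2 _
  have : ((SchwartzMap.toLpCLM ℝ ℂ 2 volume f : L2) : 𝓢'(ℝ, ℂ)) = (f : 𝓢'(ℝ, ℂ)) := by
    rw [SchwartzMap.toLpCLM_apply, Lp.toTemperedDistribution_toLp_eq]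
  rw [this]
  exact f.memSobolev

/-- The Riesz representation argument for the energy form, phrased as an orthogonal projection. With
`s = √(q + r)` and `t = √p`, the pairs `(s u, t u')` form a closed subspace of `L² ⊕ L²` whose norm
is the energy norm. -/
theorem exists_sub_smul_eq {r : ℝ} (hr : ∀ x, 1 ≤ A.q x + r) (f : L2) :
    ∃ u : A.op.domain, A.op u + (r : ℂ) • (u : L2) = f := by
  set Q : ℝ →ᵇ ℝ := A.q + BoundedContinuousFunction.const ℝ r with hQ
  have hQ1 : ∀ x, 1 ≤ Q x := hr
  set s := bcfSqrt Q with hs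
  have hs1 : ∀ x, 1 ≤ s x := fun x => Real.one_le_sqrt.2 (hQ1 x)
  set t := bcfSqrt A.p with ht
  have ht1 : ∀ x, √A.low ≤ t x := fun x => Real.sqrt_le_sqrt (A.low_le x)
  have htl : 0 < √A.low := Real.sqrt_pos.2 A.low_pos
  set si := bcfInv s one_pos hs1
  set ti := bcfInv t htl ht1
  let K : Submodule ℂ (WithLp 2 (L2 × L2)) :=
    { carrier := {x | IsWeakDeriv (mulL si x.fst) (mulL ti x.snd)}
      zero_mem' := by
        simpa using isWeakDeriv_zero
      add_mem' := fun {x y} hx hy => by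
        have := IsWeakDeriv.add hx hy
        rw [← map_add, ← map_add] at this
        exact this
      smul_mem' := fun a x hx => by
        have := IsWeakDeriv.smul a hx
        rw [← map_smul, ← map_smul] at this
        exact this }
  have hK : IsClosed (K : Set (WithLp 2 (L2 × L2))) := by
    have hc : Continuous fun x : WithLp 2 (L2 × L2) => (mulL si x.fst, mulL ti x.snd) := by
      have := WithLp.prod_continuous_ofLp 2 L2 L2
      exact ((mulL si).continuous.comp (continuous_fst.comp this)).prodMk
        ((mulL ti).continuous.comp (continuous_snd.comp this))
    exact isClosed_weakDeriv.preimage hc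
  have := hK.completeSpace_coe
  -- The first component of the projection is `s u` for the solution `u`. Orthogonality of the
  -- remainder to every pair `(s a, t a')` is the weak equation `(p u')' = (q + r) u - f`.
  obtain ⟨x, hx, y, hy, hxy⟩ := K.exists_add_mem_mem_orthogonal (WithLp.toLp 2 (mulL si f, (0 : L2)))
  set u := mulL si x.fst with hu
  set v := mulL ti x.snd with hv
  have huv : IsWeakDeriv u v := hx
  have hxf : x.fst = mulL s u := (mulL_mulL_bcfInv _ _ _ _).symm
  have hxs : x.snd = mulL t v := (mulL_mulL_bcfInv _ _ _ _).symm
  have hy1 : y.fst = mulL si f - mulL s u := by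
    have := congrArg WithLp.fst hxy
    rw [← hxf, eq_sub_iff_add_eq, add_comm]
    exact this.symm
  have hy2 : y.snd = - mulL t v := by
    have := congrArg WithLp.snd hxy
    rw [← hxs, eq_neg_iff_add_eq_zero, add_comm]
    exact this.symm
  have hss : ∀ a, mulL s (mulL s a) = mulL A.q a + (r : ℂ) • a := by
    intro a
    rw [hs, mulL_bcfSqrt _ fun x => zero_le_one.trans (hQ1 x)]
    apply Lp.ext
    filter_upwards [coeFn_mulL Q a, coeFn_mulL A.q a, Lp.coeFn_add (mulL A.q a) ((r : ℂ) • a),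
      Lp.coeFn_smul (r : ℂ) a] with z h1 h2 h3 h4
    rw [h1, h3, Pi.add_apply, h2, h4, Pi.smul_apply, smul_eq_mul, hQ,
      BoundedContinuousFunction.add_apply, BoundedContinuousFunction.const_apply]
    push_cast
    ring
  have hw : IsWeakDeriv (mulL A.p v) (mulL A.q u + (r : ℂ) • u - f) := by
    apply isWeakDeriv_of_test
    intro a b ha hb hab
    have hd := isWeakDeriv_of_hasDerivAt hab ha hb
    set a' := ha.toLp a
    set b' := hb.toLp b
    have hmem : WithLp.toLp 2 (mulL s a', mulL t b') ∈ K := by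
      change IsWeakDeriv (mulL si (mulL s a')) (mulL ti (mulL t b'))
      rw [mulL_bcfInv_mulL, mulL_bcfInv_mulL]
      exact hd
    have h0 := (Submodule.mem_orthogonal _ _).1 hy _ hmem
    rw [WithLp.prod_inner_apply] at h0
    have h1 : ⟪mulL s a', y.fst⟫_ℂ + ⟪mulL t b', y.snd⟫_ℂ = 0 := h0
    rw [hy1, hy2, inner_mulL, inner_mulL, map_sub, mulL_mulL_bcfInv, map_neg, hss,
      mulL_bcfSqrt _ fun x => A.low_pos.le.trans (A.low_le x), inner_neg_right,
      inner_sub_right] at h1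
    rw [inner_sub_right]
    linear_combination -h1
  obtain ⟨z, hz1, hz2⟩ := A.exists_apply_eq (A.mem_graph_iff.2 ⟨v, _, huv, hw, rfl⟩)
  refine ⟨z, ?_⟩
  rw [hz2, hz1]
  abel

theorem isSelfAdjoint : IsSelfAdjoint A.op := by
  have hd : Dense (A.op.domain : Set L2) := by
    rw [A.domain_eq]; exact dense_sobolevH2
  -- This shift makes `q + r ≥ 1` pointwise.
  refine isSelfAdjoint_of_symm_of_surjective hd A.isSymm (‖A.q‖ + 1)
    (A.exists_sub_smul_eq fun x => ?_)
  have := (abs_le.1 (A.q.norm_coe_le_norm x)).1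
  linarith

theorem mem_graph_of_hasDerivAt {u u' u'' : ℝ → ℂ} (h : ∀ x, HasDerivAt u (u' x) x)
    (h' : ∀ x, HasDerivAt u' (u'' x) x) (hu : MemLp u 2 volume) (hu' : MemLp u' 2 volume)
    (hu'' : MemLp u'' 2 volume) {f : L2}
    (hf : ∀ᵐ x, f x = -((A.p' x : ℂ) * u' x + (A.p x : ℂ) * u'' x) + (A.q x : ℂ) * u x) :
    (hu.toLp u, f) ∈ sturmLiouvilleGraph A.p A.q := by
  refine A.mem_graph_iff.2 ⟨hu'.toLp u', mulL A.p' (hu'.toLp u') + mulL A.p (hu''.toLp u''),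
    isWeakDeriv_of_hasDerivAt h hu hu',
    (isWeakDeriv_of_hasDerivAt h' hu' hu'').mulL A.hasDerivAt_p, ?_⟩
  rw [mulL_toLp, mulL_toLp, mulL_toLp]
  apply Lp.ext
  filter_upwards [hf, Lp.coeFn_add (-((memLp_bcf_mul_fun A.p' hu').toLp _ +
    (memLp_bcf_mul_fun A.p hu'').toLp _)) ((memLp_bcf_mul_fun A.q hu).toLp _),
    Lp.coeFn_neg ((memLp_bcf_mul_fun A.p' hu').toLp _ + (memLp_bcf_mul_fun A.p hu'').toLp _),
    Lp.coeFn_add ((memLp_bcf_mul_fun A.p' hu').toLp _) ((memLp_bcf_mul_fun A.p hu'').toLp _),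
    (memLp_bcf_mul_fun A.p' hu').coeFn_toLp, (memLp_bcf_mul_fun A.p hu'').coeFn_toLp,
    (memLp_bcf_mul_fun A.q hu).coeFn_toLp] with x h1 h2 h3 h4 h5 h6 h7
  rw [h1, h2, Pi.add_apply, h3, Pi.neg_apply, h4, Pi.add_apply, h5, h6, h7]

theorem apply_toLp_of_contDiff {u : ℝ → ℂ} (hu : MemLp u 2 volume) (hc : ContDiff ℝ ∞ u)
    (hs : HasCompactSupport u) : ∃ h : hu.toLp u ∈ A.op.domain,
      ∀ᵐ x, A.op ⟨hu.toLp u, h⟩ x =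
        -deriv (fun y => (A.p y : ℂ) * deriv u y) x + (A.q x : ℂ) * u x := by
  have hd : ∀ x, HasDerivAt u (deriv u x) x := fun x =>
    (hc.differentiable (by simp)).differentiableAt.hasDerivAt
  have hc1 : ContDiff ℝ ∞ (deriv u) := ContDiff.deriv' (n := ∞) hc
  have hd1 : ∀ x, HasDerivAt (deriv u) (deriv (deriv u) x) x := fun x =>
    (hc1.differentiable (by simp)).differentiableAt.hasDerivAt
  have hc2 : ContDiff ℝ ∞ (deriv (deriv u)) := ContDiff.deriv' (n := ∞) hc1
  have m1 : MemLp (deriv u) 2 (volume : Measure ℝ) :=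
    hc1.continuous.memLp_of_hasCompactSupport hs.deriv
  have m2 : MemLp (deriv (deriv u)) 2 (volume : Measure ℝ) :=
    hc2.continuous.memLp_of_hasCompactSupport hs.deriv.deriv
  have hpd : ∀ x, HasDerivAt (fun y => (A.p y : ℂ) * deriv u y)
      ((A.p' x : ℂ) * deriv u x + (A.p x : ℂ) * deriv (deriv u) x) x :=
    fun x => (A.hasDerivAt_p x).ofReal_comp.mul (hd1 x)
  have hm : MemLp (fun x => -((A.p' x : ℂ) * deriv u x + (A.p x : ℂ) * deriv (deriv u) x) +
      (A.q x : ℂ) * u x) 2 volume :=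
    ((memLp_bcf_mul_fun A.p' m1).add (memLp_bcf_mul_fun A.p m2)).neg.add (memLp_bcf_mul_fun A.q hu)
  obtain ⟨x, hx1, hx2⟩ := A.exists_apply_eq
    (A.mem_graph_of_hasDerivAt hd hd1 hu m1 m2 hm.coeFn_toLp)
  have hmem : hu.toLp u ∈ A.op.domain := by rw [← hx1]; exact x.2
  refine ⟨hmem, ?_⟩
  have : (⟨hu.toLp u, hmem⟩ : A.op.domain) = x := Subtype.ext hx1.symm
  rw [this, hx2]
  filter_upwards [hm.coeFn_toLp] with y hy
  rw [hy, (hpd y).deriv]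

end Coeff

end BCH

/-! ### The essential spectrum: a Poincaré inequality and wave packets -/

namespace BCH

open scoped ComplexConjugate InnerProductSpace BoundedContinuousFunction

section Poincare

/-- The variance of `f` about its mean `c` is nonnegative. -/
theorem sq_intervalIntegral_le {f : ℝ → ℝ} (hf : Continuous f) {a b : ℝ} (hab : a < b) :
    (∫ x in a..b, f x) ^ 2 ≤ (b - a) * ∫ x in a..b, f x ^ 2 := by
  have hba : 0 < b - a := sub_pos.2 hab
  set c := (∫ x in a..b, f x) / (b - a) with hc
  have h0 : 0 ≤ ∫ x in a..b, (f x - c) ^ 2 :=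
    intervalIntegral.integral_nonneg hab.le fun x _ => sq_nonneg _
  have e : ∫ x in a..b, (f x - c) ^ 2 =
      (∫ x in a..b, f x ^ 2) - 2 * c * (∫ x in a..b, f x) + (b - a) * c ^ 2 := by
    have : (fun x => (f x - c) ^ 2) = fun x => (f x ^ 2 - 2 * c * f x) + c ^ 2 := by
      funext x; ring
    rw [this, intervalIntegral.integral_add, intervalIntegral.integral_sub,
      intervalIntegral.integral_const_mul, intervalIntegral.integral_const, smul_eq_mul]
    all_goals exact Continuous.intervalIntegrable (by fun_prop) _ _
  rw [e] at h0
  have h1 : ∫ x in a..b, f x = c * (b - a) := by rw [hc]; field_simp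
  rw [h1] at h0 ⊢
  nlinarith

/-- A Poincaré inequality on an interval, with the mean in place of a boundary condition. -/
theorem intervalIntegral_norm_sq_le {U V : ℝ → ℂ} (hU : ∀ x, HasDerivAt U (V x) x)
    (hV : Continuous V) {a b : ℝ} (hab : a < b) :
    ∫ x in a..b, ‖U x‖ ^ 2 ≤ 2 * (b - a) ^ 2 * (∫ x in a..b, ‖V x‖ ^ 2) +
      2 / (b - a) * ‖∫ x in a..b, U x‖ ^ 2 := by
  have hba : 0 < b - a := sub_pos.2 hab
  have hUc : Continuous U := continuous_iff_continuousAt.2 fun x => (hU x).continuousAt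
  set D := ∫ x in a..b, ‖V x‖
  have hD : D ^ 2 ≤ (b - a) * ∫ x in a..b, ‖V x‖ ^ 2 := sq_intervalIntegral_le hV.norm hab
  set m := ∫ x in a..b, U x with hm
  have hosc : ∀ x ∈ Set.Icc a b, ∀ y ∈ Set.Icc a b, ‖U x - U y‖ ≤ D := by
    intro x hx y hy
    have h1 : U x - U y = ∫ t in y..x, V t :=
      (intervalIntegral.integral_eq_sub_of_hasDerivAt (fun t _ => hU t)
        (hV.intervalIntegrable _ _)).symm
    rw [h1]
    have h2 := intervalIntegral.norm_integral_le_abs_integral_norm (f := V) (a := y) (b := x) (μ := volume)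
    refine h2.trans ?_
    have hint : IntervalIntegrable (fun t => ‖V t‖) volume a b := hV.norm.intervalIntegrable _ _
    rcases le_total y x with h | h
    · rw [abs_of_nonneg (intervalIntegral.integral_nonneg h fun t _ => norm_nonneg _)]
      exact intervalIntegral.integral_mono_interval hy.1 h hx.2
        (Eventually.of_forall fun t => norm_nonneg _) hint
    · rw [intervalIntegral.integral_symm, abs_neg,
        abs_of_nonneg (intervalIntegral.integral_nonneg h fun t _ => norm_nonneg _)]
      exact intervalIntegral.integral_mono_interval hx.1 h hy.2
        (Eventually.of_forall fun t => norm_nonneg _) hint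
  -- `U` deviates from its mean `m / (b - a)` by at most its oscillation, which `D` bounds.
  have hpt : ∀ x ∈ Set.Icc a b, ‖U x‖ ^ 2 ≤ 2 * D ^ 2 + 2 * (‖m‖ / (b - a)) ^ 2 := by
    intro x hx
    have h1 : ‖((b - a : ℝ) : ℂ) * U x - m‖ ≤ D * (b - a) := by
      have : ((b - a : ℝ) : ℂ) * U x - m = ∫ y in a..b, (U x - U y) := by
        rw [intervalIntegral.integral_sub (by simp) (hUc.intervalIntegrable _ _),
          intervalIntegral.integral_const, Complex.real_smul]
      rw [this]
      have := intervalIntegral.norm_integral_le_of_norm_le_const (f := fun y => U x - U y) (C := D)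
        (a := a) (b := b) (fun y hy => by
          rw [Set.uIoc_of_le hab.le] at hy
          exact hosc x hx y ⟨hy.1.le, hy.2⟩)
      rwa [abs_of_pos hba] at this
    have h2 : (b - a) * ‖U x‖ ≤ D * (b - a) + ‖m‖ := by
      have : ‖((b - a : ℝ) : ℂ) * U x‖ ≤ _ := norm_le_norm_sub_add _ m
      rw [norm_mul, Complex.norm_real, Real.norm_of_nonneg hba.le] at this
      linarith
    have h3 : ‖U x‖ ≤ D + ‖m‖ / (b - a) := by
      rw [← mul_le_mul_iff_right₀ hba, mul_add, mul_div_cancel₀ _ hba.ne']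
      linarith
    have h4 : ‖U x‖ ^ 2 ≤ (D + ‖m‖ / (b - a)) ^ 2 := pow_le_pow_left₀ (norm_nonneg _) h3 2
    nlinarith [sq_nonneg (D - ‖m‖ / (b - a))]
  have h5 : ∫ x in a..b, ‖U x‖ ^ 2 ≤ ∫ _ in a..b, (2 * D ^ 2 + 2 * (‖m‖ / (b - a)) ^ 2) :=
    intervalIntegral.integral_mono_on hab.le ((hUc.norm.pow 2).intervalIntegrable _ _)
      (by simp) hpt
  rw [intervalIntegral.integral_const, smul_eq_mul] at h5
  refine h5.trans ?_
  have h6 : (b - a) * (2 * (‖m‖ / (b - a)) ^ 2) = 2 / (b - a) * ‖m‖ ^ 2 := by field_simp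
  have h7 : (b - a) * (2 * D ^ 2) ≤ 2 * (b - a) ^ 2 * ∫ x in a..b, ‖V x‖ ^ 2 := by
    nlinarith
  linarith

end Poincare

namespace Coeff

variable (A : Coeff)

theorem exists_representative (u : A.op.domain) : ∃ (v : L2) (U V : ℝ → ℂ),
    IsWeakDeriv (u : L2) v ∧ (∀ x, HasDerivAt U (V x) x) ∧ Continuous V ∧
      (∀ᵐ x, (u : L2) x = U x) ∧ ∀ᵐ x, v x = V x := by
  have hu : (u : L2) ∈ sobolevH2 := by rw [← A.domain_eq]; exact u.2
  obtain ⟨v, w, hv, hw⟩ := mem_sobolevH2_iff.1 hu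
  obtain ⟨U, V, h1, h2, h3, h4⟩ := hv.exists_hasDerivAt hw
  exact ⟨v, U, V, hv, h1, h2, h3, h4⟩

/-- Outside a finite-dimensional space the form is bounded below by the limit of the potential. -/
theorem hasFormBound {a R : ℝ} (hR : 0 < R) (hq : ∀ x, R ≤ |x| → a ≤ A.q x) :
    HasFormBound A.op a := by
  set M := ‖A.q‖ + |a| with hM
  have hM0 : 0 ≤ M := by positivity
  have hlow := A.low_pos
  -- The interval `[-R, R]` is cut into `N` cells of length `h`, so fine that `2 M h² ≤ low`. The
  -- Poincaré error, multiplied by `M`, is then absorbed by the gradient term.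
  obtain ⟨N, hN⟩ := exists_nat_gt (8 * M * R ^ 2 / A.low)
  have hN0 : (0 : ℝ) < N := lt_of_le_of_lt (by positivity) hN
  set h := 2 * R / N with hh
  have hh0 : 0 < h := by positivity
  have hsmall : M * (2 * h ^ 2) ≤ A.low := by
    have hN1 : (1 : ℝ) ≤ N := by exact_mod_cast (Nat.cast_pos.1 hN0)
    rw [div_lt_iff₀ hlow] at hN
    rw [hh, div_pow, show M * (2 * ((2 * R) ^ 2 / (N : ℝ) ^ 2)) = 8 * M * R ^ 2 / (N : ℝ) ^ 2 by ring,
      div_le_iff₀ (by positivity)]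
    nlinarith [mul_nonneg hlow.le (mul_nonneg hN0.le (sub_nonneg.2 hN1))]
  set x : ℕ → ℝ := fun j => -R + j * h with hx
  have hstep : ∀ j, x (j + 1) - x j = h := fun j => by simp only [hx]; push_cast; ring
  have hlt : ∀ j, x j < x (j + 1) := fun j => by linarith [hstep j]
  have hx0 : x 0 = -R := by simp [hx]
  have hxN : x N = R := by simp only [hx, hh]; field_simp; ring
  -- The finite-rank part collects the integrals over the cells, which vanish exactly when all cell
  -- means do.
  let l : L2 →L[ℂ] (Fin N → ℂ) := ContinuousLinearMap.pi fun j =>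
    innerSL ℂ (indicatorConstLp 2 (measurableSet_Ioc (a := x j) (b := x (j + 1)))
      (by simp) (1 : ℂ))
  have hl : ∀ (u : L2) (j : Fin N), l u j = ∫ t in (x j)..(x (j + 1)), u t := by
    intro u j
    rw [intervalIntegral.integral_of_le (hlt j).le]
    exact L2.inner_indicatorConstLp_one _ _ u
  refine ⟨N, l, M * (2 / h * N), fun u => ?_⟩
  obtain ⟨v, U, V, hv, hU, hV, huU, hvV⟩ := A.exists_representative u
  have hUc : Continuous U := continuous_iff_continuousAt.2 fun x => (hU x).continuousAt
  have iU : Integrable fun t => ‖U t‖ ^ 2 := (integrable_norm_sq (u : L2)).congr (by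
    filter_upwards [huU] with t ht
    rw [ht])
  have iV : Integrable fun t => ‖V t‖ ^ 2 := (integrable_norm_sq v).congr (by
    filter_upwards [hvV] with t ht
    rw [ht])
  have iqU : Integrable fun t => A.q t * ‖U t‖ ^ 2 := (integrable_mul_norm_sq A.q (u : L2)).congr (by
    filter_upwards [huU] with t ht
    rw [ht])
  have ipV : Integrable fun t => A.p t * ‖V t‖ ^ 2 := (integrable_mul_norm_sq A.p v).congr (by
    filter_upwards [hvV] with t ht
    rw [ht])
  have eN : ‖(u : L2)‖ ^ 2 = ∫ t, ‖U t‖ ^ 2 := by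
    rw [norm_sq_eq_integral]
    exact integral_congr_ae (by filter_upwards [huU] with t ht; rw [ht])
  have eF : (⟪(u : L2), A.op u⟫_ℂ).re = (∫ t, A.p t * ‖V t‖ ^ 2) + ∫ t, A.q t * ‖U t‖ ^ 2 := by
    rw [A.re_form u hv]
    congr 1
    · exact integral_congr_ae (by filter_upwards [hvV] with t ht; rw [ht])
    · exact integral_congr_ae (by filter_upwards [huU] with t ht; rw [ht])
  have hint : ∀ j : ℕ, ∫ t in (x j)..(x (j + 1)), ‖U t‖ ^ 2 ≤
      2 * h ^ 2 * (∫ t in (x j)..(x (j + 1)), ‖V t‖ ^ 2) +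
        2 / h * ‖∫ t in (x j)..(x (j + 1)), U t‖ ^ 2 := by
    intro j
    have := intervalIntegral_norm_sq_le hU hV (hlt j)
    rwa [hstep j] at this
  have hsum : ∫ t in (-R)..R, ‖U t‖ ^ 2 ≤ 2 * h ^ 2 * (∫ t in (-R)..R, ‖V t‖ ^ 2) +
      2 / h * N * ‖l u‖ ^ 2 := by
    have s1 := intervalIntegral.sum_integral_adjacent_intervals (n := N) (a := x)
      (f := fun t => ‖U t‖ ^ 2) (μ := volume) fun k _ => (hUc.norm.pow 2).intervalIntegrable _ _
    have s2 := intervalIntegral.sum_integral_adjacent_intervals (n := N) (a := x)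
      (f := fun t => ‖V t‖ ^ 2) (μ := volume) fun k _ => (hV.norm.pow 2).intervalIntegrable _ _
    rw [hx0, hxN] at s1 s2
    rw [← s1, ← s2, Finset.mul_sum]
    have s3 : ∀ j ∈ Finset.range N, ∫ t in (x j)..(x (j + 1)), ‖U t‖ ^ 2 ≤
        2 * h ^ 2 * (∫ t in (x j)..(x (j + 1)), ‖V t‖ ^ 2) + 2 / h * ‖l u‖ ^ 2 := by
      intro j hj
      refine (hint j).trans ?_
      gcongr
      have e : l u ⟨j, Finset.mem_range.1 hj⟩ = ∫ t in (x j)..(x (j + 1)), U t := by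
        rw [hl]
        refine intervalIntegral.integral_congr_ae ?_
        filter_upwards [huU] with t ht _
        exact ht
      rw [← e]
      exact norm_le_pi_norm (l u) _
    refine (Finset.sum_le_sum s3).trans (le_of_eq ?_)
    rw [Finset.sum_add_distrib, Finset.sum_const, Finset.card_range, nsmul_eq_mul]
    ring
  have hIV : ∫ t in (-R)..R, ‖V t‖ ^ 2 ≤ ∫ t, ‖V t‖ ^ 2 := by
    rw [intervalIntegral.integral_of_le (by linarith)]
    exact setIntegral_le_integral iV (Eventually.of_forall fun t => by positivity)
  have hp : A.low * ∫ t, ‖V t‖ ^ 2 ≤ ∫ t, A.p t * ‖V t‖ ^ 2 := by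
    rw [← integral_const_mul]
    refine integral_mono (iV.const_mul _) ipV fun t => ?_
    have := A.low_le t
    dsimp only
    gcongr
  -- Outside `[-R, R]` the potential is at least `a`; inside, `a - q` is at most `M`.
  have hqU : a * (∫ t, ‖U t‖ ^ 2) - M * (∫ t in (-R)..R, ‖U t‖ ^ 2) ≤ ∫ t, A.q t * ‖U t‖ ^ 2 := by
    rw [intervalIntegral.integral_of_le (by linarith), ← integral_indicator measurableSet_Ioc,
      ← integral_const_mul, ← integral_const_mul, ← integral_sub (iU.const_mul _)
        ((iU.indicator measurableSet_Ioc).const_mul _)]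
    refine integral_mono ((iU.const_mul _).sub ((iU.indicator measurableSet_Ioc).const_mul _)) iqU
      fun t => ?_
    dsimp only
    by_cases ht : t ∈ Set.Ioc (-R) R
    · rw [Set.indicator_of_mem ht, ← sub_mul]
      have := (abs_le.1 (A.q.norm_coe_le_norm t)).1
      have := le_abs_self a
      gcongr
      linarith
    · rw [Set.indicator_of_notMem ht, mul_zero, sub_zero]
      have : R ≤ |t| := by
        by_contra hlt
        rw [not_le, abs_lt] at hlt
        exact ht ⟨hlt.1, hlt.2.le⟩
      have := hq t this
      gcongr
  rw [eN, eF]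
  set IV := ∫ t, ‖V t‖ ^ 2
  have hIV0 : 0 ≤ IV := integral_nonneg fun t => by positivity
  have h1 : M * (∫ t in (-R)..R, ‖U t‖ ^ 2) ≤ A.low * IV + M * (2 / h * N) * ‖l u‖ ^ 2 := by
    calc M * (∫ t in (-R)..R, ‖U t‖ ^ 2)
        ≤ M * (2 * h ^ 2 * IV + 2 / h * N * ‖l u‖ ^ 2) := by
          refine mul_le_mul_of_nonneg_left (hsum.trans ?_) hM0
          gcongr
      _ = M * (2 * h ^ 2) * IV + M * (2 / h * N) * ‖l u‖ ^ 2 := by ring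
      _ ≤ _ := by gcongr
  linarith

theorem hasFormBound_of_tendsto {L : ℝ} (ht : Tendsto A.q atTop (𝓝 L))
    (hb : Tendsto A.q atBot (𝓝 L)) {a : ℝ} (ha : a < L) : HasFormBound A.op a := by
  obtain ⟨R₁, h1⟩ := eventually_atTop.1 (ht.eventually (lt_mem_nhds ha))
  obtain ⟨R₂, h2⟩ := eventually_atBot.1 (hb.eventually (lt_mem_nhds ha))
  refine A.hasFormBound (R := max 1 (max |R₁| |R₂|)) (by positivity) fun x hx => ?_
  have e1 : |R₁| ≤ |x| := le_trans (le_max_of_le_right (le_max_left _ _)) hx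
  have e2 : |R₂| ≤ |x| := le_trans (le_max_of_le_right (le_max_right _ _)) hx
  rcases le_total 0 x with h | h
  · rw [abs_of_nonneg h] at e1
    exact (h1 x ((le_abs_self _).trans e1)).le
  · rw [abs_of_nonpos h] at e2
    refine (h2 x ?_).le
    linarith [neg_abs_le R₂]

/-- A bounded inverse of `A - r` also bounds the inverse of the limit operator at infinity. -/
theorem integral_norm_sq_le_of_mem_resolventSet {P L r : ℝ} (hp : Tendsto A.p atTop (𝓝 P))
    (hp' : Tendsto A.p' atTop (𝓝 0)) (hq : Tendsto A.q atTop (𝓝 L))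
    (hr : (r : ℂ) ∈ resolventSet A.op) : ∃ K : ℝ, ∀ u u' u'' : ℝ → ℂ,
      (∀ x, HasDerivAt u (u' x) x) → (∀ x, HasDerivAt u' (u'' x) x) → MemLp u 2 volume →
      MemLp u' 2 volume → MemLp u'' 2 volume →
      ∫ x, ‖u x‖ ^ 2 ≤ K * ∫ x, ‖-((P : ℂ) * u'' x) + ((L - r : ℝ) : ℂ) * u x‖ ^ 2 := by
  obtain ⟨S, hS1, hS2⟩ := hr
  refine ⟨‖S‖ ^ 2, fun u u' u'' hd hd' hu hu' hu'' => ?_⟩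
  set F : ℕ → ℝ → ℂ := fun n x => -((A.p' (x + n) : ℂ) * u' x + (A.p (x + n) : ℂ) * u'' x) +
    (A.q (x + n) - r : ℝ) * u x with hF
  -- The resolvent estimate is applied to the translate `u (· - n)`. Translating back moves the
  -- coefficients to `x + n`, where they approach their limits.
  have hn : ∀ n : ℕ, ∫ x, ‖u x‖ ^ 2 ≤ ‖S‖ ^ 2 * ∫ x, ‖F n x‖ ^ 2 := by
    intro n
    have mp := measurePreserving_sub_right (volume : Measure ℝ) (n : ℝ)
    have tu : MemLp (fun x => u (x - n)) 2 volume := hu.comp_measurePreserving mp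
    have tu' : MemLp (fun x => u' (x - n)) 2 volume := hu'.comp_measurePreserving mp
    have tu'' : MemLp (fun x => u'' (x - n)) 2 volume := hu''.comp_measurePreserving mp
    have hmul := (((memLp_bcf_mul_fun A.p' tu').add (memLp_bcf_mul_fun A.p tu'')).neg.add
      (memLp_bcf_mul_fun A.q tu))
    have hg := A.mem_graph_of_hasDerivAt (u := fun x => u (x - n)) (u' := fun x => u' (x - n))
      (u'' := fun x => u'' (x - n)) (f := hmul.toLp _)
      (fun x => by simpa using (hd (x - n)).comp_sub_const x (n : ℝ))
      (fun x => by simpa using (hd' (x - n)).comp_sub_const x (n : ℝ)) tu tu' tu''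
      hmul.coeFn_toLp
    obtain ⟨y, hy1, hy2⟩ := A.exists_apply_eq hg
    have h1 := hS2 y
    have h2 : ‖(y : L2)‖ ≤ ‖S‖ * ‖A.op y - (r : ℂ) • (y : L2)‖ := by
      rw [← h1]
      refine (S.le_opNorm _).trans ?_
      rw [h1]
    have h3 : ‖(y : L2)‖ ^ 2 ≤ ‖S‖ ^ 2 * ‖A.op y - (r : ℂ) • (y : L2)‖ ^ 2 := by
      rw [← mul_pow]
      exact pow_le_pow_left₀ (norm_nonneg _) h2 2
    have e1 : ‖(y : L2)‖ ^ 2 = ∫ x, ‖u x‖ ^ 2 := by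
      rw [hy1, norm_sq_eq_integral, ← integral_sub_right_eq_self (fun x => ‖u x‖ ^ 2) (n : ℝ)]
      refine integral_congr_ae ?_
      filter_upwards [tu.coeFn_toLp] with x hx
      rw [hx]
    have e2 : ‖A.op y - (r : ℂ) • (y : L2)‖ ^ 2 = ∫ x, ‖F n x‖ ^ 2 := by
      rw [hy2, hy1, norm_sq_eq_integral,
        ← integral_sub_right_eq_self (fun x => ‖F n x‖ ^ 2) (n : ℝ)]
      refine integral_congr_ae ?_
      filter_upwards [tu.coeFn_toLp, hmul.coeFn_toLp, Lp.coeFn_sub (hmul.toLp _) ((r : ℂ) • tu.toLp _),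
        Lp.coeFn_smul (r : ℂ) (tu.toLp _)] with x h1 h2 h3 h4
      have e3 : (hmul.toLp _ - (r : ℂ) • tu.toLp (fun x => u (x - n)) : L2) x = F n (x - n) := by
        erw [h3]
        rw [Pi.sub_apply, h2]
        erw [h4]
        rw [Pi.smul_apply, h1]
        simp only [hF, Pi.add_apply, Pi.neg_apply, sub_add_cancel, smul_eq_mul]
        push_cast
        ring
      exact congrArg (fun z : ℂ => ‖z‖ ^ 2) e3
    rwa [e1, e2] at h3
  have hlim : Tendsto (fun n : ℕ => ∫ x, ‖F n x‖ ^ 2) atTop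
      (𝓝 (∫ x, ‖-((P : ℂ) * u'' x) + ((L - r : ℝ) : ℂ) * u x‖ ^ 2)) := by
    set C := ‖A.p'‖ + ‖A.p‖ + ‖A.q‖ + |r|
    refine tendsto_integral_of_dominated_convergence
      (fun x => C ^ 2 * 3 * (‖u' x‖ ^ 2 + ‖u'' x‖ ^ 2 + ‖u x‖ ^ 2)) ?_ ?_ ?_ ?_
    · intro n
      have c1 : Continuous fun x : ℝ => A.p' (x + n) := A.p'.continuous.comp (by fun_prop)
      have c2 : Continuous fun x : ℝ => A.p (x + n) := A.p.continuous.comp (by fun_prop)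
      have c3 : Continuous fun x : ℝ => A.q (x + n) - r :=
        (A.q.continuous.comp (by fun_prop)).sub continuous_const
      refine AEStronglyMeasurable.pow (AEStronglyMeasurable.norm ?_) 2
      exact ((((Complex.continuous_ofReal.comp c1).aestronglyMeasurable.mul
        hu'.aestronglyMeasurable).add ((Complex.continuous_ofReal.comp c2).aestronglyMeasurable.mul
        hu''.aestronglyMeasurable)).neg).add
        ((Complex.continuous_ofReal.comp c3).aestronglyMeasurable.mul hu.aestronglyMeasurable)
    · have i0 := (memLp_two_iff_integrable_sq_norm hu.aestronglyMeasurable).1 hu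
      have i1 := (memLp_two_iff_integrable_sq_norm hu'.aestronglyMeasurable).1 hu'
      have i2 := (memLp_two_iff_integrable_sq_norm hu''.aestronglyMeasurable).1 hu''
      exact ((i1.add i2).add i0).const_mul _
    · intro n
      refine Eventually.of_forall fun x => ?_
      rw [Real.norm_of_nonneg (by positivity)]
      have b1 : ‖F n x‖ ≤ C * (‖u' x‖ + ‖u'' x‖ + ‖u x‖) := by
        have hb1 := A.p'.norm_coe_le_norm (x + n)
        have hb2 := A.p.norm_coe_le_norm (x + n)
        have hb3 := A.q.norm_coe_le_norm (x + n)
        have hb4 : ‖A.q (x + n) - r‖ ≤ ‖A.q‖ + |r| := (norm_sub_le _ _).trans (by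
          rw [Real.norm_eq_abs r]; gcongr)
        calc ‖F n x‖ ≤ ‖A.p' (x + n)‖ * ‖u' x‖ + ‖A.p (x + n)‖ * ‖u'' x‖ +
              ‖A.q (x + n) - r‖ * ‖u x‖ := by
              refine (norm_add_le _ _).trans ?_
              rw [norm_neg, norm_mul, Complex.norm_real]
              gcongr
              refine (norm_add_le _ _).trans ?_
              rw [norm_mul, norm_mul, Complex.norm_real, Complex.norm_real]
          _ ≤ C * ‖u' x‖ + C * ‖u'' x‖ + C * ‖u x‖ := by
              gcongr
              · refine hb1.trans ?_
                simp only [C]; linarith [norm_nonneg A.p, norm_nonneg A.q, abs_nonneg r]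
              · refine hb2.trans ?_
                simp only [C]; linarith [norm_nonneg A.p', norm_nonneg A.q, abs_nonneg r]
              · refine hb4.trans ?_
                simp only [C]; linarith [norm_nonneg A.p', norm_nonneg A.p, abs_nonneg r]
          _ = _ := by ring
      calc ‖F n x‖ ^ 2 ≤ (C * (‖u' x‖ + ‖u'' x‖ + ‖u x‖)) ^ 2 :=
            pow_le_pow_left₀ (norm_nonneg _) b1 2
        _ = C ^ 2 * (‖u' x‖ + ‖u'' x‖ + ‖u x‖) ^ 2 := by ring
        _ ≤ C ^ 2 * (3 * (‖u' x‖ ^ 2 + ‖u'' x‖ ^ 2 + ‖u x‖ ^ 2)) := by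
            gcongr
            nlinarith [sq_nonneg (‖u' x‖ - ‖u'' x‖), sq_nonneg (‖u' x‖ - ‖u x‖),
              sq_nonneg (‖u'' x‖ - ‖u x‖)]
        _ = _ := by ring
    · refine Eventually.of_forall fun x => ?_
      have hx : Tendsto (fun n : ℕ => x + n) atTop atTop :=
        tendsto_atTop_add_const_left _ _ tendsto_natCast_atTop_atTop
      have t1 := (Complex.continuous_ofReal.tendsto _).comp (hp'.comp hx)
      have t2 := (Complex.continuous_ofReal.tendsto _).comp (hp.comp hx)
      have t3 := (Complex.continuous_ofReal.tendsto _).comp ((hq.comp hx).sub_const r)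
      have := ((((t1.mul_const (u' x)).add (t2.mul_const (u'' x))).neg.add
        (t3.mul_const (u x))).norm).pow 2
      simpa [hF] using! this
  exact ge_of_tendsto (hlim.const_mul _) (Eventually.of_forall hn)

/-- Modulated and rescaled cut-off functions are approximate eigenfunctions of the limit
operator. -/
theorem exists_wavePacket {g : ℝ → ℝ} (gc : ContDiff ℝ ∞ g) (gs : HasCompactSupport g)
    {P L r ξ ε : ℝ} (hξ2 : P * ξ ^ 2 = r - L) (hε : 0 < ε) (hε1 : ε ≤ 1) :
    ∃ u u' u'' : ℝ → ℂ, (∀ x, HasDerivAt u (u' x) x) ∧ (∀ x, HasDerivAt u' (u'' x) x) ∧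
      MemLp u 2 volume ∧ MemLp u' 2 volume ∧ MemLp u'' 2 volume ∧
      (∫ x, ‖u x‖ ^ 2 = ε⁻¹ * ∫ x, g x ^ 2) ∧
      ∫ x, ‖-((P : ℂ) * u'' x) + ((L - r : ℝ) : ℂ) * u x‖ ^ 2 ≤ ε⁻¹ * (P ^ 2 * ε ^ 2 *
        ∫ x, (8 * ξ ^ 2 * deriv g x ^ 2 + 2 * deriv (deriv g) x ^ 2)) := by
  have gc1 : ContDiff ℝ ∞ (deriv g) := ContDiff.deriv' (n := ∞) gc
  have gc2 : ContDiff ℝ ∞ (deriv (deriv g)) := ContDiff.deriv' (n := ∞) gc1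
  have gd : ∀ x, HasDerivAt g (deriv g x) x := fun x =>
    (gc.differentiable (by simp)).differentiableAt.hasDerivAt
  have gd1 : ∀ x, HasDerivAt (deriv g) (deriv (deriv g) x) x := fun x =>
    (gc1.differentiable (by simp)).differentiableAt.hasDerivAt
  set G₀ := ∫ x, g x ^ 2
  set G₁ := ∫ x, (8 * ξ ^ 2 * deriv g x ^ 2 + 2 * deriv (deriv g) x ^ 2)
  set e : ℝ → ℂ := fun x => Complex.exp ((ξ * x : ℝ) * Complex.I) with he
  have hen : ∀ x, ‖e x‖ = 1 := fun x => Complex.norm_exp_ofReal_mul_I _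
  have hed : ∀ x, HasDerivAt e (e x * (ξ * Complex.I)) x := by
    intro x
    have h1 : HasDerivAt (fun y : ℝ => ((ξ * y : ℝ) : ℂ) * Complex.I) ((ξ : ℂ) * Complex.I) x := by
      have := ((hasDerivAt_id x).const_mul ξ).ofReal_comp.mul_const Complex.I
      simpa using this
    exact h1.cexp
  have hec : Continuous e := continuous_iff_continuousAt.2 fun x => (hed x).continuousAt
  have hsc : ∀ (f : ℝ → ℝ) (f' : ℝ → ℝ), (∀ x, HasDerivAt f (f' x) x) →
      ∀ x, HasDerivAt (fun x => ((f (ε * x) : ℝ) : ℂ)) ((ε * f' (ε * x) : ℝ) : ℂ) x := by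
    intro f f' hf x
    have h1 : HasDerivAt (fun y : ℝ => ε * y) ε x := by
      simpa using (hasDerivAt_id x).const_mul ε
    have := ((hf (ε * x)).comp x h1).ofReal_comp
    rwa [mul_comm] at this
  have hm : ∀ f : ℝ → ℝ, Continuous f → HasCompactSupport f →
      MemLp (fun x => e x * ((f (ε * x) : ℝ) : ℂ)) 2 volume := by
    intro f hf hfs
    have c1 : Continuous fun x => f (ε * x) := by fun_prop
    have c2 : HasCompactSupport fun x => f (ε * x) := by
        simpa only [smul_eq_mul] using hfs.comp_smul hε.ne'
    have c3 : HasCompactSupport fun x => ((f (ε * x) : ℝ) : ℂ) :=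
      c2.comp_left (g := fun y : ℝ => (y : ℂ)) Complex.ofReal_zero
    exact (hec.mul (Complex.continuous_ofReal.comp c1)).memLp_of_hasCompactSupport c3.mul_left
  have m0 := hm g gc.continuous gs
  have m1 := hm (deriv g) gc1.continuous gs.deriv
  have m2 := hm (deriv (deriv g)) gc2.continuous gs.deriv.deriv
  -- The plane wave `e` with the wide envelope `g (ε x)`. Terms in which no derivative hits the
  -- envelope cancel because `P ξ² = r - L`; the remainder carries a factor `ε`.
  set u : ℝ → ℂ := fun x => e x * (g (ε * x) : ℝ)
  set u' : ℝ → ℂ := fun x => (ξ * Complex.I) * (e x * (g (ε * x) : ℝ)) +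
    ε * (e x * (deriv g (ε * x) : ℝ))
  set u'' : ℝ → ℂ := fun x => -(ξ : ℂ) ^ 2 * (e x * (g (ε * x) : ℝ)) +
    2 * ξ * Complex.I * ε * (e x * (deriv g (ε * x) : ℝ)) +
    (ε : ℂ) ^ 2 * (e x * (deriv (deriv g) (ε * x) : ℝ))
  have hu : ∀ x, HasDerivAt u (u' x) x := fun x => by
    refine ((hed x).mul (hsc g _ gd x)).congr_deriv ?_
    simp only [u']
    push_cast
    ring
  have hu' : ∀ x, HasDerivAt u' (u'' x) x := fun x => by
    refine (((hu x).const_mul (ξ * Complex.I)).add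
      (((hed x).mul (hsc _ _ gd1 x)).const_mul (ε : ℂ))).congr_deriv ?_
    simp only [u', u'']
    push_cast
    linear_combination ((ξ : ℂ) ^ 2 * (e x * (g (ε * x) : ℝ))) * Complex.I_sq
  have e1 : ∫ x, ‖u x‖ ^ 2 = ε⁻¹ * G₀ := by
    have h1 : (fun x => ‖u x‖ ^ 2) = fun x => g (ε * x) ^ 2 := by
      funext x
      rw [norm_mul, hen, one_mul, Complex.norm_real, Real.norm_eq_abs, sq_abs]
    rw [h1, Measure.integral_comp_mul_left (fun x => g x ^ 2) ε, abs_of_pos (inv_pos.2 hε),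
      smul_eq_mul]
  have e2 : ∫ x, ‖-((P : ℂ) * u'' x) + ((L - r : ℝ) : ℂ) * u x‖ ^ 2 ≤
      ε⁻¹ * (P ^ 2 * ε ^ 2 * G₁) := by
    have h1 : ∀ x, ‖-((P : ℂ) * u'' x) + ((L - r : ℝ) : ℂ) * u x‖ ^ 2 ≤
        P ^ 2 * ε ^ 2 * (8 * ξ ^ 2 * deriv g (ε * x) ^ 2 + 2 * deriv (deriv g) (ε * x) ^ 2) := by
      intro x
      have h2 : -((P : ℂ) * u'' x) + ((L - r : ℝ) : ℂ) * u x = -((P * ε : ℝ) : ℂ) * (e x *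
          (((2 * ξ * deriv g (ε * x) : ℝ) : ℂ) * Complex.I +
            ((ε * deriv (deriv g) (ε * x) : ℝ) : ℂ))) := by
        have h3 : ((L - r : ℝ) : ℂ) = -((P : ℂ) * (ξ : ℂ) ^ 2) := by
          rw [← neg_sub, ← hξ2]; push_cast; ring
        simp only [u, u'', h3]
        push_cast
        ring
      rw [h2, norm_mul, norm_neg, Complex.norm_real, norm_mul (e x), hen, one_mul, mul_pow,
        Real.norm_eq_abs, sq_abs, mul_pow]
      refine mul_le_mul_of_nonneg_left ?_ (by positivity)
      rw [add_comm, Complex.sq_norm, Complex.normSq_add_mul_I]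
      have : ε ^ 2 * deriv (deriv g) (ε * x) ^ 2 ≤ 1 * deriv (deriv g) (ε * x) ^ 2 := by
        gcongr
        nlinarith
      nlinarith [sq_nonneg (ξ * deriv g (ε * x)), sq_nonneg (deriv (deriv g) (ε * x))]
    have ci : Continuous fun x =>
        8 * ξ ^ 2 * deriv g x ^ 2 + 2 * deriv (deriv g) x ^ 2 := by
      have := gc1.continuous
      have := gc2.continuous
      fun_prop
    have hcs : HasCompactSupport fun x =>
        8 * ξ ^ 2 * deriv g x ^ 2 + 2 * deriv (deriv g) x ^ 2 :=
      (gs.deriv.comp_left (g := fun y : ℝ => 8 * ξ ^ 2 * y ^ 2) (by simp)).add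
        (gs.deriv.deriv.comp_left (g := fun y : ℝ => 2 * y ^ 2) (by simp))
    have i2 := ci.integrable_of_hasCompactSupport hcs (μ := volume)
    have i3 := i2.comp_mul_left' hε.ne'
    have h4 := integral_mono_of_nonneg (Eventually.of_forall fun x => by positivity)
      (i3.const_mul (P ^ 2 * ε ^ 2)) (Eventually.of_forall h1)
    refine h4.trans (le_of_eq ?_)
    rw [integral_const_mul, Measure.integral_comp_mul_left
      (fun x => 8 * ξ ^ 2 * deriv g x ^ 2 + 2 * deriv (deriv g) x ^ 2) ε,
      abs_of_pos (inv_pos.2 hε), smul_eq_mul]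
    ring
  exact ⟨u, u', u'', hu, hu', m0, (m0.const_mul _).add (m1.const_mul _),
    ((m0.const_mul _).add (m1.const_mul _)).add (m2.const_mul _), e1, e2⟩

/-- Weyl's criterion: the half-line above the limit of the potential belongs to the spectrum. -/
theorem mem_spectrum_of_tendsto {P L r : ℝ} (hp : Tendsto A.p atTop (𝓝 P))
    (hp' : Tendsto A.p' atTop (𝓝 0)) (hq : Tendsto A.q atTop (𝓝 L)) (hr : L ≤ r) :
    (r : ℂ) ∈ spectrum A.op := by
  intro hres
  obtain ⟨K, hK⟩ := A.integral_norm_sq_le_of_mem_resolventSet hp hp' hq hres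
  have hP : 0 < P := A.low_pos.trans_le (ge_of_tendsto hp (Eventually.of_forall A.low_le))
  set ξ := √((r - L) / P) with hξ
  have hξ2 : P * ξ ^ 2 = r - L := by
    rw [hξ, Real.sq_sqrt (div_nonneg (by linarith) hP.le)]
    field_simp
  obtain ⟨g, gc, gs, g0⟩ : ∃ g : ℝ → ℝ, ContDiff ℝ ∞ g ∧ HasCompactSupport g ∧ g 0 = 1 := by
    let f : ContDiffBump (0 : ℝ) := ⟨1, 2, by norm_num, by norm_num⟩
    exact ⟨f, f.contDiff, f.hasCompactSupport, f.one_of_mem_closedBall (by simp [f])⟩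
  set G₀ := ∫ x, g x ^ 2
  set G₁ := ∫ x, (8 * ξ ^ 2 * deriv g x ^ 2 + 2 * deriv (deriv g) x ^ 2)
  have hG₀ : 0 < G₀ := by
    apply Continuous.integral_pos_of_hasCompactSupport_nonneg_nonzero (x := 0)
    · exact gc.continuous.pow 2
    · exact gs.comp_left (g := fun y : ℝ => y ^ 2) (by simp)
    · exact fun x => sq_nonneg _
    · rw [g0]; norm_num
  -- Both sides of the resolvent estimate scale like `ε⁻¹`, but the right side has an additional
  -- `ε²`, so `ε → 0` forces `G₀ ≤ 0`.
  have key : ∀ ε ∈ Set.Ioc (0 : ℝ) 1, G₀ ≤ |K| * P ^ 2 * G₁ * ε ^ 2 := by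
    rintro ε ⟨hε, hε1⟩
    obtain ⟨u, u', u'', hu, hu', m0, m1, m2, e1, e2⟩ :=
      exists_wavePacket gc gs (P := P) (L := L) (r := r) hξ2 hε hε1
    have hb := hK u u' u'' hu hu' m0 m1 m2
    rw [e1] at hb
    have h5 : ε⁻¹ * G₀ ≤ ε⁻¹ * (|K| * P ^ 2 * G₁ * ε ^ 2) := by
      refine hb.trans ?_
      calc _ ≤ |K| * ∫ x, ‖-((P : ℂ) * u'' x) + ((L - r : ℝ) : ℂ) * u x‖ ^ 2 :=
            mul_le_mul_of_nonneg_right (le_abs_self K) (integral_nonneg fun x => by positivity)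
        _ ≤ |K| * (ε⁻¹ * (P ^ 2 * ε ^ 2 * G₁)) := by gcongr
        _ = _ := by ring
    exact le_of_mul_le_mul_left h5 (inv_pos.2 hε)
  have hlim : Tendsto (fun ε : ℝ => |K| * P ^ 2 * G₁ * ε ^ 2) (𝓝[>] 0) (𝓝 0) := by
    have : Continuous fun ε : ℝ => |K| * P ^ 2 * G₁ * ε ^ 2 := by fun_prop
    have := (this.tendsto 0).mono_left (nhdsWithin_le_nhds (s := Set.Ioi 0))
    simpa using this
  have := ge_of_tendsto hlim (by
    filter_upwards [Ioc_mem_nhdsGT (zero_lt_one' ℝ)] with ε hε using key ε hε)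
  linarith

/-- The form bound needs the limit of `q` at both ends; the wave packets only have to escape to
`+∞`. -/
theorem essentialSpectrum_eq {P L : ℝ} (hp : Tendsto A.p atTop (𝓝 P))
    (hp' : Tendsto A.p' atTop (𝓝 0)) (hq : Tendsto A.q atTop (𝓝 L))
    (hq' : Tendsto A.q atBot (𝓝 L)) :
    essentialSpectrum A.op = (fun r : ℝ => (r : ℂ)) '' Set.Ici L :=
  essentialSpectrum_eq_Ici A.isSelfAdjoint (fun _ ha => A.hasFormBound_of_tendsto hq hq' ha)
    fun _ hr => A.mem_spectrum_of_tendsto hp hp' hq hr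

end Coeff

end BCH

/-! ### A null solution with one zero: Jacobi's identity and the kernel -/

namespace BCH

open scoped ComplexConjugate InnerProductSpace BoundedContinuousFunction

/-- The Fourier transform satisfies `ξ 𝓕 u = 0`, so it vanishes almost everywhere: the only constant
in `L²` is zero. -/
theorem IsWeakDeriv.eq_zero_of_deriv_eq_zero {u : L2} (h : IsWeakDeriv u 0) : u = 0 := by
  open scoped FourierTransform in
  have h1 : (𝓕 u : L2) = 0 := by
    have h0 : (𝓕 (0 : L2) : L2) = 0 := (Lp.fourierTransformₗᵢ ℝ ℂ).map_zero
    apply Lp.ext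
    have hne : ∀ᵐ ξ : ℝ, ξ ≠ 0 := by simp [ae_iff]
    have hF := isWeakDeriv_iff_fourier.1 h
    rw [h0] at hF
    filter_upwards [hF, hne, Lp.coeFn_zero ℂ 2 (volume : Measure ℝ)] with ξ h1 h2 h3
    rw [h3] at h1 ⊢
    have := mul_eq_zero.1 h1.symm
    rcases this with h4 | h4
    · simp [Real.pi_ne_zero, h2] at h4
    · exact h4
  rw [← norm_eq_zero, ← Lp.norm_fourier_eq u, h1, norm_zero]

/-- At a zero of `f` the second factor only has to be continuous. This handles Jacobi's identity at
the point `0`, where the quotient `U / w` need not be differentiable. -/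
theorem hasDerivAt_mul_of_eq_zero {f g : ℝ → ℝ} {a x : ℝ} (hf : HasDerivAt f a x) (h0 : f x = 0)
    (hg : ContinuousAt g x) : HasDerivAt (fun y => f y * g y) (a * g x) x := by
  rw [hasDerivAt_iff_tendsto_slope] at hf ⊢
  have h := hf.mul (hg.tendsto.mono_left (nhdsWithin_le_nhds (s := {x}ᶜ)))
  refine h.congr fun y => ?_
  simp only [slope_def_field, h0]
  ring

/-- A `C¹` function vanishing at `0` is divisible by a function with a single simple zero at `0`. -/
theorem exists_continuous_quotient {U V : ℝ → ℂ} {w w' : ℝ → ℝ} (hU : ∀ x, HasDerivAt U (V x) x)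
    (hw : ∀ x, HasDerivAt w (w' x) x) (hU0 : U 0 = 0) (hw0 : w 0 = 0) (hw'0 : w' 0 ≠ 0)
    (hne : ∀ x, x ≠ 0 → w x ≠ 0) :
    ∃ g : ℝ → ℂ, Continuous g ∧ (∀ x, U x = w x * g x) ∧ V 0 = w' 0 * g 0 := by
  have hc : ∀ {E : Type} [NormedAddCommGroup E] [NormedSpace ℝ E] {f f' : ℝ → E},
      (∀ x, HasDerivAt f (f' x) x) → Continuous (dslope f 0) := by
    intro E _ _ f f' hf
    rw [← continuousOn_univ, continuousOn_dslope univ_mem]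
    exact ⟨fun x _ => (hf x).continuousAt.continuousWithinAt, (hf 0).differentiableAt⟩
  have e : ∀ x, w x = x * dslope w 0 x := fun x => by
    have := sub_smul_dslope w 0 x
    rw [hw0, sub_zero, sub_zero, smul_eq_mul] at this
    exact this.symm
  have e' : ∀ x, U x = x * dslope U 0 x := fun x => by
    have := sub_smul_dslope U 0 x
    rw [hU0, sub_zero, sub_zero, Complex.real_smul] at this
    exact this.symm
  have d0 : dslope w 0 0 = w' 0 := by rw [dslope_same, (hw 0).deriv]
  have d0' : dslope U 0 0 = V 0 := by rw [dslope_same, (hU 0).deriv]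
  have hd : ∀ x, dslope w 0 x ≠ 0 := by
    intro x
    by_cases hx : x = 0
    · rw [hx, d0]; exact hw'0
    · intro h
      apply hne x hx
      rw [e, h, mul_zero]
  have hd' : ∀ x, ((dslope w 0 x : ℝ) : ℂ) ≠ 0 := fun x => by exact_mod_cast hd x
  refine ⟨fun x => dslope U 0 x / ((dslope w 0 x : ℝ) : ℂ),
    (hc hU).div (Complex.continuous_ofReal.comp (hc hw)) hd', fun x => ?_, ?_⟩
  · rw [e' x, e x]
    have := hd' x
    push_cast
    field_simp
  · have := hd' 0
    rw [d0] at this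
    simp only [d0, d0']
    field_simp

/-- The quotient `U / w` has zero derivative on each half-line. Its continuous extension through `0`
makes the two constants agree. -/
theorem eq_const_mul_of_wronskian_eq_zero {U V : ℝ → ℂ} {w w' : ℝ → ℝ}
    (hU : ∀ x, HasDerivAt U (V x) x)
    (hw : ∀ x, HasDerivAt w (w' x) x) (hU0 : U 0 = 0) (hw0 : w 0 = 0) (hw'0 : w' 0 ≠ 0)
    (hne : ∀ x, x ≠ 0 → w x ≠ 0) (hW : ∀ x, (w x : ℂ) * V x = w' x * U x) :
    ∃ a : ℂ, ∀ x, U x = a * w x := by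
  obtain ⟨g, hg, hUg, -⟩ := exists_continuous_quotient hU hw hU0 hw0 hw'0 hne
  have hgd : ∀ x, x ≠ 0 → HasDerivAt g 0 x := by
    intro x hx
    have hwx : (w x : ℂ) ≠ 0 := by exact_mod_cast hne x hx
    have h1 := ((hU x).div (hw x).ofReal_comp hwx)
    have h2 : (V x * (w x : ℂ) - U x * (w' x : ℂ)) / (w x : ℂ) ^ 2 = 0 := by
      rw [mul_comm, hW x, mul_comm, sub_self, zero_div]
    rw [h2] at h1
    refine h1.congr_of_eventuallyEq ?_
    filter_upwards [isOpen_ne.mem_nhds hx] with y hy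
    have hwy : (w y : ℂ) ≠ 0 := by exact_mod_cast hne y hy
    change g y = U y / (w y : ℂ)
    rw [hUg y]
    field_simp
  have hconst : ∀ s : Set ℝ, IsOpen s → IsPreconnected s → (∀ x ∈ s, x ≠ 0) → (0 : ℝ) ∈ closure s →
      ∀ x ∈ s, g x = g 0 := by
    intro s hs hs' hs0 hcl x hx
    obtain ⟨a, ha⟩ := hs.exists_is_const_of_deriv_eq_zero hs'
      (fun y hy => (hgd y (hs0 y hy)).differentiableAt.differentiableWithinAt)
      (fun y hy => (hgd y (hs0 y hy)).deriv)
    have h0 : g 0 = a := by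
      have : closure s ⊆ {y | g y = a} := closure_minimal ha (isClosed_eq hg continuous_const)
      exact this hcl
    rw [ha x hx, h0]
  refine ⟨g 0, fun x => ?_⟩
  have : g x = g 0 := by
    rcases lt_trichotomy x 0 with hx | hx | hx
    · exact hconst (Set.Iio 0) isOpen_Iio isPreconnected_Iio (fun y hy => ne_of_lt hy)
        (by rw [closure_Iio]; simp) x hx
    · rw [hx]
    · exact hconst (Set.Ioi 0) isOpen_Ioi isPreconnected_Ioi (fun y hy => ne_of_gt hy)
        (by rw [closure_Ioi]; simp) x hx
  rw [hUg x, this, mul_comm]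

namespace Coeff

variable (A : Coeff)

/-- A square-integrable null solution of the Sturm--Liouville equation with a single zero. -/
structure NullSolution (w w' : ℝ →ᵇ ℝ) : Prop where
  hasDerivAt : ∀ x, HasDerivAt w (w' x) x
  hasDerivAt_flux : ∀ x, HasDerivAt (fun y => A.p y * w' y) (A.q x * w x) x
  zero : w 0 = 0
  deriv_ne_zero : w' 0 ≠ 0
  neg : ∀ x, 0 < x → w x < 0
  pos : ∀ x, x < 0 → 0 < w x
  bound : ∃ C, ∀ x, 1 ≤ |x| → |w' x| ≤ C * |w x|
  memLp : MemLp (fun x => (w x : ℂ)) 2 volume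
  memLp' : MemLp (fun x => (w' x : ℂ)) 2 volume

namespace NullSolution

variable {A} {w w' : ℝ →ᵇ ℝ} (hw : A.NullSolution w w')

include hw

theorem ne_zero (x : ℝ) (hx : x ≠ 0) : w x ≠ 0 := by
  rcases lt_or_gt_of_ne hx with h | h
  · exact (hw.pos x h).ne'
  · exact (hw.neg x h).ne

/-- Jacobi's identity for the quadratic form. -/
theorem form_eq {U V : ℝ → ℂ} (hU : ∀ x, HasDerivAt U (V x) x) (hV : Continuous V) (hU0 : U 0 = 0)
    (iU : Integrable fun t => ‖U t‖ ^ 2) (iV : Integrable fun t => ‖V t‖ ^ 2) :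
    ∃ ρ : ℝ → ℂ, ∫ t, A.p t * ‖V t - ρ t‖ ^ 2 =
      (∫ t, A.p t * ‖V t‖ ^ 2) + ∫ t, A.q t * ‖U t‖ ^ 2 := by
  obtain ⟨g, hg, hUg, hV0⟩ :=
    exists_continuous_quotient hU hw.hasDerivAt hU0 hw.zero hw.deriv_ne_zero hw.ne_zero
  obtain ⟨C, hC⟩ := hw.bound
  -- This is `(w' / w) U`, written with the continuous quotient `g = U / w` so that it makes sense
  -- at `0`.
  set ρ : ℝ → ℂ := fun x => w' x * g x with hρ
  have hρc : Continuous ρ := (Complex.continuous_ofReal.comp w'.continuous).mul hg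
  have hUc : Continuous U := continuous_iff_continuousAt.2 fun x => (hU x).continuousAt
  refine ⟨ρ, ?_⟩
  obtain ⟨B, hB⟩ := (isCompact_Icc (a := (-1 : ℝ)) (b := 1)).exists_bound_of_continuousOn
    hρc.continuousOn
  have hB0 : 0 ≤ B := (norm_nonneg _).trans (hB 0 (by simp))
  -- Away from `[-1, 1]`, `|w'| ≤ C |w|` gives `|ρ| ≤ C |U|`; on `[-1, 1]` continuity suffices.
  have hρb : ∀ x, ‖ρ x‖ ^ 2 ≤ C ^ 2 * ‖U x‖ ^ 2 + (Set.Icc (-1 : ℝ) 1).indicator (fun _ => B ^ 2) x := by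
    intro x
    by_cases hx : x ∈ Set.Icc (-1 : ℝ) 1
    · rw [Set.indicator_of_mem hx]
      have := pow_le_pow_left₀ (norm_nonneg _) (hB x hx) 2
      have : 0 ≤ C ^ 2 * ‖U x‖ ^ 2 := by positivity
      linarith
    · rw [Set.indicator_of_notMem hx, add_zero, ← mul_pow]
      have hx1 : 1 ≤ |x| := by
        by_contra h
        rw [not_le, abs_lt] at h
        exact hx ⟨h.1.le, h.2.le⟩
      refine pow_le_pow_left₀ (norm_nonneg _) ?_ 2
      rw [hUg x, norm_mul, norm_mul, Complex.norm_real, Complex.norm_real, ← mul_assoc]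
      gcongr
      exact hC x hx1
  have iind : Integrable ((Set.Icc (-1 : ℝ) 1).indicator (fun _ => B ^ 2)) :=
    (continuous_const (y := B ^ 2)).integrableOn_Icc.integrable_indicator measurableSet_Icc
  have iρ : Integrable fun t => ‖ρ t‖ ^ 2 := by
    refine Integrable.mono' ((iU.const_mul (C ^ 2)).add iind) (hρc.norm.pow 2).aestronglyMeasurable
      (Eventually.of_forall fun x => ?_)
    rw [Real.norm_of_nonneg (by positivity)]
    exact hρb x
  have ibdd : ∀ (h : ℝ →ᵇ ℝ) {f : ℝ → ℝ}, Integrable f → Integrable fun t => h t * f t :=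
    fun h f hf => hf.bdd_mul (c := ‖h‖) h.continuous.aestronglyMeasurable
      (Eventually.of_forall h.norm_coe_le_norm)
  have i1 := ibdd A.p iV
  have i2 := ibdd A.q iU
  have i3 : Integrable fun t => A.p t * ‖V t - ρ t‖ ^ 2 := by
    refine ibdd A.p (Integrable.mono' ((iV.add iρ).const_mul 2)
      ((hV.sub hρc).norm.pow 2).aestronglyMeasurable (Eventually.of_forall fun x => ?_))
    rw [Real.norm_of_nonneg (by positivity)]
    have := norm_sub_le (V x) (ρ x)
    have := pow_le_pow_left₀ (norm_nonneg _) this 2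
    simp only [Pi.add_apply]
    nlinarith [sq_nonneg (‖V x‖ - ‖ρ x‖)]
  -- `G = p (w' / w) |U|²`, with the factor `w` split off because it vanishes at `0`.
  set G : ℝ → ℝ := fun x => w x * (A.p x * w' x * ‖g x‖ ^ 2) with hG
  have hGc : Continuous G :=
    w.continuous.mul ((A.p.continuous.mul w'.continuous).mul (hg.norm.pow 2))
  have iG : Integrable G := by
    refine Integrable.mono' ((iU.add iρ).const_mul ‖A.p‖) hGc.aestronglyMeasurable
      (Eventually.of_forall fun x => ?_)
    have h1 : ‖G x‖ = ‖A.p x‖ * (‖U x‖ * ‖ρ x‖) := by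
      simp only [hG, hρ, hUg x, norm_mul, norm_pow, Complex.norm_real, norm_norm]
      ring
    rw [h1]
    have := A.p.norm_coe_le_norm x
    simp only [Pi.add_apply]
    gcongr
    nlinarith [sq_nonneg (‖U x‖ - ‖ρ x‖), norm_nonneg (U x), norm_nonneg (ρ x)]
  have hGd : ∀ x, HasDerivAt G
      ((A.p x * ‖V x‖ ^ 2 + A.q x * ‖U x‖ ^ 2) - A.p x * ‖V x - ρ x‖ ^ 2) x := by
    intro x
    by_cases hx : x = 0
    · subst hx
      have hcont : ContinuousAt (fun x => A.p x * w' x * ‖g x‖ ^ 2) 0 :=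
        ((A.p.continuous.mul w'.continuous).mul (hg.norm.pow 2)).continuousAt
      refine (hasDerivAt_mul_of_eq_zero (hw.hasDerivAt 0) hw.zero hcont).congr_deriv ?_
      have : V 0 - ρ 0 = 0 := by rw [hV0, hρ, sub_self]
      rw [this, hU0, hV0, norm_zero, norm_mul, Complex.norm_real, mul_pow, Real.norm_eq_abs, sq_abs]
      ring
    · have hwx := hw.ne_zero x hx
      have hns : HasDerivAt (fun y => ‖U y‖ ^ 2) (2 * (conj (U x) * V x).re) x := by
        have h1 := (hU x).norm_sq
        refine h1.congr_deriv ?_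
        rw [Complex.inner, mul_comm (conj (U x))]
      have h1 := ((hw.hasDerivAt_flux x).mul hns).div (hw.hasDerivAt x) hwx
      have h2 : G =ᶠ[𝓝 x] fun y => A.p y * w' y * ‖U y‖ ^ 2 / w y := by
        filter_upwards [isOpen_ne.mem_nhds hx] with y hy
        have hwy := hw.ne_zero y hy
        simp only [hG, hUg y, norm_mul, mul_pow, Complex.norm_real, Real.norm_eq_abs, sq_abs]
        field_simp
      refine (h1.congr_of_eventuallyEq h2).congr_deriv ?_
      have hwc : (w x : ℂ) ≠ 0 := by exact_mod_cast hwx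
      have e1 : ρ x = ((w' x / w x : ℝ) : ℂ) * U x := by
        rw [hρ, hUg x]
        push_cast
        field_simp
      have e2 : ‖V x - ρ x‖ ^ 2 = ‖V x‖ ^ 2 - 2 * (w' x / w x) * (conj (U x) * V x).re +
          (w' x / w x) ^ 2 * ‖U x‖ ^ 2 := by
        rw [e1, @norm_sub_sq ℂ, norm_mul, mul_pow, Complex.norm_real, Real.norm_eq_abs, sq_abs]
        have : RCLike.re ⟪V x, ((w' x / w x : ℝ) : ℂ) * U x⟫_ℂ =
            (w' x / w x) * (conj (U x) * V x).re := by
          change (((w' x / w x : ℝ) : ℂ) * U x * conj (V x)).re = _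
          rw [mul_assoc, Complex.re_ofReal_mul]
          congr 1
          simp only [Complex.mul_re, Complex.conj_re, Complex.conj_im]
          ring
        rw [this]
        ring
      rw [e2, Pi.mul_apply]
      field_simp
      ring
  -- `G` and its derivative are integrable, so there are no boundary terms at infinity.
  have h0 := integral_eq_zero_of_hasDerivAt_of_integrable hGd ((i1.add i2).sub i3) iG
  have h1 := integral_sub (i1.add i2) i3
  simp only [Pi.add_apply] at h1
  rw [h1, integral_add i1 i2] at h0
  linarith

theorem form_nonneg_of_eq_zero {U V : ℝ → ℂ} (hU : ∀ x, HasDerivAt U (V x) x) (hV : Continuous V)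
    (hU0 : U 0 = 0) (iU : Integrable fun t => ‖U t‖ ^ 2) (iV : Integrable fun t => ‖V t‖ ^ 2) :
    0 ≤ (∫ t, A.p t * ‖V t‖ ^ 2) + ∫ t, A.q t * ‖U t‖ ^ 2 := by
  obtain ⟨ρ, hρ⟩ := hw.form_eq hU hV hU0 iU iV
  rw [← hρ]
  exact integral_nonneg fun t => mul_nonneg (A.low_pos.le.trans (A.low_le t)) (by positivity)

theorem isWeakDeriv_toLp : IsWeakDeriv (hw.memLp.toLp _) (hw.memLp'.toLp _) :=
  isWeakDeriv_of_hasDerivAt (fun x => (hw.hasDerivAt x).ofReal_comp) _ _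

theorem isWeakDeriv_flux :
    IsWeakDeriv (mulL A.p (hw.memLp'.toLp _)) (mulL A.q (hw.memLp.toLp _)) := by
  rw [mulL_toLp, mulL_toLp]
  refine isWeakDeriv_of_hasDerivAt (fun x => ?_) _ _
  have := (hw.hasDerivAt_flux x).ofReal_comp
  simpa only [Complex.ofReal_mul] using this

theorem mem_eigenspace : hw.memLp.toLp _ ∈ eigenspace A.op 0 := by
  obtain ⟨x, hx1, hx2⟩ := A.exists_apply_eq
    (A.mem_graph_iff.2 ⟨_, _, hw.isWeakDeriv_toLp, hw.isWeakDeriv_flux, rfl⟩)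
  refine mem_eigenspace_iff.2 ⟨x, ?_, hx1⟩
  rw [hx2, zero_smul, neg_add_cancel]

/-- The Wronskian `p (w u' - w' u)` of two null solutions has zero weak derivative and lies in `L²`,
hence vanishes. Then `u` vanishes at `0` together with `w`, and `u / w` is constant. -/
theorem eigenspace_zero : eigenspace A.op 0 = Submodule.span ℂ {hw.memLp.toLp _} := by
  apply le_antisymm
  · intro y hy
    obtain ⟨u, hu, rfl⟩ := mem_eigenspace_iff.1 hy
    rw [zero_smul] at hu
    obtain ⟨v, z, hv, hz, hf⟩ := A.mem_graph_iff.1 (A.mem_graph_apply u)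
    rw [hu, eq_comm, neg_add_eq_zero] at hf
    subst hf
    obtain ⟨v₁, U, V, hv₁, hU, hV, huU, hvV⟩ := A.exists_representative u
    obtain rfl := hv.unique hv₁
    have hUc : Continuous U := continuous_iff_continuousAt.2 fun x => (hU x).continuousAt
    -- The derivatives of `w (p u')` and `(p w') u`; their difference cancels by the equations for
    -- `u` and `w`.
    have h1 := hz.mulL hw.hasDerivAt
    have h2 := hv.mulL (g := A.p * w') (g' := A.q * w) hw.hasDerivAt_flux
    have h3 := h1.sub h2
    have h4 : mulL w' (mulL A.p v) + mulL w (mulL A.q u) -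
        (mulL (A.q * w) (u : L2) + mulL (A.p * w') v) = 0 := by
      rw [mulL_mulL, mulL_mulL, mul_comm w', mul_comm w]
      abel
    rw [h4] at h3
    have h5 := h3.eq_zero_of_deriv_eq_zero
    rw [sub_eq_zero] at h5
    have hW : ∀ x, (w x : ℂ) * V x = w' x * U x := by
      have hcont : Continuous fun x => (w x : ℂ) * V x :=
        (Complex.continuous_ofReal.comp w.continuous).mul hV
      have hcont' : Continuous fun x => (w' x : ℂ) * U x :=
        (Complex.continuous_ofReal.comp w'.continuous).mul hUc
      refine congrFun ((hcont.ae_eq_iff_eq volume hcont').1 ?_)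
      have e1 := coeFn_mulL w (mulL A.p v)
      rw [h5] at e1
      filter_upwards [huU, hvV, e1, coeFn_mulL A.p v, coeFn_mulL (A.p * w') (u : L2)]
        with x h1 h2 h3 h4 h5
      rw [h5, h4, h1, h2] at h3
      have hp : (A.p x : ℂ) ≠ 0 := by exact_mod_cast (A.low_pos.trans_le (A.low_le x)).ne'
      apply mul_left_cancel₀ hp
      rw [BoundedContinuousFunction.mul_apply, Complex.ofReal_mul] at h3
      linear_combination -h3
    have hU0 : U 0 = 0 := by
      have := hW 0
      rw [hw.zero, Complex.ofReal_zero, zero_mul] at this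
      rcases mul_eq_zero.1 this.symm with h | h
      · exact absurd (by exact_mod_cast h) hw.deriv_ne_zero
      · exact h
    obtain ⟨a, ha⟩ := eq_const_mul_of_wronskian_eq_zero hU hw.hasDerivAt hU0 hw.zero
      hw.deriv_ne_zero hw.ne_zero hW
    refine Submodule.mem_span_singleton.2 ⟨a, ?_⟩
    apply Lp.ext
    filter_upwards [huU, hw.memLp.coeFn_toLp, Lp.coeFn_smul a (hw.memLp.toLp _)] with x h1 h2 h3
    rw [h3, Pi.smul_apply, h2, h1, ha, smul_eq_mul]
  · rw [Submodule.span_singleton_le_iff_mem]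
    exact hw.mem_eigenspace

theorem toLp_ne_zero : hw.memLp.toLp _ ≠ 0 := by
  intro h
  have hc : Continuous fun x => (w x : ℂ) := Complex.continuous_ofReal.comp w.continuous
  have h0 : (fun x => (w x : ℂ)) = fun _ => (0 : ℂ) := by
    refine (hc.ae_eq_iff_eq volume continuous_const).1 ?_
    have h1 := hw.memLp.coeFn_toLp
    rw [h] at h1
    filter_upwards [h1, Lp.coeFn_zero ℂ 2 (volume : Measure ℝ)] with x h1 h2
    rw [← h1, h2]; rfl
  have := congrFun h0 1
  exact (hw.neg 1 one_pos).ne (by exact_mod_cast this)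

theorem finrank_eigenspace_zero : Module.finrank ℂ (eigenspace A.op 0) = 1 := by
  rw [hw.eigenspace_zero]
  exact finrank_span_singleton hw.toLp_ne_zero

end NullSolution

end Coeff

end BCH

/-! ### Exactly one negative eigenvalue -/

namespace BCH

open scoped ComplexConjugate InnerProductSpace BoundedContinuousFunction

namespace Coeff

variable (A : Coeff)

/-- Evaluation at `0` of the continuous representative. -/
theorem exists_eval_zero : ∃ l : A.op.domain →ₗ[ℂ] ℂ, ∀ u : A.op.domain, ∀ U : ℝ → ℂ,
    Continuous U → (∀ᵐ x, (u : L2) x = U x) → l u = U 0 := by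
  choose v U V hv hU hV huU hvV using A.exists_representative
  have hUc : ∀ u, Continuous (U u) := fun u =>
    continuous_iff_continuousAt.2 fun x => (hU u x).continuousAt
  have key : ∀ u : A.op.domain, ∀ U' : ℝ → ℂ, Continuous U' → (∀ᵐ x, (u : L2) x = U' x) →
      U u 0 = U' 0 := by
    intro u U' hU' h
    refine congrFun (((hUc u).ae_eq_iff_eq volume hU').1 ?_) 0
    filter_upwards [h, huU u] with x h1 h2
    rw [← h1, h2]
  refine ⟨{ toFun := fun u => U u 0, map_add' := fun u u' => ?_, map_smul' := fun a u => ?_ }, key⟩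
  · refine key (u + u') (fun x => U u x + U u' x) ((hUc u).add (hUc u')) ?_
    filter_upwards [huU u, huU u', Lp.coeFn_add (u : L2) (u' : L2)] with x h1 h2 h3
    rw [Submodule.coe_add, h3, Pi.add_apply, h1, h2]
  · refine key (a • u) (fun x => a * U u x) (continuous_const.mul (hUc u)) ?_
    filter_upwards [huU u, Lp.coeFn_smul a (u : L2)] with x h1 h2
    rw [Submodule.coe_smul, h2, Pi.smul_apply, h1, smul_eq_mul]

namespace NullSolution

variable {A} {w w' : ℝ →ᵇ ℝ} (hw : A.NullSolution w w')

include hw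

theorem form_nonneg {u : A.op.domain} {l : A.op.domain →ₗ[ℂ] ℂ}
    (hl : ∀ u : A.op.domain, ∀ U : ℝ → ℂ,
      Continuous U → (∀ᵐ x, (u : L2) x = U x) → l u = U 0) (h0 : l u = 0) :
    0 ≤ (⟪(u : L2), A.op u⟫_ℂ).re := by
  obtain ⟨v, U, V, hv, hU, hV, huU, hvV⟩ := A.exists_representative u
  have hUc : Continuous U := continuous_iff_continuousAt.2 fun x => (hU x).continuousAt
  rw [A.re_form u hv]
  have e1 : ∫ t, A.p t * ‖v t‖ ^ 2 = ∫ t, A.p t * ‖V t‖ ^ 2 := integral_congr_ae <| by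
    filter_upwards [hvV] with t ht
    rw [ht]
  have e2 : ∫ t, A.q t * ‖(u : L2) t‖ ^ 2 = ∫ t, A.q t * ‖U t‖ ^ 2 := integral_congr_ae <| by
    filter_upwards [huU] with t ht
    rw [ht]
  rw [e1, e2]
  refine hw.form_nonneg_of_eq_zero hU hV ((hl u U hUc huU).symm.trans h0) ?_ ?_
  · refine (integrable_norm_sq (u : L2)).congr ?_
    filter_upwards [huU] with t ht
    rw [ht]
  · refine (integrable_norm_sq v).congr ?_
    filter_upwards [hvV] with t ht
    rw [ht]

/-- Smooth approximations of the absolute value of a null solution lie in the domain. -/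
theorem exists_approx {δ : ℝ} (hδ : 0 < δ) : ∃ (u : A.op.domain) (v : L2) (s : ℝ →ᵇ ℝ),
    IsWeakDeriv (u : L2) v ∧ (∀ x, s x = w x / √(w x ^ 2 + δ ^ 2)) ∧
    (u : L2) = mulL s (hw.memLp.toLp _) ∧ v = mulL (2 * s - s ^ 3) (hw.memLp'.toLp _) := by
  have hb : ∀ x, δ ≤ bcfSqrt (w ^ 2 + BoundedContinuousFunction.const ℝ (δ ^ 2)) x := by
    intro x
    rw [bcfSqrt_apply]
    refine Real.le_sqrt_of_sq_le ?_
    change δ ^ 2 ≤ w x ^ 2 + δ ^ 2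
    nlinarith [sq_nonneg (w x)]
  set r := bcfInv _ hδ hb with hr
  have hrx : ∀ x, r x = (√(w x ^ 2 + δ ^ 2))⁻¹ := fun x => rfl
  have hpos : ∀ x, 0 < w x ^ 2 + δ ^ 2 := fun x => by positivity
  have hrd : ∀ x, HasDerivAt r (-(w x * w' x * r x ^ 3)) x := by
    intro x
    have h1 := (((hw.hasDerivAt x).pow 2).add_const (δ ^ 2)).sqrt (hpos x).ne'
    have h2 := h1.inv (Real.sqrt_pos.2 (hpos x)).ne'
    refine (h2.congr_of_eventuallyEq (Eventually.of_forall hrx)).congr_deriv ?_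
    have := Real.sqrt_pos.2 (hpos x)
    rw [hrx]
    simp only [Pi.pow_apply]
    field_simp
    norm_num
    ring
  have hsd : ∀ x, HasDerivAt (w * r : ℝ →ᵇ ℝ) ((w' * r - w ^ 2 * w' * r ^ 3 : ℝ →ᵇ ℝ) x) x := by
    intro x
    refine ((hw.hasDerivAt x).mul (hrd x)).congr_deriv ?_
    simp only [BoundedContinuousFunction.sub_apply, BoundedContinuousFunction.mul_apply,
      BoundedContinuousFunction.pow_apply]
    ring
  -- The approximation of `|w|` is `s w = w² / √(w² + δ²)`, whose derivative simplifies to `(2 s -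
  -- s³) w'`.
  set s := w * r with hs
  set s' := w' * r - w ^ 2 * w' * r ^ 3 with hs'
  have hgd : ∀ x, HasDerivAt (2 * s - s ^ 3 : ℝ →ᵇ ℝ) ((2 * s' - 3 * s ^ 2 * s' : ℝ →ᵇ ℝ) x) x := by
    intro x
    exact (((hsd x).const_mul 2).sub ((hsd x).pow 3)).congr_deriv (by
      change _ = 2 * s' x - 3 * s x ^ 2 * s' x
      norm_num)
  have h1 := hw.isWeakDeriv_toLp.mulL hsd
  -- The flux of the approximation is `(2 s - s³) p w'`, again weakly differentiable, so the
  -- approximation lies in the domain.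
  have h2 := hw.isWeakDeriv_flux.mulL hgd
  have e : mulL s' (hw.memLp.toLp _) + mulL s (hw.memLp'.toLp _) =
      mulL (2 * s - s ^ 3) (hw.memLp'.toLp _) := by
    apply Lp.ext
    filter_upwards [Lp.coeFn_add (mulL s' (hw.memLp.toLp _)) (mulL s (hw.memLp'.toLp _)),
      coeFn_mulL s' (hw.memLp.toLp _), coeFn_mulL s (hw.memLp'.toLp _),
      coeFn_mulL (2 * s - s ^ 3) (hw.memLp'.toLp _), hw.memLp.coeFn_toLp, hw.memLp'.coeFn_toLp]
      with x h1 h2 h3 h4 h5 h6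
    rw [h1, Pi.add_apply, h2, h3, h4, h5, h6, ← Complex.ofReal_mul, ← Complex.ofReal_mul,
      ← Complex.ofReal_mul, ← Complex.ofReal_add]
    congr 1
    change (w' x * r x - w x ^ 2 * w' x * r x ^ 3) * w x + w x * r x * w' x =
      (2 * (w x * r x) - (w x * r x) ^ 3) * w' x
    ring
  rw [e] at h1
  rw [mulL_mulL, mul_comm, ← mulL_mulL] at h2
  obtain ⟨u, hu, -⟩ := A.exists_apply_eq (A.mem_graph_iff.2 ⟨_, _, h1, h2, rfl⟩)
  refine ⟨u, _, s, hu ▸ h1, fun x => ?_, hu, rfl⟩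
  change w x * r x = _
  rw [hrx, div_eq_mul_inv]

/-- If the form were nonnegative, the approximations of `|w|`, whose forms tend to the form of `w`,
that is to `0`, would put `|w|` into the kernel. A multiple of `w` cannot equal `|w|` on both sides
of the sign change. -/
theorem exists_form_neg : ∃ u : A.op.domain, (⟪(u : L2), A.op u⟫_ℂ).re < 0 := by
  by_contra! hpos
  set δ : ℕ → ℝ := fun n => 1 / ((n : ℝ) + 1) with hδdef
  have hδ : ∀ n, 0 < δ n := fun n => by positivity
  have hδ0 : Tendsto δ atTop (𝓝 0) := tendsto_one_div_add_atTop_nhds_zero_nat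
  choose u v s hv hs hus hvs using fun n => hw.exists_approx (hδ n)
  have habs : MemLp (fun x => ((|w x| : ℝ) : ℂ)) 2 volume := by
    refine hw.memLp.of_le (Complex.continuous_ofReal.comp w.continuous.abs).aestronglyMeasurable
      (Eventually.of_forall fun x => ?_)
    simp
  have hs1 : ∀ n x, |s n x| ≤ 1 := by
    intro n x
    rw [hs, abs_div, abs_of_nonneg (Real.sqrt_nonneg _)]
    refine div_le_one_of_le₀ (Real.abs_le_sqrt ?_) (Real.sqrt_nonneg _)
    nlinarith [sq_nonneg (δ n)]
  have hslim : ∀ x, x ≠ 0 → Tendsto (fun n => s n x) atTop (𝓝 (w x / |w x|)) := by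
    intro x hx
    simp only [hs]
    have h1 : Tendsto (fun n => √(w x ^ 2 + δ n ^ 2)) atTop (𝓝 (√(w x ^ 2 + 0 ^ 2))) :=
      (tendsto_const_nhds.add (hδ0.pow 2)).sqrt
    rw [zero_pow two_ne_zero, add_zero, Real.sqrt_sq_eq_abs] at h1
    exact tendsto_const_nhds.div h1 (abs_pos.2 (hw.ne_zero x hx)).ne'
  have hslim2 : ∀ x, x ≠ 0 → Tendsto (fun n => s n x ^ 2) atTop (𝓝 1) := by
    intro x hx
    have h := (hslim x hx).pow 2
    rwa [div_pow, sq_abs, div_self (pow_ne_zero 2 (hw.ne_zero x hx))] at h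
  have hne : ∀ᵐ x : ℝ, x ≠ 0 := by simp [ae_iff]
  have iw : Integrable fun x => w x ^ 2 := by
    have := (memLp_two_iff_integrable_sq_norm hw.memLp.aestronglyMeasurable).1 hw.memLp
    simpa [Complex.norm_real] using this
  have iw' : Integrable fun x => w' x ^ 2 := by
    have := (memLp_two_iff_integrable_sq_norm hw.memLp'.aestronglyMeasurable).1 hw.memLp'
    simpa [Complex.norm_real] using this
  have hx : Tendsto (fun n => (u n : L2)) atTop (𝓝 (habs.toLp _)) := by
    rw [tendsto_iff_norm_sub_tendsto_zero]
    have h1 : Tendsto (fun n => ‖(u n : L2) - habs.toLp _‖ ^ 2) atTop (𝓝 0) := by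
      have e : ∀ n, ‖(u n : L2) - habs.toLp _‖ ^ 2 = ∫ x, (s n x * w x - |w x|) ^ 2 := by
        intro n
        rw [norm_sq_eq_integral]
        refine integral_congr_ae ?_
        rw [hus n]
        filter_upwards [Lp.coeFn_sub (mulL (s n) (hw.memLp.toLp _)) (habs.toLp _),
          coeFn_mulL (s n) (hw.memLp.toLp _), hw.memLp.coeFn_toLp, habs.coeFn_toLp] with x h1 h2 h3 h4
        rw [h1, Pi.sub_apply, h2, h3, h4, ← Complex.ofReal_mul, ← Complex.ofReal_sub,
          Complex.norm_real, Real.norm_eq_abs, sq_abs]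
      simp_rw [e]
      rw [← integral_zero ℝ ℝ]
      refine tendsto_integral_of_dominated_convergence (fun x => 4 * w x ^ 2)
        (fun n => ((((s n).continuous.mul w.continuous).sub w.continuous.abs).pow
          2).aestronglyMeasurable) (iw.const_mul 4) (fun n => Eventually.of_forall fun x => ?_) ?_
      · rw [Real.norm_of_nonneg (sq_nonneg _)]
        have h1 := abs_le.1 (hs1 n x)
        have h2 : abs (s n x * w x - |w x|) ≤ 2 * |w x| := by
          calc abs (s n x * w x - |w x|) ≤ |s n x * w x| + abs |w x| := abs_sub _ _
            _ = |s n x| * |w x| + |w x| := by rw [abs_mul, abs_abs]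
            _ ≤ 1 * |w x| + |w x| := by gcongr; exact hs1 n x
            _ = 2 * |w x| := by ring
        have h3 := pow_le_pow_left₀ (abs_nonneg _) h2 2
        rw [sq_abs, mul_pow, sq_abs] at h3
        linarith
      · filter_upwards [hne] with x hx
        have h1 := (((hslim x hx).mul_const (w x)).sub_const |w x|).pow 2
        have h2 : w x / |w x| * w x - |w x| = 0 := by
          have := abs_pos.2 (hw.ne_zero x hx)
          field_simp
          rw [sq_abs]
          ring
        rwa [h2, zero_pow two_ne_zero] at h1
    have h2 := h1.sqrt
    simpa [Real.sqrt_sq (norm_nonneg _)] using h2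
  -- Off the point `0`, `s² → 1` and hence `(2 s - s³)² → 1`; the bounds `s² ≤ 1` and `(2 s - s³)² ≤
  -- 4` provide the dominating functions.
  have hform : Tendsto (fun n => (⟪(u n : L2), A.op (u n)⟫_ℂ).re) atTop (𝓝 0) := by
    have h0 : (∫ x, A.p x * w' x ^ 2) + ∫ x, A.q x * w x ^ 2 = 0 := by
      obtain ⟨y, hy, hyw⟩ := mem_eigenspace_iff.1 hw.mem_eigenspace
      have h1 := A.re_form y (by rw [hyw]; exact hw.isWeakDeriv_toLp)
      rw [hy, zero_smul, inner_zero_right, Complex.zero_re] at h1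
      rw [h1]
      congr 1
      · refine integral_congr_ae ?_
        filter_upwards [hw.memLp'.coeFn_toLp] with x hx
        rw [hx, Complex.norm_real, Real.norm_eq_abs, sq_abs]
      · refine integral_congr_ae ?_
        rw [hyw]
        filter_upwards [hw.memLp.coeFn_toLp] with x hx
        rw [hx, Complex.norm_real, Real.norm_eq_abs, sq_abs]
    have e : ∀ n, (⟪(u n : L2), A.op (u n)⟫_ℂ).re =
        (∫ x, A.p x * ((2 * s n x - s n x ^ 3) * w' x) ^ 2) +
          ∫ x, A.q x * (s n x * w x) ^ 2 := by
      intro n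
      rw [A.re_form (u n) (hv n)]
      congr 1
      · refine integral_congr_ae ?_
        rw [hvs n]
        filter_upwards [coeFn_mulL (2 * s n - s n ^ 3) (hw.memLp'.toLp _), hw.memLp'.coeFn_toLp]
          with x h1 h2
        rw [h1, h2, ← Complex.ofReal_mul, Complex.norm_real, Real.norm_eq_abs, sq_abs]
        rfl
      · refine integral_congr_ae ?_
        rw [hus n]
        filter_upwards [coeFn_mulL (s n) (hw.memLp.toLp _), hw.memLp.coeFn_toLp] with x h1 h2
        rw [h1, h2, ← Complex.ofReal_mul, Complex.norm_real, Real.norm_eq_abs, sq_abs]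
    simp_rw [e]
    rw [← h0]
    refine Tendsto.add ?_ ?_
    · refine tendsto_integral_of_dominated_convergence (fun x => ‖A.p‖ * (4 * w' x ^ 2))
        (fun n => (A.p.continuous.mul ((((continuous_const.mul (s n).continuous).sub
          ((s n).continuous.pow 3)).mul w'.continuous).pow 2)).aestronglyMeasurable)
        ((iw'.const_mul 4).const_mul _) (fun n => Eventually.of_forall fun x => ?_) ?_
      · rw [norm_mul, Real.norm_of_nonneg (sq_nonneg _)]
        have h2 : s n x ^ 2 ≤ 1 := by
          rw [← sq_abs]
          exact pow_le_one₀ (abs_nonneg _) (hs1 n x)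
        have h3 : (2 * s n x - s n x ^ 3) ^ 2 ≤ 4 := by
          have : (2 * s n x - s n x ^ 3) ^ 2 = s n x ^ 2 * (2 - s n x ^ 2) ^ 2 := by ring
          rw [this]
          nlinarith [sq_nonneg (s n x), sq_nonneg (2 - s n x ^ 2)]
        rw [mul_pow]
        gcongr
        exact A.p.norm_coe_le_norm x
      · filter_upwards [hne] with x hx
        have h1 := (((hslim2 x hx).mul ((tendsto_const_nhds (x := (2 : ℝ))).sub
          (hslim2 x hx) |>.pow 2)).mul_const (w' x ^ 2)).const_mul (A.p x)
        norm_num at h1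
        refine h1.congr fun n => ?_
        ring
    · refine tendsto_integral_of_dominated_convergence (fun x => ‖A.q‖ * (w x ^ 2))
        (fun n => (A.q.continuous.mul (((s n).continuous.mul
          w.continuous).pow 2)).aestronglyMeasurable)
        (iw.const_mul _) (fun n => Eventually.of_forall fun x => ?_) ?_
      · rw [norm_mul, Real.norm_of_nonneg (sq_nonneg _), mul_pow]
        have h2 : s n x ^ 2 ≤ 1 := by
          rw [← sq_abs]
          exact pow_le_one₀ (abs_nonneg _) (hs1 n x)
        have := A.q.norm_coe_le_norm x
        have h3 : s n x ^ 2 * w x ^ 2 ≤ w x ^ 2 := by nlinarith [sq_nonneg (w x)]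
        gcongr
      · filter_upwards [hne] with x hx
        have h1 := ((hslim2 x hx).mul_const (w x ^ 2)).const_mul (A.q x)
        rw [one_mul] at h1
        refine h1.congr fun n => ?_
        ring
  have hmem := mem_ker_of_tendsto_form A.isSelfAdjoint hpos hx hform
  rw [hw.eigenspace_zero, Submodule.mem_span_singleton] at hmem
  obtain ⟨a, ha⟩ := hmem
  have hfun : (fun x => a * (w x : ℂ)) = fun x => ((|w x| : ℝ) : ℂ) := by
    refine (Continuous.ae_eq_iff_eq volume
      (continuous_const.mul (Complex.continuous_ofReal.comp w.continuous))
      (Complex.continuous_ofReal.comp w.continuous.abs)).1 ?_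
    have h1 := habs.coeFn_toLp
    rw [← ha] at h1
    filter_upwards [h1, Lp.coeFn_smul a (hw.memLp.toLp _), hw.memLp.coeFn_toLp] with x h1 h2 h3
    change a * (w x : ℂ) = ((|w x| : ℝ) : ℂ)
    rw [← h1, h2, Pi.smul_apply, h3, smul_eq_mul]
  have h1 := congrFun hfun 1
  have h2 := congrFun hfun (-1)
  have n1 := hw.neg 1 one_pos
  have p1 := hw.pos (-1) (by norm_num)
  simp only [abs_of_neg n1, abs_of_pos p1] at h1 h2
  have n1' : (w 1 : ℂ) ≠ 0 := by exact_mod_cast n1.ne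
  have p1' : (w (-1) : ℂ) ≠ 0 := by exact_mod_cast p1.ne'
  have a1 : a = -1 := by
    apply mul_right_cancel₀ n1'
    rw [h1]; push_cast; ring
  have a2 : a = 1 := by
    apply mul_right_cancel₀ p1'
    rw [h2]; ring
  rw [a1] at a2
  norm_num at a2

/-- Below a small positive level the spectrum consists of a simple negative eigenvalue and the
simple eigenvalue `0`. -/
theorem spectrum_below {a : ℝ} (ha : 0 < a) (hab : HasFormBound A.op a) :
    ∃ δ : ℝ, 0 < δ ∧ ∃ E₀ : ℝ, E₀ < 0 ∧ {z ∈ spectrum A.op | z.re < δ} = {(E₀ : ℂ), 0} ∧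
      IsSimpleEigenvalue A.op (E₀ : ℂ) ∧ IsSimpleEigenvalue A.op 0 := by
  obtain ⟨l, hl⟩ := A.exists_eval_zero
  have hl0 : ∀ u : A.op.domain, l u = 0 → 0 * ‖(u : L2)‖ ^ 2 ≤ (⟪(u : L2), A.op u⟫_ℂ).re := by
    intro u hu
    rw [zero_mul]
    exact hw.form_nonneg hl hu
  obtain ⟨E, hE, hEs⟩ := exists_neg_mem_spectrum A.isSelfAdjoint A.form_lower_bound hw.exists_form_neg
  have hEe := eigenspace_ne_bot_of_mem_spectrum A.isSelfAdjoint hab (hE.trans ha) hEs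
  -- Two orthonormal eigenvectors with negative eigenvalues would exceed the rank of the single
  -- functional `l`, on whose kernel the form is nonnegative.
  have huniq : ∀ r : ℝ, r < 0 → eigenspace A.op (r : ℂ) ≠ ⊥ → r = E := by
    intro r hr hre
    by_contra hne
    obtain ⟨u₁, hu1, hu1'⟩ := exists_unit_eigenvector hEe
    obtain ⟨u₂, hu2, hu2'⟩ := exists_unit_eigenvector hre
    have h12 := A.isSymm.inner_eq_zero (Ne.symm hne) hu1' hu2'
    have := card_le_finrank_of_orthonormal l hl0 ![u₁, u₂] ![E, r] (by
      rw [orthonormal_iff_ite]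
      intro i j
      fin_cases i <;> fin_cases j
      · simp [hu1]
      · simpa using h12
      · simpa using inner_eq_zero_symm.1 h12
      · simp [hu2]) (by
      intro i
      fin_cases i
      · exact hu1'
      · exact hu2') (by
      intro i
      fin_cases i
      · exact hE
      · exact hr)
    simp at this
  have hfin : Module.finrank ℂ (eigenspace A.op (E : ℂ)) = 1 := by
    have := finiteDimensional_eigenspace_of_hasFormBound hab (hE.trans ha)
    apply le_antisymm
    · set o := stdOrthonormalBasis ℂ (eigenspace A.op (E : ℂ))
      choose u hu hu' using fun i => mem_eigenspace_iff.1 (o i).2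
      have := card_le_finrank_of_orthonormal l hl0 u (fun _ => E) (by
        have h := o.orthonormal.comp_linearIsometry (eigenspace A.op (E : ℂ)).subtypeₗᵢ
        convert h using 1
        ext1 i
        exact hu' i) (fun i => (hu i).trans (by rw [hu' i])) (fun _ => hE)
      simpa using this
    · rw [Nat.one_le_iff_ne_zero, Ne, Submodule.finrank_eq_zero]
      exact hEe
  -- Only finitely many eigenvalues lie below `a`, so the positive ones stay away from `0`.
  obtain ⟨δ, hδ, hδ0⟩ : ∃ δ > 0, δ ≤ a ∧
      ∀ r : ℝ, r < δ → eigenspace A.op (r : ℂ) ≠ ⊥ → r ≤ 0 := by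
    have hf := finite_eigenvalues_of_hasFormBound A.isSymm hab
    have hf' : {r : ℝ | 0 < r ∧ r < a ∧ eigenspace A.op (r : ℂ) ≠ ⊥}.Finite :=
      hf.subset fun r hr => hr.2
    have hnot : {r : ℝ | 0 < r ∧ r < a ∧ eigenspace A.op (r : ℂ) ≠ ⊥}ᶜ ∈ 𝓝 (0 : ℝ) :=
      hf'.isClosed.isOpen_compl.mem_nhds fun h => lt_irrefl _ h.1
    obtain ⟨ε, hε, hball⟩ := Metric.mem_nhds_iff.1 hnot
    refine ⟨min ε a, lt_min hε ha, min_le_right _ _, fun r hr hre => ?_⟩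
    by_contra! h
    refine hball (?_ : r ∈ Metric.ball 0 ε) ⟨h, hr.trans_le (min_le_right _ _), hre⟩
    rw [Metric.mem_ball, Real.dist_eq, sub_zero, abs_of_pos h]
    exact hr.trans_le (min_le_left _ _)
  have h0s : eigenspace A.op 0 ≠ ⊥ := fun h => by
    have := hw.finrank_eigenspace_zero
    rw [h] at this
    simp at this
  refine ⟨δ, hδ, E, hE, ?_, isSimpleEigenvalue_of_finrank A.isSymm E hfin, ?_⟩
  · ext z
    constructor
    · rintro ⟨hz, hzδ⟩
      have hzr := spectrum_eq_ofReal_re A.isSelfAdjoint hz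
      rw [hzr] at hz
      have he := eigenspace_ne_bot_of_mem_spectrum A.isSelfAdjoint hab (hzδ.trans_le hδ0.1) hz
      rcases (hδ0.2 _ hzδ he).lt_or_eq with h | h
      · left
        rw [hzr, huniq _ h he]
      · right
        rw [hzr, h]
        exact Complex.ofReal_zero
    · rintro (rfl | h)
      · exact ⟨hEs, by rw [Complex.ofReal_re]; exact hE.trans hδ⟩
      · rw [Set.mem_singleton_iff] at h
        subst h
        exact ⟨mem_spectrum_of_eigenspace_ne_bot h0s, by rwa [Complex.zero_re]⟩
  · have := isSimpleEigenvalue_of_finrank A.isSymm 0 (by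
      rw [Complex.ofReal_zero]; exact hw.finrank_eigenspace_zero)
    rwa [Complex.ofReal_zero] at this

end NullSolution

end Coeff

end BCH

/-! ### Calculus lemmas for the profile -/

namespace BCH

/-- A second difference of `f` with step one equals `f''` at an intermediate point and tends to
zero, so `m = 0`. Then `f'` is a first difference of `f` up to an error controlled by `f''`. -/
theorem tendsto_zero_of_tendsto_deriv_deriv {f f' f'' : ℝ → ℝ} (h : ∀ x, HasDerivAt f (f' x) x)
    (h' : ∀ x, HasDerivAt f' (f'' x) x) {l m : ℝ} (hf : Tendsto f atTop (𝓝 l))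
    (hf'' : Tendsto f'' atTop (𝓝 m)) : m = 0 ∧ Tendsto f' atTop (𝓝 0) := by
  have mvt : ∀ {g g' : ℝ → ℝ}, (∀ x, HasDerivAt g (g' x) x) → ∀ {x y}, x < y →
      ∃ ξ ∈ Set.Ioo x y, g' ξ * (y - x) = g y - g x := by
    intro g g' hg x y hxy
    obtain ⟨ξ, hξ, e⟩ := exists_hasDerivAt_eq_slope g g' hxy
      (fun z _ => (hg z).continuousAt.continuousWithinAt) (fun z _ => hg z)
    exact ⟨ξ, hξ, by rw [e, div_mul_cancel₀ _ (sub_pos.2 hxy).ne']⟩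
  have hshift : ∀ r : ℝ, Tendsto (fun x => f (x + r)) atTop (𝓝 l) := fun r =>
    hf.comp (tendsto_atTop_add_const_right atTop r tendsto_id)
  have hm : m = 0 := by
    have h2 : ∀ x, ∃ ζ, x ≤ ζ ∧ f'' ζ = f (x + 1 + 1) - f (x + 1) - (f (x + 1) - f x) := by
      intro x
      obtain ⟨η, hη, e⟩ := mvt (g := fun y => f (y + 1) - f y) (g' := fun y => f' (y + 1) - f' y)
        (fun y => ((h (y + 1)).comp_add_const y 1).sub (h y)) (lt_add_one x)
      obtain ⟨ζ, hζ, e'⟩ := mvt h' (lt_add_one η)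
      refine ⟨ζ, (hη.1.trans hζ.1).le, ?_⟩
      rw [← e, ← e']
      ring
    choose ζ hζ e using h2
    have h3 := hf''.comp (tendsto_atTop_mono hζ tendsto_id)
    have h4 : Tendsto (fun x => f (x + 1 + 1) - f (x + 1) - (f (x + 1) - f x)) atTop
        (𝓝 (l - l - (l - l))) := by
      refine Tendsto.sub (Tendsto.sub ?_ (hshift 1)) ((hshift 1).sub hf)
      simp_rw [add_assoc]
      exact hshift (1 + 1)
    have h5 := tendsto_nhds_unique (h3.congr e) h4
    rw [h5]
    ring
  refine ⟨hm, ?_⟩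
  subst hm
  have h2 : ∀ x, ∃ η, x ≤ η ∧ |f' x| ≤ |f (x + 1) - f x| + |f'' η| := by
    intro x
    obtain ⟨ξ, hξ, e⟩ := mvt h (lt_add_one x)
    obtain ⟨η, hη, e'⟩ := mvt h' hξ.1
    refine ⟨η, hη.1.le, ?_⟩
    have h1 : f' x = (f (x + 1) - f x) - f'' η * (ξ - x) := by rw [← e, e']; ring
    have h3 : |f'' η * (ξ - x)| ≤ |f'' η| := by
      rw [abs_mul, abs_of_pos (sub_pos.2 hξ.1)]
      exact mul_le_of_le_one_right (abs_nonneg _) (by linarith [hξ.2])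
    rw [h1]
    exact (abs_sub _ _).trans (by linarith)
  choose η hη hle using h2
  have h3 := hf''.comp (tendsto_atTop_mono hη tendsto_id)
  have h4 := ((hshift 1).sub hf).abs.add h3.abs
  rw [sub_self, abs_zero, add_zero] at h4
  exact squeeze_zero_norm hle h4

/-- A differentiable function that decreases at each of its zeros is negative after any zero. -/
theorem neg_of_deriv_neg_of_eq_zero {g g' : ℝ → ℝ} (hg : ∀ x, HasDerivAt g (g' x) x)
    (hz : ∀ x, g x = 0 → g' x < 0) {a x : ℝ} (ha : g a = 0) (hx : a < x) : g x < 0 := by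
  by_contra! hgx
  have hgc : Continuous g := continuous_iff_continuousAt.2 fun x => (hg x).continuousAt
  obtain ⟨x₁, hx₁, hgx₁⟩ : ∃ x₁ ∈ Set.Ioo a x, g x₁ < 0 := by
    by_contra! h
    have h1 := (hasDerivAt_iff_tendsto_slope.1 (hg a)).mono_left
      (nhdsWithin_mono a (s := Set.Ioi a) fun y hy => ne_of_gt hy)
    refine (hz a ha).not_ge (ge_of_tendsto h1 ?_)
    filter_upwards [Ioo_mem_nhdsGT hx] with y hy
    rw [slope_def_field, ha, sub_zero]
    exact div_nonneg (h y hy) (sub_pos.2 hy.1).le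
  -- Its infimum `z` is the first return to zero after `x₁`. Slopes at `z` from the left are
  -- nonnegative, against `g' z < 0`.
  set S := Set.Icc x₁ x ∩ {y | 0 ≤ g y} with hS
  have hScl : IsClosed S := isClosed_Icc.inter (isClosed_le continuous_const hgc)
  have hSne : S.Nonempty := ⟨x, ⟨hx₁.2.le, le_rfl⟩, hgx⟩
  have hSbd : BddBelow S := ⟨x₁, fun y hy => hy.1.1⟩
  have hzS := hScl.csInf_mem hSne hSbd
  set z := sInf S with hzdef
  have hx₁z : x₁ < z := hzS.1.1.lt_of_ne fun h => by
    have : 0 ≤ g z := hzS.2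
    rw [← h] at this
    exact hgx₁.not_ge this
  have hlt : ∀ y ∈ Set.Ioo x₁ z, g y < 0 := by
    intro y hy
    by_contra! h
    exact (csInf_le hSbd ⟨⟨hy.1.le, hy.2.le.trans hzS.1.2⟩, h⟩).not_gt hy.2
  have hz0 : g z = 0 := by
    refine le_antisymm ?_ hzS.2
    have h1 : Tendsto g (𝓝[<] z) (𝓝 (g z)) := hgc.continuousAt.tendsto.mono_left nhdsWithin_le_nhds
    refine le_of_tendsto h1 ?_
    filter_upwards [Ioo_mem_nhdsLT hx₁z] with y hy
    exact (hlt y hy).le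
  have h1 := (hasDerivAt_iff_tendsto_slope.1 (hg z)).mono_left
    (nhdsWithin_mono z (s := Set.Iio z) fun y hy => ne_of_lt hy)
  refine (hz z hz0).not_ge (ge_of_tendsto h1 ?_)
  filter_upwards [Ioo_mem_nhdsLT hx₁z] with y hy
  rw [slope_def_field, hz0, sub_zero]
  exact div_nonneg_of_nonpos (hlt y hy).le (sub_neg.2 hy.2).le

/-- The trapezoidal rule for the concave function `s ↦ s - k ((c - k) / (c - s)) ^ b`, in
normalised form. -/
theorem rpow_mul_lt {b t : ℝ} (hb : 1 < b) (ht : 1 < t) :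
    t ^ b * ((b + 1) - (b - 1) * t) < (b + 1) * t - (b - 1) := by
  -- `ψ 1 = 0`, so it is enough that `ψ` increases.
  set ψ : ℝ → ℝ := fun t => (b + 1) * t - (b - 1) - (b + 1) * t ^ b + (b - 1) * (t ^ b * t) with hψ
  have hd : ∀ t : ℝ, 1 ≤ t → HasDerivAt ψ
      ((b + 1) * 1 - (b + 1) * (1 * b * t ^ (b - 1)) +
        (b - 1) * (1 * b * t ^ (b - 1) * t + t ^ b * 1)) t := by
    intro t ht
    have h1 : HasDerivAt (fun t : ℝ => t ^ b) (1 * b * t ^ (b - 1)) t :=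
      (hasDerivAt_id t).rpow_const (Or.inr hb.le)
    exact ((((hasDerivAt_id t).const_mul (b + 1)).sub_const (b - 1)).sub
      (h1.const_mul (b + 1))).add ((h1.mul (hasDerivAt_id t)).const_mul (b - 1))
  have hmono : StrictMonoOn ψ (Set.Ici 1) := by
    refine strictMonoOn_of_deriv_pos (convex_Ici 1)
      (fun t ht => (hd t ht).continuousAt.continuousWithinAt) fun t ht => ?_
    rw [interior_Ici] at ht
    have ht1 : 1 < t := ht
    have ht0 : 0 < t := one_pos.trans ht1
    rw [(hd t ht1.le).deriv, Real.rpow_sub_one ht0.ne']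
    -- Bernoulli at `1 / t`, where `ψ'` takes the form `(b + 1) (1 - t ^ b (1 + b (1 / t - 1)))`.
    have h1 := one_add_mul_self_lt_rpow_one_add (s := t⁻¹ - 1)
      (by linarith [inv_pos.2 ht0]) (by
        rw [sub_ne_zero]
        exact (inv_lt_one_of_one_lt₀ ht1).ne) hb
    rw [add_sub_cancel, Real.inv_rpow ht0.le] at h1
    have hp : 0 < t ^ b := Real.rpow_pos_of_pos ht0 b
    set P := t ^ b with hP
    have h2 : P * (1 + b * (t⁻¹ - 1)) < 1 := by
      have := mul_lt_mul_of_pos_left h1 hp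
      rwa [mul_inv_cancel₀ hp.ne'] at this
    have h3 : (b + 1) * 1 - (b + 1) * (1 * b * (P / t)) + (b - 1) * (1 * b * (P / t) * t + P * 1) =
        (b + 1) * (1 - P * (1 + b * (t⁻¹ - 1))) := by
      field_simp
      ring
    rw [h3]
    exact mul_pos (by linarith) (by linarith)
  have h := hmono (Set.mem_Ici.2 le_rfl) (Set.mem_Ici.2 ht.le) ht
  simp only [hψ, Real.one_rpow] at h
  nlinarith

/-! ### The shape of the solitary wave -/

namespace IsSolitaryWave

variable {b c k : ℝ} {φ : ℝ → ℝ} (hφ : IsSolitaryWave b c k φ)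

include hφ

theorem hasDerivAt (x : ℝ) : HasDerivAt φ (deriv φ x) x :=
  (hφ.smooth.differentiable (by simp)).differentiableAt.hasDerivAt

theorem hasDerivAt_deriv (x : ℝ) : HasDerivAt (deriv φ) (φ x - momentum φ x) x := by
  have h1 : ContDiff ℝ ∞ (deriv φ) := ContDiff.deriv' (n := ∞) hφ.smooth
  have h2 := (h1.differentiable (by simp)).differentiableAt (x := x).hasDerivAt
  rwa [momentum, sub_sub_cancel, iteratedDeriv_succ, iteratedDeriv_one]

theorem hasDerivAt_momentum (x : ℝ) :
    HasDerivAt (momentum φ) (deriv φ x - iteratedDeriv 3 φ x) x := by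
  have h2 : ContDiff ℝ ∞ (iteratedDeriv 2 φ) := by
    rw [iteratedDeriv_succ, iteratedDeriv_one]
    exact ContDiff.deriv' (n := ∞) (ContDiff.deriv' (n := ∞) hφ.smooth)
  have h3 := (h2.differentiable (by simp)).differentiableAt (x := x).hasDerivAt
  rw [iteratedDeriv_succ (n := 2)]
  exact (hφ.hasDerivAt x).sub h3

theorem speed_sub_mul_deriv_momentum (x : ℝ) :
    (c - φ x) * deriv (momentum φ) x = b * deriv φ x * momentum φ x := by
  rw [(hφ.hasDerivAt_momentum x).deriv, momentum]
  linear_combination hφ.equation x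

theorem continuous : Continuous φ := hφ.smooth.continuous

theorem continuous_deriv : Continuous (deriv φ) :=
  continuous_iff_continuousAt.2 fun x => (hφ.hasDerivAt_deriv x).continuousAt

theorem continuous_momentum : Continuous (momentum φ) :=
  continuous_iff_continuousAt.2 fun x => (hφ.hasDerivAt_momentum x).continuousAt

omit hφ in
theorem deriv_comp_neg' (x : ℝ) : deriv (fun x => φ (-x)) x = -deriv φ (-x) := deriv_comp_neg φ x

omit hφ in
theorem momentum_comp_neg (x : ℝ) : momentum (fun x => φ (-x)) x = momentum φ (-x) := by
  rw [momentum, momentum, iteratedDeriv_comp_neg]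
  simp

theorem comp_neg : IsSolitaryWave b c k (fun x => φ (-x)) where
  smooth := hφ.smooth.comp contDiff_neg
  equation x := by
    rw [iteratedDeriv_comp_neg, iteratedDeriv_comp_neg, deriv_comp_neg']
    have := hφ.equation (-x)
    simp only [smul_eq_mul]
    linear_combination -this
  deriv_zero := by rw [deriv_comp_neg', neg_zero, hφ.deriv_zero, neg_zero]
  tendsto_atTop := hφ.tendsto_atBot.comp tendsto_neg_atTop_atBot
  tendsto_atBot := hφ.tendsto_atTop.comp tendsto_neg_atBot_atTop
  nonconstant := by
    obtain ⟨x, hx⟩ := hφ.nonconstant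
    exact ⟨-x, by rwa [neg_neg]⟩

/-- The equation `(c - φ) μ' = b φ' μ` is the vanishing of the derivative of this product where `φ <
c`. A half-line suffices as domain because `φ < c` is not yet known globally. -/
theorem flux_const {x₀ : ℝ} (h : ∀ x, x₀ < x → φ x < c) :
    ∃ K, ∀ x, x₀ < x → (c - φ x) ^ b * momentum φ x = K := by
  have hd : ∀ x, x₀ < x → HasDerivAt (fun x => (c - φ x) ^ b * momentum φ x) 0 x := by
    intro x hx
    have hpos : 0 < c - φ x := sub_pos.2 (h x hx)
    have h1 := ((hφ.hasDerivAt x).const_sub c).rpow_const (p := b) (Or.inl hpos.ne')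
    refine (h1.mul (hφ.hasDerivAt_momentum x)).congr_deriv ?_
    rw [← (hφ.hasDerivAt_momentum x).deriv, Real.rpow_sub_one hpos.ne']
    have h2 := hφ.speed_sub_mul_deriv_momentum x
    field_simp
    linear_combination (c - φ x) ^ b * h2
  obtain ⟨K, hK⟩ := isOpen_Ioi.exists_is_const_of_deriv_eq_zero (isPreconnected_Ioi (a := x₀))
    (fun x hx => (hd x hx).differentiableAt.differentiableWithinAt) (fun x hx => (hd x hx).deriv)
  exact ⟨K, hK⟩

/-- The conserved product determines the limit of `μ`, hence that of `φ'' = φ - μ`. Since `φ`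
converges, the latter limit is `0`, which identifies the constant. -/
theorem flux_eq_of_lt (hkc : k < c) {x₀ : ℝ} (h : ∀ x, x₀ < x → φ x < c) :
    (∀ x, x₀ < x → (c - φ x) ^ b * momentum φ x = k * (c - k) ^ b) ∧
      Tendsto (deriv φ) atTop (𝓝 0) ∧ Tendsto (momentum φ) atTop (𝓝 k) := by
  obtain ⟨K, hK⟩ := hφ.flux_const h
  have hpos : 0 < (c - k) ^ b := Real.rpow_pos_of_pos (sub_pos.2 hkc) b
  have h1 : Tendsto (momentum φ) atTop (𝓝 (K / (c - k) ^ b)) := by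
    have h2 : Tendsto (fun x => K / (c - φ x) ^ b) atTop (𝓝 (K / (c - k) ^ b)) :=
      tendsto_const_nhds.div ((tendsto_const_nhds.sub hφ.tendsto_atTop).rpow_const
        (Or.inl (sub_pos.2 hkc).ne')) hpos.ne'
    refine h2.congr' ?_
    filter_upwards [eventually_gt_atTop x₀] with x hx
    have : 0 < (c - φ x) ^ b := Real.rpow_pos_of_pos (sub_pos.2 (h x hx)) b
    rw [div_eq_iff this.ne', ← hK x hx, mul_comm]
  obtain ⟨h2, h3⟩ := tendsto_zero_of_tendsto_deriv_deriv hφ.hasDerivAt hφ.hasDerivAt_deriv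
    hφ.tendsto_atTop (hφ.tendsto_atTop.sub h1)
  have h4 : k = K / (c - k) ^ b := sub_eq_zero.1 h2
  rw [← h4] at h1
  rw [eq_div_iff hpos.ne'] at h4
  exact ⟨fun x hx => by rw [hK x hx, h4], h3, h1⟩

/-- At the last point where `φ ≥ c` one has `φ = c`, so from the right the conserved product tends
to `0`, although its value is `k (c - k) ^ b > 0`. -/
theorem lt_speed (hb : 1 < b) (hk : 0 < k) (hkc : k < c) (x : ℝ) : φ x < c := by
  by_contra! hx
  set S := {y | c ≤ φ y} with hS
  have hScl : IsClosed S := isClosed_le continuous_const hφ.continuous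
  have hSne : S.Nonempty := ⟨x, hx⟩
  have hSbd : BddAbove S := by
    obtain ⟨R, hR⟩ := eventually_atTop.1 (hφ.tendsto_atTop.eventually (gt_mem_nhds hkc))
    refine ⟨R, fun y hy => ?_⟩
    by_contra! h
    exact (hR y h.le).not_ge hy
  have hmem := hScl.csSup_mem hSne hSbd
  set x₀ := sSup S
  have hlt : ∀ y, x₀ < y → φ y < c := by
    intro y hy
    by_contra! h
    exact (le_csSup hSbd h).not_gt hy
  obtain ⟨hK, -, -⟩ := hφ.flux_eq_of_lt hkc hlt
  have h1 : Tendsto φ (𝓝[>] x₀) (𝓝 (φ x₀)) :=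
    hφ.continuous.continuousAt.tendsto.mono_left nhdsWithin_le_nhds
  have h2 : Tendsto (momentum φ) (𝓝[>] x₀) (𝓝 (momentum φ x₀)) :=
    hφ.continuous_momentum.continuousAt.tendsto.mono_left nhdsWithin_le_nhds
  have h3 : φ x₀ = c := by
    refine le_antisymm (le_of_tendsto h1 ?_) hmem
    filter_upwards [self_mem_nhdsWithin] with y hy
    exact (hlt y hy).le
  have h4 := ((tendsto_const_nhds (x := c)).sub h1 |>.rpow_const (p := b)
    (Or.inr (by linarith))).mul h2
  have h5 : Tendsto (fun y => (c - φ y) ^ b * momentum φ y) (𝓝[>] x₀) (𝓝 (k * (c - k) ^ b)) := by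
    refine tendsto_const_nhds.congr' ?_
    filter_upwards [self_mem_nhdsWithin] with y hy
    exact (hK y hy).symm
  have h6 := tendsto_nhds_unique h4 h5
  rw [h3, sub_self, Real.zero_rpow (by linarith), zero_mul] at h6
  exact (mul_pos hk (Real.rpow_pos_of_pos (sub_pos.2 hkc) b)).ne h6

theorem momentum_eq (hb : 1 < b) (hk : 0 < k) (hkc : k < c) (x : ℝ) :
    momentum φ x = k * ((c - k) / (c - φ x)) ^ b := by
  have hlt := hφ.lt_speed hb hk hkc
  have h := (hφ.flux_eq_of_lt hkc (x₀ := x - 1) fun y _ => hlt y).1 x (by linarith)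
  have hpos := sub_pos.2 (hlt x)
  rw [Real.div_rpow (sub_pos.2 hkc).le hpos.le]
  have := Real.rpow_pos_of_pos hpos b
  field_simp
  linarith

theorem momentum_pos (hb : 1 < b) (hk : 0 < k) (hkc : k < c) (x : ℝ) : 0 < momentum φ x := by
  rw [hφ.momentum_eq hb hk hkc]
  exact mul_pos hk (Real.rpow_pos_of_pos
    (div_pos (sub_pos.2 hkc) (sub_pos.2 (hφ.lt_speed hb hk hkc x))) b)

theorem tendsto_deriv_atTop (hb : 1 < b) (hk : 0 < k) (hkc : k < c) :
    Tendsto (deriv φ) atTop (𝓝 0) :=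
  (hφ.flux_eq_of_lt hkc (x₀ := 0) fun y _ => hφ.lt_speed hb hk hkc y).2.1

theorem tendsto_momentum_atTop (hb : 1 < b) (hk : 0 < k) (hkc : k < c) :
    Tendsto (momentum φ) atTop (𝓝 k) :=
  (hφ.flux_eq_of_lt hkc (x₀ := 0) fun y _ => hφ.lt_speed hb hk hkc y).2.2

theorem tendsto_deriv_atBot (hb : 1 < b) (hk : 0 < k) (hkc : k < c) :
    Tendsto (deriv φ) atBot (𝓝 0) := by
  have h := ((hφ.comp_neg.tendsto_deriv_atTop hb hk hkc).neg).comp tendsto_neg_atBot_atTop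
  rw [neg_zero] at h
  refine h.congr fun x => ?_
  simp only [Function.comp_apply]
  rw [deriv_comp_neg', neg_neg, neg_neg]

theorem tendsto_momentum_atBot (hb : 1 < b) (hk : 0 < k) (hkc : k < c) :
    Tendsto (momentum φ) atBot (𝓝 k) := by
  refine ((hφ.comp_neg.tendsto_momentum_atTop hb hk hkc).comp tendsto_neg_atBot_atTop).congr
    fun x => ?_
  simp only [Function.comp_apply]
  rw [momentum_comp_neg, neg_neg]

/-- The first integral of the travelling wave equation. -/
theorem first_integral (hb : 1 < b) (hk : 0 < k) (hkc : k < c) (x : ℝ) :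
    (b - 1) * deriv φ x ^ 2 =
      (b - 1) * φ x ^ 2 - 2 * momentum φ x * (c - φ x) + k * (2 * c - (b + 1) * k) := by
  set G : ℝ → ℝ := fun x =>
    (b - 1) * (deriv φ x ^ 2 - φ x ^ 2) + 2 * (momentum φ x * (c - φ x)) with hG
  have hd : ∀ x, HasDerivAt G 0 x := by
    intro x
    have h1 := (((hφ.hasDerivAt_deriv x).pow 2).sub ((hφ.hasDerivAt x).pow 2)).const_mul (b - 1)
    have h2 := ((hφ.hasDerivAt_momentum x).mul ((hφ.hasDerivAt x).const_sub c)).const_mul 2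
    refine (h1.add h2).congr_deriv ?_
    rw [← (hφ.hasDerivAt_momentum x).deriv]
    have h3 := hφ.speed_sub_mul_deriv_momentum x
    norm_num
    linear_combination 2 * h3
  have hconst : ∀ y, G y = G x := fun y =>
    is_const_of_deriv_eq_zero (fun y => (hd y).differentiableAt) (fun y => (hd y).deriv) y x
  have h1 : Tendsto G atTop (𝓝 ((b - 1) * (0 ^ 2 - k ^ 2) + 2 * (k * (c - k)))) :=
    ((((hφ.tendsto_deriv_atTop hb hk hkc).pow 2).sub (hφ.tendsto_atTop.pow 2)).const_mul _).add
      (((hφ.tendsto_momentum_atTop hb hk hkc).mul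
        (tendsto_const_nhds.sub hφ.tendsto_atTop)).const_mul 2)
  have h2 : Tendsto G atTop (𝓝 (G x)) := by
    rw [show G = fun _ => G x from funext hconst]
    exact tendsto_const_nhds
  have h3 := tendsto_nhds_unique h1 h2
  simp only [hG] at h3
  linear_combination -h3

/-- Bernoulli's inequality for the power `b` of `(c - k) / (c - φ) = 1 + (φ - k) / (c - φ)`. -/
theorem bernoulli (hb : 1 < b) (hk : 0 < k) (hkc : k < c) {x : ℝ} (hx : φ x ≠ k) :
    k * ((c - φ x) + b * (φ x - k)) < momentum φ x * (c - φ x) := by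
  have hpos := sub_pos.2 (hφ.lt_speed hb hk hkc x)
  have hpos' := sub_pos.2 hkc
  have e : 1 + (φ x - k) / (c - φ x) = (c - k) / (c - φ x) := by field_simp; ring
  have h1 := one_add_mul_self_lt_rpow_one_add (s := (φ x - k) / (c - φ x))
    (by have : 0 < (c - k) / (c - φ x) := div_pos hpos' hpos
        linarith)
    (div_ne_zero (sub_ne_zero.2 hx) hpos.ne') hb
  rw [e] at h1
  rw [hφ.momentum_eq hb hk hkc]
  have h2 := mul_lt_mul_of_pos_left h1 (mul_pos hk hpos)
  have h3 : k * (c - φ x) * (1 + b * ((φ x - k) / (c - φ x))) =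
      k * ((c - φ x) + b * (φ x - k)) := by field_simp
  rw [h3] at h2
  linarith

/-- After inserting the first integral this is the Bernoulli bound, with equality when `φ = k`. -/
theorem deriv_sq_le (hb : 1 < b) (hk : 0 < k) (hkc : k < c) (x : ℝ) :
    deriv φ x ^ 2 ≤ (φ x - k) ^ 2 := by
  have h1 := hφ.first_integral hb hk hkc x
  have hb' : 0 < b - 1 := by linarith
  rw [← mul_le_mul_iff_right₀ hb', h1]
  by_cases hx : φ x = k
  · have := hφ.momentum_eq hb hk hkc x
    rw [hx, div_self (sub_pos.2 hkc).ne', Real.one_rpow, mul_one] at this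
    rw [this, hx]
    nlinarith
  · have := hφ.bernoulli hb hk hkc hx
    nlinarith

/-- A Grönwall argument: `|φ'| ≤ |φ - k|` makes `(φ - k)² e^{-2t}` nonincreasing and `(φ - k)²
e^{2t}` nondecreasing, so touching `k` once forces `φ = k` everywhere. -/
theorem ne_background (hb : 1 < b) (hk : 0 < k) (hkc : k < c) (x : ℝ) : φ x ≠ k := by
  intro hx
  obtain ⟨y, hy⟩ := hφ.nonconstant
  have hd : ∀ (s t : ℝ), HasDerivAt (fun t => (φ t - k) ^ 2 * Real.exp (s * t))
      ((2 * (φ t - k) * deriv φ t + s * (φ t - k) ^ 2) * Real.exp (s * t)) t := by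
    intro s t
    have h1 := ((hφ.hasDerivAt t).sub_const k).pow 2
    have h2 := ((hasDerivAt_id t).const_mul s).exp
    refine (h1.mul h2).congr_deriv ?_
    norm_num
    ring
  have hle : ∀ t, |(φ t - k) * deriv φ t| ≤ (φ t - k) ^ 2 := by
    intro t
    have h1 := hφ.deriv_sq_le hb hk hkc t
    rw [abs_mul, ← sq_abs (φ t - k)]
    have := sq_le_sq.1 h1
    nlinarith [abs_nonneg (φ t - k)]
  have hypos : 0 < (φ y - k) ^ 2 := by
    have := sub_ne_zero.2 hy
    positivity
  rcases le_total x y with h | h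
  · have hanti : Antitone (fun t => (φ t - k) ^ 2 * Real.exp (-2 * t)) := by
      refine antitone_of_deriv_nonpos (fun t => (hd _ t).differentiableAt) fun t => ?_
      rw [(hd _ t).deriv]
      refine mul_nonpos_of_nonpos_of_nonneg ?_ (Real.exp_pos _).le
      linarith [(abs_le.1 (hle t)).2]
    have := hanti h
    simp only [hx, sub_self] at this
    have := mul_pos hypos (Real.exp_pos (-2 * y))
    linarith
  · have hmono : Monotone (fun t => (φ t - k) ^ 2 * Real.exp (2 * t)) := by
      refine monotone_of_deriv_nonneg (fun t => (hd _ t).differentiableAt) fun t => ?_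
      rw [(hd _ t).deriv]
      refine mul_nonneg ?_ (Real.exp_pos _).le
      linarith [(abs_le.1 (hle t)).1]
    have := hmono h
    simp only [hx, sub_self] at this
    have := mul_pos hypos (Real.exp_pos (2 * y))
    linarith

/-- `φ'² / 2` is the integral from `k` to `φ` of the strictly concave function `s - k ((c - k) / (c
- s)) ^ b`, which vanishes at `k` and equals `φ - μ` at `φ`. Such an integral exceeds its
trapezoidal value. -/
theorem sub_mul_sub_momentum_lt (hb : 1 < b) (hk : 0 < k) (hkc : k < c) {x : ℝ} (hx : k < φ x) :
    (φ x - k) * (φ x - momentum φ x) < deriv φ x ^ 2 := by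
  have hpos := sub_pos.2 (hφ.lt_speed hb hk hkc x)
  have hpos' := sub_pos.2 hkc
  have h1 := hφ.first_integral hb hk hkc x
  have hτ : 1 < (c - k) / (c - φ x) := by
    rw [one_lt_div hpos]
    linarith
  have h2 := rpow_mul_lt hb hτ
  have hμ := hφ.momentum_eq hb hk hkc x
  set P := ((c - k) / (c - φ x)) ^ b
  have h3 := mul_lt_mul_of_pos_left h2 (mul_pos hk hpos)
  have e1 : k * (c - φ x) * (P * (b + 1 - (b - 1) * ((c - k) / (c - φ x)))) =
      momentum φ x * ((b + 1) * (c - φ x) - (b - 1) * (c - k)) := by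
    rw [hμ]
    field_simp
  have e2 : k * (c - φ x) * ((b + 1) * ((c - k) / (c - φ x)) - (b - 1)) =
      k * ((b + 1) * (c - k) - (b - 1) * (c - φ x)) := by
    field_simp
  rw [e1, e2] at h3
  have hb' : 0 < b - 1 := by linarith
  rw [← mul_lt_mul_iff_right₀ hb', h1]
  linarith

/-- The quantity is `φ''`, so every critical point is a strict maximum. Above the background this is
the trapezoidal inequality with `φ' = 0`. Below it, the first integral reduces the claim to
positivity of `(k - φ) (2 c - (b + 1) (φ + k))`. -/
theorem sub_momentum_neg_of_deriv_eq_zero (hb : 1 < b) (hk : 0 < k) (hkc : (b + 1) * k < c) {x : ℝ}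
    (hx : deriv φ x = 0) : φ x - momentum φ x < 0 := by
  have hkc' : k < c := by nlinarith
  rcases lt_or_gt_of_ne (hφ.ne_background hb hk hkc' x) with h | h
  · have h1 := hφ.first_integral hb hk hkc' x
    have hpos := sub_pos.2 (hφ.lt_speed hb hk hkc' x)
    rw [hx] at h1
    rw [sub_neg, ← mul_lt_mul_iff_left₀ hpos]
    have h2 : 0 < (k - φ x) * (2 * c - (b + 1) * (φ x + k)) := by
      refine mul_pos (sub_pos.2 h) ?_
      nlinarith
    nlinarith
  · have h1 := hφ.sub_mul_sub_momentum_lt hb hk hkc' h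
    rw [hx, zero_pow two_ne_zero] at h1
    exact (pos_iff_neg_of_mul_neg h1).1 (sub_pos.2 h)

theorem deriv_neg_of_pos (hb : 1 < b) (hk : 0 < k) (hkc : (b + 1) * k < c) {x : ℝ} (hx : 0 < x) :
    deriv φ x < 0 :=
  neg_of_deriv_neg_of_eq_zero hφ.hasDerivAt_deriv
    (fun _ h => hφ.sub_momentum_neg_of_deriv_eq_zero hb hk hkc h) hφ.deriv_zero hx

theorem deriv_pos_of_neg (hb : 1 < b) (hk : 0 < k) (hkc : (b + 1) * k < c) {x : ℝ} (hx : x < 0) :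
    0 < deriv φ x := by
  have := hφ.comp_neg.deriv_neg_of_pos hb hk hkc (neg_pos.2 hx)
  rw [deriv_comp_neg', neg_neg] at this
  linarith

theorem background_lt (hb : 1 < b) (hk : 0 < k) (hkc : (b + 1) * k < c) {x : ℝ} (hx : 0 < x) :
    k < φ x := by
  have hkc' : k < c := by nlinarith
  refine lt_of_le_of_ne ?_ (hφ.ne_background hb hk hkc' x).symm
  have hanti : AntitoneOn φ (Set.Ici x) := by
    refine antitoneOn_of_deriv_nonpos (convex_Ici x) hφ.continuous.continuousOn
      (fun y _ => (hφ.hasDerivAt y).differentiableAt.differentiableWithinAt) fun y hy => ?_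
    rw [interior_Ici] at hy
    exact (hφ.deriv_neg_of_pos hb hk hkc (hx.trans hy)).le
  refine le_of_tendsto hφ.tendsto_atTop ?_
  filter_upwards [eventually_ge_atTop x] with y hy
  exact hanti (Set.mem_Ici.2 le_rfl) hy hy

/-- As a function of `φ`, the difference `φ - μ` vanishes at `k` with slope `1 - k b / (c - k)`,
positive because `(b + 1) k < c`; and `φ` approaches `k` from above. -/
theorem eventually_momentum_le (hb : 1 < b) (hk : 0 < k) (hkc : (b + 1) * k < c) :
    ∀ᶠ x in atTop, momentum φ x ≤ φ x := by
  have hkc' : k < c := by nlinarith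
  have hpos := sub_pos.2 hkc'
  have hd : HasDerivAt (fun s => s - k * ((c - k) / (c - s)) ^ b) (1 - k * (b / (c - k))) k := by
    have h1 := ((hasDerivAt_const k (c - k)).div ((hasDerivAt_id k).const_sub c) hpos.ne')
    have h2 := h1.rpow_const (p := b) (Or.inr hb.le)
    refine ((hasDerivAt_id k).sub (h2.const_mul k)).congr_deriv ?_
    simp only [Pi.div_apply, id, div_self hpos.ne', Real.one_rpow]
    field_simp
    ring
  have hκ : 0 < 1 - k * (b / (c - k)) := by
    rw [sub_pos, ← mul_div_assoc, div_lt_one hpos]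
    linarith
  have h1 := (hasDerivAt_iff_tendsto_slope.1 hd).eventually (lt_mem_nhds hκ)
  have h2 : Tendsto φ atTop (𝓝[≠] k) := tendsto_nhdsWithin_iff.2
    ⟨hφ.tendsto_atTop, Eventually.of_forall fun x => hφ.ne_background hb hk hkc' x⟩
  filter_upwards [h2.eventually h1, eventually_gt_atTop 0] with x hx hx0
  have hkx := sub_pos.2 (hφ.background_lt hb hk hkc hx0)
  rw [slope_def_field, div_self hpos.ne', Real.one_rpow, mul_one, sub_self, sub_zero,
    ← hφ.momentum_eq hb hk hkc'] at hx
  have := (div_pos_iff_of_pos_right hkx).1 hx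
  linarith

/-- On a compact piece `φ'` has no zero. Further out, `k ≤ μ ≤ φ` gives `(φ - μ)² ≤ (φ - k) (φ - μ)
< φ'²`. -/
theorem exists_abs_sub_momentum_le_of_one_le (hb : 1 < b) (hk : 0 < k) (hkc : (b + 1) * k < c) :
    ∃ C, ∀ x, 1 ≤ x → |φ x - momentum φ x| ≤ C * |deriv φ x| := by
  have hkc' : k < c := by nlinarith
  obtain ⟨R, hR⟩ := eventually_atTop.1 (hφ.eventually_momentum_le hb hk hkc)
  have hne : ∀ x ∈ Set.Icc 1 R, deriv φ x ≠ 0 := fun x hx =>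
    (hφ.deriv_neg_of_pos hb hk hkc (one_pos.trans_le hx.1)).ne
  obtain ⟨B, hB⟩ := (isCompact_Icc (a := (1 : ℝ)) (b := R)).exists_bound_of_continuousOn
    (f := fun x => (φ x - momentum φ x) / deriv φ x)
    ((hφ.continuous.sub hφ.continuous_momentum).continuousOn.div
      hφ.continuous_deriv.continuousOn hne)
  refine ⟨max B 1, fun x hx => ?_⟩
  rcases le_total x R with h | h
  · have h1 := hB x ⟨hx, h⟩
    rw [norm_div, Real.norm_eq_abs, Real.norm_eq_abs,
      div_le_iff₀ (abs_pos.2 (hne x ⟨hx, h⟩))] at h1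
    exact h1.trans (mul_le_mul_of_nonneg_right (le_max_left _ _) (abs_nonneg _))
  · have h1 := hR x h
    have hx0 : 0 < x := one_pos.trans_le hx
    have hkx := hφ.background_lt hb hk hkc hx0
    have h2 := hφ.sub_mul_sub_momentum_lt hb hk hkc' hkx
    have hμk : k ≤ momentum φ x := by
      rw [hφ.momentum_eq hb hk hkc']
      refine le_mul_of_one_le_right hk.le (Real.one_le_rpow ?_ (by linarith))
      rw [one_le_div (sub_pos.2 (hφ.lt_speed hb hk hkc' x))]
      linarith
    have h3 : (φ x - momentum φ x) ^ 2 ≤ deriv φ x ^ 2 := by nlinarith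
    refine (sq_le_sq.1 h3).trans ?_
    exact le_mul_of_one_le_left (abs_nonneg _) (le_max_right B 1)

theorem exists_abs_sub_momentum_le (hb : 1 < b) (hk : 0 < k) (hkc : (b + 1) * k < c) :
    ∃ C, ∀ x, 1 ≤ |x| → |φ x - momentum φ x| ≤ C * |deriv φ x| := by
  obtain ⟨C₁, h1⟩ := hφ.exists_abs_sub_momentum_le_of_one_le hb hk hkc
  obtain ⟨C₂, h2⟩ := hφ.comp_neg.exists_abs_sub_momentum_le_of_one_le hb hk hkc
  refine ⟨max C₁ C₂, fun x hx => ?_⟩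
  rcases le_abs.1 hx with h | h
  · exact (h1 x h).trans (mul_le_mul_of_nonneg_right (le_max_left _ _) (abs_nonneg _))
  · have := h2 (-x) h
    rw [momentum_comp_neg, deriv_comp_neg', neg_neg, abs_neg] at this
    exact this.trans (mul_le_mul_of_nonneg_right (le_max_right _ _) (abs_nonneg _))

/-- `φ` is monotone on the half-line with a finite limit. -/
theorem integrableOn_Ioi_deriv (hb : 1 < b) (hk : 0 < k) (hkc : (b + 1) * k < c) :
    IntegrableOn (deriv φ) (Set.Ioi 0) :=
  integrableOn_Ioi_deriv_of_nonpos hφ.continuous.continuousWithinAt (fun x _ => hφ.hasDerivAt x)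
    (fun _ hx => (hφ.deriv_neg_of_pos hb hk hkc hx).le) hφ.tendsto_atTop

theorem integrable_deriv (hb : 1 < b) (hk : 0 < k) (hkc : (b + 1) * k < c) :
    Integrable (deriv φ) := by
  rw [← integrableOn_univ, ← Set.Iic_union_Ioi (a := (0 : ℝ)), integrableOn_union]
  refine ⟨?_, hφ.integrableOn_Ioi_deriv hb hk hkc⟩
  have h := (hφ.comp_neg.integrableOn_Ioi_deriv hb hk hkc).neg
  rw [← integrableOn_Ici_iff_integrableOn_Ioi] at h
  have h2 := (Measure.measurePreserving_neg (volume : Measure ℝ)).integrableOn_comp_preimage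
    (Homeomorph.neg ℝ).measurableEmbedding (f := deriv φ) (s := Set.Iic 0)
  have e1 : deriv φ ∘ Neg.neg = -deriv (fun x => φ (-x)) := by
    funext x
    rw [Pi.neg_apply, deriv_comp_neg', neg_neg]
    rfl
  have e2 : Neg.neg ⁻¹' Set.Iic (0 : ℝ) = Set.Ici 0 := by
    ext x
    simp
  rw [← h2, e2, e1]
  exact h

end IsSolitaryWave

end BCH

/-! ### The Hessian coefficients, the null solution and the conclusion -/

namespace BCH

open scoped BoundedContinuousFunction

/-- A continuous function with finite limits at `±∞` is bounded. -/
theorem exists_boundedContinuousFunction {g : ℝ → ℝ} {l m : ℝ} (hg : Continuous g)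
    (h : Tendsto g atTop (𝓝 l)) (h' : Tendsto g atBot (𝓝 m)) : ∃ G : ℝ →ᵇ ℝ, ⇑G = g := by
  obtain ⟨R, hR⟩ := eventually_atTop.1 (h.norm.eventually (gt_mem_nhds (lt_add_one ‖l‖)))
  obtain ⟨S, hS⟩ := eventually_atBot.1 (h'.norm.eventually (gt_mem_nhds (lt_add_one ‖m‖)))
  obtain ⟨B, hB⟩ := (isCompact_Icc (a := S) (b := R)).exists_bound_of_continuousOn hg.continuousOn
  refine ⟨BoundedContinuousFunction.ofNormedAddCommGroup g hg (max B (max (‖l‖ + 1) (‖m‖ + 1)))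
    fun x => ?_, rfl⟩
  rcases le_total R x with h1 | h1
  · exact (hR x h1).le.trans (le_max_of_le_right (le_max_left _ _))
  · rcases le_total x S with h2 | h2
    · exact (hS x h2).le.trans (le_max_of_le_right (le_max_right _ _))
    · exact (hB x ⟨h2, h1⟩).trans (le_max_left _ _)

namespace IsSolitaryWave

variable {b c k : ℝ} {φ : ℝ → ℝ} (hφ : IsSolitaryWave b c k φ)

include hφ

/-- All coefficients are functions of `(φ, φ', μ)` singular only at `φ = c` or `μ = 0`. The triple
avoids these values and tends to `(k, 0, k)` at both ends, which gives boundedness and the limits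
together. -/
theorem exists_bcf_comp (hb : 1 < b) (hk : 0 < k) (hkc : k < c) (F : ℝ → ℝ → ℝ → ℝ)
    (hF : ∀ s d m, c - s ≠ 0 → m ≠ 0 →
      ContinuousAt (fun z : ℝ × ℝ × ℝ => F z.1 z.2.1 z.2.2) (s, d, m)) :
    ∃ G : ℝ →ᵇ ℝ, (∀ x, G x = F (φ x) (deriv φ x) (momentum φ x)) ∧
      Tendsto G atTop (𝓝 (F k 0 k)) ∧ Tendsto G atBot (𝓝 (F k 0 k)) := by
  have key : ∀ {l : Filter ℝ} {s d m : ℝ}, c - s ≠ 0 → m ≠ 0 → Tendsto φ l (𝓝 s) →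
      Tendsto (deriv φ) l (𝓝 d) → Tendsto (momentum φ) l (𝓝 m) →
      Tendsto (fun x => F (φ x) (deriv φ x) (momentum φ x)) l (𝓝 (F s d m)) :=
    fun h0 h1 hs hd hm => (hF _ _ _ h0 h1).tendsto.comp
      (hs.prodMk_nhds (hd.prodMk_nhds hm))
  have hc : Continuous fun x => F (φ x) (deriv φ x) (momentum φ x) :=
    continuous_iff_continuousAt.2 fun x =>
      key (sub_pos.2 (hφ.lt_speed hb hk hkc x)).ne' (hφ.momentum_pos hb hk hkc x).ne'
        hφ.continuous.continuousAt hφ.continuous_deriv.continuousAt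
        hφ.continuous_momentum.continuousAt
  have ht := key (sub_pos.2 hkc).ne' hk.ne' hφ.tendsto_atTop (hφ.tendsto_deriv_atTop hb hk hkc)
    (hφ.tendsto_momentum_atTop hb hk hkc)
  have ht' := key (sub_pos.2 hkc).ne' hk.ne' hφ.tendsto_atBot (hφ.tendsto_deriv_atBot hb hk hkc)
    (hφ.tendsto_momentum_atBot hb hk hkc)
  obtain ⟨G, hG⟩ := exists_boundedContinuousFunction hc ht ht'
  exact ⟨G, congrFun hG, hG ▸ ht, hG ▸ ht'⟩

theorem deriv_momentum_eq (hb : 1 < b) (hk : 0 < k) (hkc : k < c) (x : ℝ) :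
    deriv (momentum φ) x = b * deriv φ x * momentum φ x / (c - φ x) := by
  rw [eq_div_iff (sub_pos.2 (hφ.lt_speed hb hk hkc x)).ne', mul_comm]
  exact hφ.speed_sub_mul_deriv_momentum x

theorem hasDerivAt_momentum' (hb : 1 < b) (hk : 0 < k) (hkc : k < c) (x : ℝ) :
    HasDerivAt (momentum φ) (b * deriv φ x * momentum φ x / (c - φ x)) x := by
  rw [← hφ.deriv_momentum_eq hb hk hkc]
  exact (hφ.hasDerivAt_momentum x).differentiableAt.hasDerivAt

theorem hasDerivAt_deriv_momentum (hb : 1 < b) (hk : 0 < k) (hkc : k < c) (x : ℝ) :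
    HasDerivAt (deriv (momentum φ)) (b * ((φ x - momentum φ x) * momentum φ x / (c - φ x) +
      (b + 1) * deriv φ x ^ 2 * momentum φ x / (c - φ x) ^ 2)) x := by
  have hpos := sub_pos.2 (hφ.lt_speed hb hk hkc x)
  rw [show deriv (momentum φ) = fun x => b * deriv φ x * momentum φ x / (c - φ x) from
    funext (hφ.deriv_momentum_eq hb hk hkc)]
  refine ((((hφ.hasDerivAt_deriv x).const_mul b).mul (hφ.hasDerivAt_momentum' hb hk hkc x)).div
    ((hφ.hasDerivAt x).const_sub c) hpos.ne').congr_deriv ?_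
  simp only [Pi.mul_apply]
  field_simp
  ring

theorem hasDerivAt_hessianP (hb : 1 < b) (hk : 0 < k) (hkc : k < c) (x : ℝ) :
    HasDerivAt (hessianP c φ) (-(2 * b + 1) * deriv φ x / momentum φ x ^ 2) x := by
  have hpos := sub_pos.2 (hφ.lt_speed hb hk hkc x)
  have hμ := hφ.momentum_pos hb hk hkc x
  refine (((hφ.hasDerivAt x).const_sub c).div ((hφ.hasDerivAt_momentum' hb hk hkc x).pow 2)
    (pow_ne_zero 2 hμ.ne')).congr_deriv ?_
  simp only [Pi.pow_apply]
  norm_num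
  field_simp
  ring

/-- The derivative of the momentum density solves the Sturm--Liouville equation. -/
theorem hasDerivAt_hessianP_mul (hb : 1 < b) (hk : 0 < k) (hkc : k < c) (x : ℝ) :
    HasDerivAt (fun y => hessianP c φ y * (b * ((φ y - momentum φ y) * momentum φ y / (c - φ y) +
      (b + 1) * deriv φ y ^ 2 * momentum φ y / (c - φ y) ^ 2)))
      (hessianQ b c k φ x * deriv (momentum φ) x) x := by
  have hpos := sub_pos.2 (hφ.lt_speed hb hk hkc x)
  have hμ := hφ.momentum_pos hb hk hkc x
  have e : (fun y => hessianP c φ y * (b * ((φ y - momentum φ y) * momentum φ y / (c - φ y) +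
      (b + 1) * deriv φ y ^ 2 * momentum φ y / (c - φ y) ^ 2))) =
      fun y => b * ((φ y - momentum φ y) / momentum φ y +
        (b + 1) * (deriv φ y ^ 2 / ((c - φ y) * momentum φ y))) := by
    funext y
    have hpos := sub_pos.2 (hφ.lt_speed hb hk hkc y)
    have hμ := hφ.momentum_pos hb hk hkc y
    rw [hessianP]
    field_simp
  rw [e]
  have d1 := hφ.hasDerivAt x
  have d2 := hφ.hasDerivAt_deriv x
  have d3 := hφ.hasDerivAt_momentum' hb hk hkc x
  have h := (((d1.sub d3).div d3 hμ.ne').add (((d2.pow 2).div ((d1.const_sub c).mul d3)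
    (mul_pos hpos hμ).ne').const_mul (b + 1))).const_mul b
  refine h.congr_deriv ?_
  have hI := hφ.first_integral hb hk hkc x
  have hb0 : b ≠ 0 := by linarith
  rw [hessianQ, iteratedDeriv_succ, iteratedDeriv_one,
    (hφ.hasDerivAt_deriv_momentum hb hk hkc x).deriv, hφ.deriv_momentum_eq hb hk hkc]
  simp only [Pi.mul_apply, Pi.pow_apply, Pi.sub_apply]
  norm_num
  generalize momentum φ x = m at *
  generalize deriv φ x = d at *
  obtain ⟨y, hy⟩ : ∃ y, y = c - φ x := ⟨_, rfl⟩
  have hs : φ x = c - y := by linarith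
  rw [← hy] at hpos ⊢
  rw [hs] at hI ⊢
  rw [← sub_eq_zero]
  -- Up to sign, the defect in the equation is this multiple of the first integral, so it vanishes.
  have : b * d / (2 * y ^ 2 * m) * ((b - 1) * d ^ 2 - ((b - 1) * (c - y) ^ 2 - 2 * m * (c - (c - y)) +
    k * (2 * c - (b + 1) * k))) = 0 := by rw [hI]; ring
  rw [← neg_eq_zero, ← this]
  field_simp
  ring

/-- `φ'` is both integrable and bounded. -/
theorem memLp_deriv (hb : 1 < b) (hk : 0 < k) (hkc : (b + 1) * k < c) :
    MemLp (fun x => ((deriv φ x : ℝ) : ℂ)) 2 volume := by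
  have hkc' : k < c := by nlinarith
  obtain ⟨g, hg, -⟩ := hφ.exists_bcf_comp hb hk hkc' (fun _ d _ => d)
    fun s d m _ _ => by fun_prop
  refine (memLp_two_iff_integrable_sq_norm
    (Complex.continuous_ofReal.comp hφ.continuous_deriv).aestronglyMeasurable).2 ?_
  refine ((hφ.integrable_deriv hb hk hkc).bdd_mul (c := ‖g‖) g.continuous.aestronglyMeasurable
    (Eventually.of_forall g.norm_coe_le_norm)).congr (Eventually.of_forall fun x => ?_)
  simp only [hg, Function.comp_apply, Complex.norm_real, Real.norm_eq_abs, sq_abs]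
  ring

/-- The Hessian operator has admissible coefficients, and the derivative of the momentum density
is a null solution with a single zero. -/
theorem exists_coeff (hb : 1 < b) (hk : 0 < k) (hkc : (b + 1) * k < c) :
    ∃ A : Coeff, ⇑A.p = hessianP c φ ∧ ⇑A.q = hessianQ b c k φ ∧
      (∃ P, Tendsto A.p atTop (𝓝 P)) ∧ Tendsto A.p' atTop (𝓝 0) ∧
      Tendsto A.q atTop (𝓝 ((c - (b + 1) * k) / k ^ 2)) ∧
      Tendsto A.q atBot (𝓝 ((c - (b + 1) * k) / k ^ 2)) ∧
      ∃ w w' : ℝ →ᵇ ℝ, A.NullSolution w w' ∧ ⇑w = deriv (momentum φ) := by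
  have hkc' : k < c := by nlinarith
  have hb0 : b ≠ 0 := by linarith
  have hpos := fun x => sub_pos.2 (hφ.lt_speed hb hk hkc' x)
  have hμ := hφ.momentum_pos hb hk hkc'
  obtain ⟨p, hp, hp1, -⟩ := hφ.exists_bcf_comp hb hk hkc' (fun s _ m => (c - s) / m ^ 2)
    fun s d m h1 h2 => by fun_prop (disch := exact pow_ne_zero 2 h2)
  -- The reciprocal of `p`; its boundedness yields the ellipticity constant.
  obtain ⟨i, hi, -⟩ := hφ.exists_bcf_comp hb hk hkc' (fun s _ m => m ^ 2 / (c - s))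
    fun s d m h1 h2 => by fun_prop (disch := exact h1)
  obtain ⟨p', hp', hp'1, -⟩ := hφ.exists_bcf_comp hb hk hkc'
    (fun _ d m => -(2 * b + 1) * d / m ^ 2)
    fun s d m h1 h2 => by fun_prop (disch := exact pow_ne_zero 2 h2)
  -- The bounded functions `a` and `e` factor `w = a φ'` and `w' = a ((φ - μ) + e φ')`, which gives
  -- `w ∈ L²` and the bound on `w' / w`.
  obtain ⟨a, ha, -⟩ := hφ.exists_bcf_comp hb hk hkc' (fun s _ m => b * m / (c - s))
    fun s d m h1 h2 => by fun_prop (disch := exact h1)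
  obtain ⟨e, he, -⟩ := hφ.exists_bcf_comp hb hk hkc' (fun s d _ => (b + 1) * d / (c - s))
    fun s d m h1 h2 => by fun_prop (disch := exact h1)
  obtain ⟨w, hw, -⟩ := hφ.exists_bcf_comp hb hk hkc' (fun s d m => b * d * m / (c - s))
    fun s d m h1 h2 => by fun_prop (disch := exact h1)
  obtain ⟨w', hw', -⟩ := hφ.exists_bcf_comp hb hk hkc'
    (fun s d m => b * ((s - m) * m / (c - s) + (b + 1) * d ^ 2 * m / (c - s) ^ 2))
    fun s d m h1 h2 => by
      have h3 := pow_ne_zero 2 h1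
      fun_prop (disch := assumption)
  obtain ⟨q, hq, hq1, hq2⟩ := hφ.exists_bcf_comp hb hk hkc'
    (fun s d m => (b + 1) * (c - s) / (2 * m ^ 2)
      + (2 * b + 1) * (c - s) *
        (b * ((s - m) * m / (c - s) + (b + 1) * d ^ 2 * m / (c - s) ^ 2)) / (b * m ^ 3)
      - (2 * b + 1) * (3 * b + 1) * (c - s) * (b * d * m / (c - s)) ^ 2 / (2 * b ^ 2 * m ^ 4)
      - (c - k) * ((b - 1) * c + (b + 1) * k) / (2 * (c - s) * m ^ 2))
    fun s d m h1 h2 => by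
      have h3 := pow_ne_zero 2 h1
      have h4 : 2 * m ^ 2 ≠ 0 := by positivity
      have h5 : b * m ^ 3 ≠ 0 := by positivity
      have h6 : 2 * b ^ 2 * m ^ 4 ≠ 0 := by positivity
      have h7 : 2 * (c - s) * m ^ 2 ≠ 0 := by positivity
      fun_prop (disch := assumption)
  have hpeq : ⇑p = hessianP c φ := funext hp
  have hweq : ⇑w = deriv (momentum φ) := by
    funext x
    rw [hw, hφ.deriv_momentum_eq hb hk hkc']
  have hqeq : ⇑q = hessianQ b c k φ := by
    funext x
    rw [hq, hessianQ, iteratedDeriv_succ, iteratedDeriv_one,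
      (hφ.hasDerivAt_deriv_momentum hb hk hkc' x).deriv, hφ.deriv_momentum_eq hb hk hkc']
  have hwd : ∀ x, HasDerivAt w (w' x) x := by
    intro x
    rw [hweq, hw']
    exact hφ.hasDerivAt_deriv_momentum hb hk hkc' x
  have hlim : (b + 1) * (c - k) / (2 * k ^ 2)
      + (2 * b + 1) * (c - k) *
        (b * ((k - k) * k / (c - k) + (b + 1) * 0 ^ 2 * k / (c - k) ^ 2)) / (b * k ^ 3)
      - (2 * b + 1) * (3 * b + 1) * (c - k) * (b * 0 * k / (c - k)) ^ 2 / (2 * b ^ 2 * k ^ 4)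
      - (c - k) * ((b - 1) * c + (b + 1) * k) / (2 * (c - k) * k ^ 2) =
      (c - (b + 1) * k) / k ^ 2 := by
    have := (sub_pos.2 hkc').ne'
    field_simp
    ring
  rw [hlim] at hq1 hq2
  simp only [mul_zero, zero_div] at hp'1
  have hpd : ∀ x, HasDerivAt p (p' x) x := by
    intro x
    rw [hpeq, hp']
    exact hφ.hasDerivAt_hessianP hb hk hkc' x
  have hlow : ∀ x, (‖i‖ + 1)⁻¹ ≤ p x := by
    intro x
    have h1 : p x = (i x)⁻¹ := by rw [hp, hi, inv_div]
    have h2 : 0 < i x := by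
      rw [hi]
      exact div_pos (pow_pos (hμ x) 2) (hpos x)
    rw [h1]
    refine inv_anti₀ h2 ?_
    linarith [(abs_le.1 (i.norm_coe_le_norm x)).2]
  have hLw : MemLp (fun x => (w x : ℂ)) 2 volume := by
    have h := memLp_bcf_mul_fun a (hφ.memLp_deriv hb hk hkc)
    refine h.ae_eq (Eventually.of_forall fun x => ?_)
    simp only [ha, hw]
    push_cast
    ring
  obtain ⟨C, hC⟩ := hφ.exists_abs_sub_momentum_le hb hk hkc
  have hbound : ∀ x, 1 ≤ |x| → |w' x| ≤ (|C| + ‖e‖) * |w x| := by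
    intro x hx
    have h1 : w' x = a x * ((φ x - momentum φ x) + e x * deriv φ x) := by
      rw [hw', ha, he]
      have := (hpos x).ne'
      field_simp
    have h2 : w x = a x * deriv φ x := by
      rw [hw, ha]
      ring
    rw [h1, h2, abs_mul, abs_mul, mul_left_comm]
    refine mul_le_mul_of_nonneg_left ?_ (abs_nonneg _)
    refine (abs_add_le _ _).trans ?_
    rw [add_mul, abs_mul]
    exact add_le_add ((hC x hx).trans
      (mul_le_mul_of_nonneg_right (le_abs_self C) (abs_nonneg _))) (mul_le_mul_of_nonneg_right (e.norm_coe_le_norm x) (abs_nonneg _))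
  -- `w'` is dominated by `w` outside `[-1, 1]` and bounded inside.
  have hLw' : MemLp (fun x => (w' x : ℂ)) 2 volume := by
    have h1 : MemLp ((Set.Icc (-1 : ℝ) 1).indicator fun _ => ‖w'‖) 2 volume :=
      memLp_indicator_const 2 measurableSet_Icc _ (Or.inr (by simp))
    refine ((hLw.norm.const_mul (|C| + ‖e‖)).add h1).mono
      (Complex.continuous_ofReal.comp w'.continuous).aestronglyMeasurable
      (Eventually.of_forall fun x => ?_)
    refine le_trans ?_ (le_abs_self _)
    rw [Complex.norm_real, Pi.add_apply, Complex.norm_real]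
    by_cases hx : x ∈ Set.Icc (-1 : ℝ) 1
    · rw [Set.indicator_of_mem hx]
      refine (w'.norm_coe_le_norm x).trans (le_add_of_nonneg_left ?_)
      positivity
    · rw [Set.indicator_of_notMem hx, add_zero]
      refine hbound x ?_
      by_contra! h
      rw [abs_lt] at h
      exact hx ⟨h.1.le, h.2.le⟩
  refine ⟨⟨p, p', q, hpd, _, by positivity, hlow⟩, hpeq, hqeq, ⟨_, hp1⟩, hp'1, hq1, hq2, w, w',
    ⟨hwd, fun x => ?_, ?_, ?_, fun x hx => ?_, fun x hx => ?_, ⟨_, hbound⟩, hLw, hLw'⟩, hweq⟩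
  · have h := hφ.hasDerivAt_hessianP_mul hb hk hkc' x
    rw [← hqeq, ← hweq, ← hpeq] at h
    simp_rw [← hw'] at h
    exact h
  · rw [hw, hφ.deriv_zero]
    simp
  · rw [hw', hφ.deriv_zero]
    have h1 := hφ.sub_momentum_neg_of_deriv_eq_zero hb hk hkc hφ.deriv_zero
    have h2 := (hpos 0).ne'
    have h3 := (hμ 0).ne'
    simp [hb0, h1.ne, h2, h3]
  · rw [hw]
    have h1 := hφ.deriv_neg_of_pos hb hk hkc hx
    have h2 := mul_pos (mul_pos (by linarith : 0 < b) (neg_pos.2 h1)) (hμ x)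
    exact div_neg_of_neg_of_pos (by linarith) (hpos x)
  · rw [hw]
    exact div_pos (mul_pos (mul_pos (by linarith) (hφ.deriv_pos_of_neg hb hk hkc hx)) (hμ x))
      (hpos x)

end IsSolitaryWave

end BCH

theorem lemma3 (b c k : ℝ) (hb : 1 < b) (hc : 0 < c) (hk : k ∈ Set.Ioo 0 ((b + 1)⁻¹ * c))
    (φ : ℝ → ℝ) (hφ : BCH.IsSolitaryWave b c k φ) :
    -- on test functions the operator is the classical differential expression
    (∀ (u : ℝ → ℂ) (hu : MemLp u 2 volume), ContDiff ℝ ∞ u → HasCompactSupport u →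
      ∃ h : hu.toLp u ∈ (BCH.hessian b c k φ).domain,
        ∀ᵐ x, BCH.hessian b c k φ ⟨hu.toLp u, h⟩ x =
          -deriv (fun y => (BCH.hessianP c φ y : ℂ) * deriv u y) x + (BCH.hessianQ b c k φ x : ℂ) * u x) ∧
    -- self-adjointness on the dense domain `H²(ℝ)`
    (BCH.hessian b c k φ).domain = BCH.sobolevH2 ∧
    Dense (BCH.sobolevH2 : Set BCH.L2) ∧
    IsSelfAdjoint (BCH.hessian b c k φ) ∧
    -- the essential spectrum
    BCH.essentialSpectrum (BCH.hessian b c k φ) =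
      (fun r : ℝ => (r : ℂ)) '' Set.Ici ((c - (b + 1) * k) / k ^ 2) ∧
    -- the spectrum below some positive level
    (∃ δ : ℝ, 0 < δ ∧ ∃ E₀ : ℝ, E₀ < 0 ∧
      {z ∈ BCH.spectrum (BCH.hessian b c k φ) | z.re < δ} = {(E₀ : ℂ), 0} ∧
      BCH.IsSimpleEigenvalue (BCH.hessian b c k φ) (E₀ : ℂ) ∧
      BCH.IsSimpleEigenvalue (BCH.hessian b c k φ) 0) ∧
    -- the kernel
    ∃ h : MemLp (fun x => ((deriv (BCH.momentum φ) x : ℝ) : ℂ)) 2 volume,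
      BCH.eigenspace (BCH.hessian b c k φ) 0 = Submodule.span ℂ {h.toLp _} := by
  have hb1 : 0 < b + 1 := by linarith
  have hk0 : 0 < k := hk.1
  have hkc : (b + 1) * k < c := by
    have := mul_lt_mul_of_pos_left hk.2 hb1
    rwa [mul_inv_cancel_left₀ hb1.ne'] at this
  obtain ⟨A, hp, hq, ⟨P, hP⟩, hp', hq1, hq2, w, w', hw, hwμ⟩ := hφ.exists_coeff hb hk0 hkc
  have hL : 0 < (c - (b + 1) * k) / k ^ 2 := div_pos (by linarith) (by positivity)
  -- A level strictly between `0` and the bottom of the essential spectrum, so that `0` is still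
  -- covered by the form bound.
  obtain ⟨a, ha, haL⟩ := exists_between hL
  rw [BCH.hessian, ← hp, ← hq, ← hwμ]
  exact ⟨fun u hu hc hs => A.apply_toLp_of_contDiff hu hc hs, A.domain_eq,
    BCH.Coeff.dense_sobolevH2, A.isSelfAdjoint, A.essentialSpectrum_eq hP hp' hq1 hq2,
    hw.spectrum_below ha (A.hasFormBound_of_tendsto hq1 hq2 haL), hw.memLp, hw.eigenspace_zero⟩
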